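/- **Setting.** Let $m\ge 0$ and let $k_1,\dots,k_m\in\mathbb C$ be nonzero levels. Consider $m$ decoupled copies (the usual case is $m=1$) of the holomorphic–topological (HT) twist on $\mathbb C_z\times\mathbb R_t$ of BLG theory: gauge algebra $\mathfrak g=\mathfrak{so}(4)\cong\mathfrak{sl}(2)\oplus\mathfrak{sl}(2)$ with the invariant pairing $\mathrm{Tr}(XY)=\tfrac14\epsilon_{stuv}X_{st}Y_{uv}$, and matter in four copies of $R=\mathbb C^4$. In each copy the twisted superfields are $\mathbf A\in\Omega^{(0),\bullet}\otimes\mathfrak g[1]$, $\mathbf B\in\Omega^{(1),\bullet}\otimes\mathfrak g^*$, $\mathbf Z^I\in\Omega^{(1/4),\bullet}\otimes R$, $\mathbf\Psi_I\in\Omega^{(3/4),\bullet}\otimes R^*[1]$ ($1\le I\le 4$), where $\Omega^{(j),\bullet}=C^\infty[dt,d\bar z]\,dz^j$; $\mathbf A,\mathbf\Psi$ are odd and $\mathbf B,\mathbf Z$ even. Put $d'=dt\,\partial_t+d\bar z\,\partial_{\bar z}$ and $\partial=dz\,\partial_z$. Local functionals are superfield differential polynomials (supercommutative polynomials in $\partial^n\phi$,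 $\partial^n d'\phi$ with entire functions of $z$ as coefficients) modulo the images of $\partial$ and $d'$. The BV bracket is the odd, graded symmetric bracket of local functionals with $\{\mathbf A,\mathbf B\}=\{\mathbf Z,\mathbf\Psi\}=\delta$; set $[F,G]=(-1)^{|F|}\{F,G\}$, a Lie superbracket after parity shift. The action is the sum over the copies of $$\int \mathbf B F'(\mathbf A)+\tfrac{k}{4\pi}\mathrm{Tr}(\mathbf A\,\partial\mathbf A)+\mathbf\Psi_I\, d'_{\mathbf A}\mathbf Z^I+\tfrac{\pi}{2\cdot 3!\,k}\,\epsilon_{IJKL}\,K^{ab}\rho_a(\mathbf Z^I,\mathbf Z^J)\rho_b(\mathbf Z^K,\mathbf Z^L),$$ with $F'(\mathbf A)=d'\mathbf A+\mathbf A^2$, $d'_{\mathbf A}=d'+\mathbf A$ and $K^{ab}(\rho_a)_{st}(\rho_b)_{uv}=\epsilon_{stuv}$. Write $S$ for the action. A local functional $F$ is $Q_{HT}$-closed if $\{S,F\}=0$ and $Q_{HT}$-exact if $F=\{S,H\}$ for some $H$. **Currents.** Let $\partial_{\mathbf B}=\partial-\tfrac{2\pi}{k}\mathbf B$, where $\mathbf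 B$ acts through $\mathrm{Tr}$. For $V\in\mathrm{Vect}(\mathbb C)$ holomorphic, $U\in\mathcal O_{\mathbb C}\otimes\mathfrak{sl}(4)$, $\Gamma\in K_{\mathbb C}^{-1/2}\otimes\bigwedge^2\mathbb C^4$ and $\Sigma\in K_{\mathbb C}^{1/2}\otimes\mathrm{Sym}^2(\mathbb C^4)^*$ (all entire in $z$; $\Gamma,\Sigma$ odd parameters) put, summing over the copies, $$\mathbf T_V=V\big(-\mathbf B\,\partial\mathbf A+\tfrac34\mathbf\Psi_I\,\partial\mathbf Z^I-\tfrac14\mathbf Z^I\partial\mathbf\Psi_I\big),\qquad \widehat{\mathbf T}_V=V\big(\tfrac34\mathbf\Psi_I\,\partial_{\mathbf B}\mathbf Z^I-\tfrac14\mathbf Z^I\partial_{\mathbf B}\mathbf\Psi_I\big),\qquad \mathbf L_U=U^I{}_J\mathbf\Psi_I\mathbf Z^J,$$ $$\mathbf\Theta_\Gamma=\tfrac12\Gamma^{IJ}\big(\mathbf\Psi_I\mathbf\Psi_J-\tfrac12\epsilon_{IJKL}\mathbf Z^K\partial_{\mathbf B}\mathbf Z^L\big),\qquad \mathbf\Xi_\Sigma=\tfrac12\Sigma_{IJ}\mathbf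 Z^I\mathbf Z^J .$$ Let $\mathbf J=\mathbf T_V+\mathbf L_U+\mathbf\Theta_\Gamma+\mathbf\Xi_\Sigma$ and $\widehat{\mathbf J}=\widehat{\mathbf T}_V+\mathbf L_U+\mathbf\Theta_\Gamma+\mathbf\Xi_\Sigma$ be the currents of $(V,U,\Gamma,\Sigma)$. **The algebra.** Let $K(1|6)$ be the space $\mathcal O(\mathbb C)\otimes\Lambda(\xi_1,\dots,\xi_6)$ of entire superfunctions with the contact bracket $$\{f,g\}=(2-E)f\,\partial_z g-\partial_z f\,(2-E)g+(-1)^{|f|}\sum_i\partial_{\xi_i}f\,\partial_{\xi_i}g,\qquad E=\sum_i\xi_i\partial_{\xi_i}.$$ The analytic exceptional Lie superalgebra $E(1|6)\subset K(1|6)$ is the span of the elements $f-i(-1)^{|f|(|f|+1)/2}\partial_z^{3-|f|}f^*$ with $f$ homogeneous of degree $|f|\le 3$ in the $\xi_i$, where $f^*$ is the Hodge dual, $\xi_S\,\xi_S^*=\xi_1\cdots\xi_6$. **Theorem.** The HT twist of BLG theory admits an action of $E(1|6)$ by these currents. Precisely, $E(1|6)$ is closed under the contact bracket, and there is a parity preserving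 linear isomorphism $$E(1|6)\;\cong\;\mathrm{Vect}(\mathbb C)\oplus\mathcal O_{\mathbb C}\otimes\mathfrak{sl}(4)\oplus\Pi\big(K_{\mathbb C}^{-1/2}\otimes\textstyle\bigwedge^2\mathbb C^4\oplus K_{\mathbb C}^{1/2}\otimes\mathrm{Sym}^2(\mathbb C^4)^*\big)$$ such that, writing $\mathbf J_x,\widehat{\mathbf J}_x$ for the currents of the image of $x\in E(1|6)$, for all $x,y\in E(1|6)$: 1. $\int\mathbf J_x$ and $\int\widehat{\mathbf J}_x$ are $Q_{HT}$-closed, and $\int\widehat{\mathbf J}_x-\int\mathbf J_x$ is $Q_{HT}$-exact; 2. $[\int\widehat{\mathbf J}_x,\int\widehat{\mathbf J}_y]=\int\widehat{\mathbf J}_{\{x,y\}}$ exactly; 3. $[\int\mathbf J_x,\int\mathbf J_y]=\int\mathbf J_{\{x,y\}}$ up to a $Q_{HT}$-exact local functional. -/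

import Mathlib

noncomputable section

/-! ## Entire functions -/

/-- The algebra `𝒪(ℂ)` of entire functions. -/
def Entire : Subalgebra ℂ (ℂ → ℂ) where
  carrier := {f | Differentiable ℂ f}
  mul_mem' hf hg := Differentiable.mul hf hg
  add_mem' hf hg := Differentiable.add hf hg
  algebraMap_mem' r := differentiable_const r

/-- The derivation `∂_z` of `𝒪(ℂ)`. -/
def Entire.der : Entire →ₗ[ℂ] Entire where
  toFun f := ⟨deriv f.1, Differentiable.deriv f.2⟩
  map_add' f g := Subtype.ext <| funext fun z => deriv_add (f.2 z) (g.2 z)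
  map_smul' r f := Subtype.ext <| funext fun z => deriv_const_smul r (f.2 z)

theorem Entire.der_mul (f g : Entire) :
    Entire.der (f * g) = f * Entire.der g + Entire.der f * g :=
  Subtype.ext <| funext fun z => by
    have h := deriv_mul (f.2 z) (g.2 z)
    simp only [Entire.der, LinearMap.coe_mk, AddHom.coe_mk, Subalgebra.coe_mul,
      Subalgebra.coe_add, Pi.mul_apply, Pi.add_apply]
    rw [h]; ring

theorem Entire.der_const (r : ℂ) : Entire.der (algebraMap ℂ Entire r) = 0 :=
  Subtype.ext <| funext fun z => deriv_const z r

/-! ## The exceptional Lie superalgebra `E(1|6)` inside the contact superalgebra `K(1|6)`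

Everything is over entire functions of the even variable `z`. -/

/-- The sign with `ξ_S ξ_T = superSign S T • ξ_{S ∪ T}` for disjoint `S`, `T`, where
`ξ_S` is the product of the odd variables `ξ_i`, `i ∈ S`, in increasing order. -/
def superSign (S T : Finset (Fin 6)) : ℂ :=
  (-1) ^ ((S ×ˢ T).filter fun p => p.2 < p.1).card

/-- Superfunctions `∑_S f_S(z) ξ_S` on `ℂ^{1|6}`: the underlying space of `K(1|6)`. -/
abbrev SuperFun : Type := Finset (Fin 6) → Entire

namespace SuperFun

/-- The product of superfunctions. -/
def mul (f g : SuperFun) : SuperFun := fun U =>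
  ∑ S ∈ U.powerset, superSign S (U \ S) • (f S * g (U \ S))

/-- `∂_z`. -/
def dz (f : SuperFun) : SuperFun := fun S => Entire.der (f S)

/-- The left derivative `∂/∂ξ_i`. -/
def dxi (i : Fin 6) (f : SuperFun) : SuperFun := fun S =>
  if i ∈ S then 0 else superSign {i} S • f (insert i S)

/-- `2 - E`, where `E = ∑ ξ_i ∂/∂ξ_i` is the Euler operator of the odd variables. -/
def twoSubEuler (f : SuperFun) : SuperFun := fun S => ((2 : ℂ) - (S.card : ℂ)) • f S

/-- The parity involution `f ↦ (-1)^{|f|} f`. -/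
def invol (f : SuperFun) : SuperFun := fun S => ((-1 : ℂ) ^ S.card) • f S

/-- The contact bracket of `K(1|6)`:
`{f, g} = (2 - E)f ∂_z g - ∂_z f (2 - E)g + (-1)^{|f|} ∑ ∂_{ξ_i} f ∂_{ξ_i} g`. -/
def contactBracket (f g : SuperFun) : SuperFun :=
  mul (twoSubEuler f) (dz g) - mul (dz f) (twoSubEuler g)
    + ∑ i : Fin 6, mul (dxi i (invol f)) (dxi i g)

/-- `f` is even: only the `ξ_S` with `|S|` even occur. -/
def IsEven (f : SuperFun) : Prop := ∀ S, Odd S.card → f S = 0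

/-- `f` is odd: only the `ξ_S` with `|S|` odd occur. -/
def IsOdd (f : SuperFun) : Prop := ∀ S, Even S.card → f S = 0

/-- Superfunctions of degree at most three in the odd variables. -/
def lowDegree : Submodule ℂ SuperFun where
  carrier := {f | ∀ S, 3 < S.card → f S = 0}
  zero_mem' _ _ := rfl
  add_mem' {f g} hf hg S hS := by
    show f S + g S = 0
    rw [hf S hS, hg S hS, add_zero]
  smul_mem' r f hf S hS := by
    show r • f S = 0
    rw [hf S hS, smul_zero]

/-- The map `f ↦ f - i (-1)^{|f|(|f|+1)/2} ∂_z^{3-|f|} f^*`, where `|f|` is the degree of `f`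
in the odd variables and `f^*` the Hodge dual, `ξ_S (ξ_S)^* = ξ_1 ⋯ ξ_6`.
It is used on superfunctions of degree at most three only. -/
def ckMap : SuperFun →ₗ[ℂ] SuperFun where
  toFun f := fun U => f U -
    (Complex.I * (-1) ^ (Uᶜ.card * (Uᶜ.card + 1) / 2) * superSign Uᶜ U) •
      ((Entire.der ^ (3 - Uᶜ.card)) (f Uᶜ))
  map_add' f g := funext fun U => by
    simp only [Pi.add_apply, map_add, smul_add]; abel
  map_smul' r f := funext fun U => by
    simp only [Pi.smul_apply, map_smul, RingHom.id_apply, smul_sub]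
    rw [smul_comm]

end SuperFun

/-- The exceptional Lie superalgebra `E(1|6)` (the Cheng–Kac superalgebra `CK_6^{≥0}`), in its
analytic version: the subspace of `K(1|6)` spanned by the
`f - i (-1)^{|f|(|f|+1)/2} ∂_z^{3-|f|} f^*`, `|f| ≤ 3`, with the contact bracket. -/
def E16 : Submodule ℂ SuperFun := SuperFun.lowDegree.map SuperFun.ckMap

/-! ## Superfields and their jets -/

/-- Labels of a basis of `𝔰𝔬(4)`: pairs `u < v`. -/
abbrev GaugeIdx : Type := {p : Fin 4 × Fin 4 // p.1 < p.2}

/-- The component twisted superfields of `m` decoupled copies of the theory with gauge algebra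
`𝔰𝔬(4)` and matter in four copies of the vector representation `R = ℂ⁴`. The form components
of a superfield (fields, antifields, ghosts, antighosts) are kept together. -/
inductive Superfield (m : ℕ) : Type
  /-- `𝐀 ∈ Ω^{(0),•} ⊗ 𝔤[1]` -/
  | A (c : Fin m) (p : GaugeIdx)
  /-- `𝐁 ∈ Ω^{(1),•} ⊗ 𝔤^*` -/
  | B (c : Fin m) (p : GaugeIdx)
  /-- `𝐙^I ∈ Ω^{(1/4),•} ⊗ R`, with gauge index `u` -/
  | Z (c : Fin m) (I u : Fin 4)
  /-- `𝚿_I ∈ Ω^{(3/4),•} ⊗ R^*[1]`, with gauge index `u` -/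
  | Psi (c : Fin m) (I u : Fin 4)
  deriving DecidableEq

/-- The parity of a superfield (`true` is odd). -/
def Superfield.odd {m : ℕ} : Superfield m → Bool
  | .A _ _ => true
  | .B _ _ => false
  | .Z _ _ _ => false
  | .Psi _ _ _ => true

/-- The jet `∂_z^n φ` (`hor = false`) or `∂_z^n d'φ` (`hor = true`) of a superfield `φ`, where
`d' = dt ∂_t + dz̄ ∂_z̄` is the differential along the leaves. As `d'² = 0` there are no others. -/
structure Jet (m : ℕ) : Type where
  field : Superfield m
  order : ℕ
  hor : Bool
  deriving DecidableEq

/-- Generators of the algebra of local densities: coefficient functions and jets. -/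
abbrev Gen (m : ℕ) : Type := Entire ⊕ Jet m

/-- The parity of a generator; `d'` is odd. -/
def Gen.odd {m : ℕ} : Gen m → Bool
  | .inl _ => false
  | .inr j => xor j.field.odd j.hor

/-- The Koszul sign `(-1)^{ab}`. -/
def koszul (a b : Bool) : ℂ := if a && b then -1 else 1

/-- Relations among generators: coefficient functions multiply as functions, and all generators
supercommute. -/
inductive LocalRel (m : ℕ) : FreeAlgebra ℂ (Gen m) → FreeAlgebra ℂ (Gen m) → Prop
  | coef_add (f g : Entire) : LocalRel m (FreeAlgebra.ι ℂ (.inl (f + g)))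
      (FreeAlgebra.ι ℂ (.inl f) + FreeAlgebra.ι ℂ (.inl g))
  | coef_mul (f g : Entire) : LocalRel m (FreeAlgebra.ι ℂ (.inl (f * g)))
      (FreeAlgebra.ι ℂ (.inl f) * FreeAlgebra.ι ℂ (.inl g))
  | coef_const (r : ℂ) : LocalRel m (FreeAlgebra.ι ℂ (.inl (algebraMap ℂ Entire r)))
      (algebraMap ℂ _ r)
  | supercomm (x y : Gen m) : LocalRel m (FreeAlgebra.ι ℂ x * FreeAlgebra.ι ℂ y)
      (koszul x.odd y.odd • (FreeAlgebra.ι ℂ y * FreeAlgebra.ι ℂ x))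

/-- The algebra of local densities: the free supercommutative algebra over the entire functions
of `z` on all jets of the superfields (superfield differential polynomials). -/
def Density (m : ℕ) : Type := RingQuot (LocalRel m)

namespace Density

variable {m : ℕ}

instance : Ring (Density m) := inferInstanceAs (Ring (RingQuot (LocalRel m)))

instance : Algebra ℂ (Density m) := inferInstanceAs (Algebra ℂ (RingQuot (LocalRel m)))

/-- The quotient map from the free algebra. -/
def mk : FreeAlgebra ℂ (Gen m) →ₐ[ℂ] Density m := RingQuot.mkAlgHom ℂ (LocalRel m)

theorem mk_rel {a b : FreeAlgebra ℂ (Gen m)} (h : LocalRel m a b) : mk a = mk b :=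
  RingQuot.mkAlgHom_rel ℂ h

theorem mk_surjective : Function.Surjective (mk (m := m)) :=
  RingQuot.mkAlgHom_surjective ℂ (LocalRel m)

/-- The universal property of the algebra of local densities. -/
def lift {B : Type} [Ring B] [Algebra ℂ B] (f : FreeAlgebra ℂ (Gen m) →ₐ[ℂ] B)
    (h : ∀ ⦃a b⦄, LocalRel m a b → f a = f b) : Density m →ₐ[ℂ] B :=
  RingQuot.liftAlgHom ℂ ⟨f, h⟩

theorem lift_mk {B : Type} [Ring B] [Algebra ℂ B] (f : FreeAlgebra ℂ (Gen m) →ₐ[ℂ] B)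
    (h : ∀ ⦃a b⦄, LocalRel m a b → f a = f b) (a : FreeAlgebra ℂ (Gen m)) :
    lift f h (mk a) = f a :=
  RingQuot.liftAlgHom_mkAlgHom_apply ℂ f h a

/-- A generator as a density. -/
def gen (x : Gen m) : Density m := mk (FreeAlgebra.ι ℂ x)

/-- A coefficient function as a density. -/
def coef (f : Entire) : Density m := gen (.inl f)

/-- A superfield as a density. -/
def fld (φ : Superfield m) : Density m := gen (.inr ⟨φ, 0, false⟩)

theorem coef_add (f g : Entire) : (coef (f + g) : Density m) = coef f + coef g :=
  (mk_rel (LocalRel.coef_add f g)).trans (map_add _ _ _)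

theorem coef_mul (f g : Entire) : (coef (f * g) : Density m) = coef f * coef g :=
  (mk_rel (LocalRel.coef_mul f g)).trans (map_mul _ _ _)

theorem coef_const (r : ℂ) :
    (coef (algebraMap ℂ Entire r) : Density m) = algebraMap ℂ _ r :=
  (mk_rel (LocalRel.coef_const r)).trans (AlgHom.commutes _ _)

theorem gen_comm (x y : Gen m) : gen x * gen y = koszul x.odd y.odd • (gen y * gen x) := by
  have h := mk_rel (LocalRel.supercomm x y)
  rw [map_smul, map_mul, map_mul] at h
  exact h

/-- Twist by the parity involution of an operator of parity `p`: the algebra automorphism with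
`x ↦ (-1)^{p|x|} x` on generators. -/
def twist (p : Bool) : Density m →ₐ[ℂ] Density m :=
  lift (FreeAlgebra.lift ℂ fun x => koszul p x.odd • gen x) <| by
    intro a b h
    cases h with
    | coef_add f g =>
      simp only [FreeAlgebra.lift_ι_apply, map_add, Gen.odd, koszul]
      simpa [coef] using coef_add (m := m) f g
    | coef_mul f g =>
      simp only [FreeAlgebra.lift_ι_apply, map_mul, Gen.odd, koszul]
      simpa [coef] using coef_mul (m := m) f g
    | coef_const r =>
      simp only [FreeAlgebra.lift_ι_apply, Gen.odd, koszul]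
      simpa [coef] using coef_const (m := m) r
    | supercomm x y =>
      simp only [map_smul, map_mul, FreeAlgebra.lift_ι_apply, smul_mul_smul_comm]
      rw [gen_comm x y, smul_smul, smul_smul]
      congr 1
      ring

theorem twist_gen (p : Bool) (x : Gen m) : twist p (gen x) = koszul p x.odd • gen x := by
  rw [twist, gen, lift_mk, FreeAlgebra.lift_ι_apply]; rfl

/-- The parity involution `F ↦ (-1)^{|F|} F`. -/
def invol : Density m →ₐ[ℂ] Density m := twist true

/-- Values on generators that extend to a superderivation of parity `p`. -/
structure Admissible (p : Bool) (v : Gen m → Density m) : Prop where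
  add (f g : Entire) : v (.inl (f + g)) = v (.inl f) + v (.inl g)
  mul (f g : Entire) : v (.inl (f * g)) = coef f * v (.inl g) + v (.inl f) * coef g
  const (r : ℂ) : v (.inl (algebraMap ℂ Entire r)) = 0
  comm (x y : Gen m) : v x * gen y = koszul (xor x.odd p) y.odd • (gen y * v x)

/-- The homomorphism `F ↦ [[(-1)^{p|F|} F, D F], [0, F]]` that encodes a superderivation `D`. -/
def derHom (p : Bool) (v : Gen m → Density m) (h : Admissible p v) :
    Density m →ₐ[ℂ] Matrix (Fin 2) (Fin 2) (Density m) :=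
  lift (FreeAlgebra.lift ℂ fun x => !![twist p (gen x), v x; 0, gen x]) <| by
    intro a b hab
    cases hab with
    | coef_add f g =>
      simp only [FreeAlgebra.lift_ι_apply, map_add]
      have e : (gen (.inl (f + g)) : Density m) = gen (.inl f) + gen (.inl g) := coef_add f g
      ext i j
      fin_cases i <;> fin_cases j <;> simp [e, h.add]
    | coef_mul f g =>
      simp only [FreeAlgebra.lift_ι_apply, map_mul]
      have e : (gen (.inl (f * g)) : Density m) = gen (.inl f) * gen (.inl g) := coef_mul f g
      have e1 : twist p (gen (.inl f) : Density m) = coef f := by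
        rw [twist_gen]; simp [Gen.odd, koszul, coef]
      ext i j
      fin_cases i <;> fin_cases j <;>
        simp [e, h.mul, Matrix.mul_apply, Fin.sum_univ_two, e1, coef]
    | coef_const r =>
      have e : (gen (.inl (algebraMap ℂ Entire r)) : Density m) = algebraMap ℂ _ r :=
        coef_const r
      rw [FreeAlgebra.lift_ι_apply, AlgHom.commutes, e, h.const, AlgHom.commutes]
      ext i j
      fin_cases i <;> fin_cases j <;> simp [Matrix.algebraMap_matrix_apply]
    | supercomm x y =>
      simp only [map_smul, map_mul, FreeAlgebra.lift_ι_apply]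
      have e0 := gen_comm x y
      have e1 := h.comm x y
      have e2 := h.comm y x
      ext i j
      fin_cases i <;> fin_cases j
      · simp [Matrix.mul_apply, Fin.sum_univ_two, ← map_mul, e0]
      · simp only [Matrix.mul_apply, Fin.sum_univ_two, twist_gen, Matrix.smul_apply]
        simp [e1, e2, smul_smul]
        cases p <;> cases x.odd <;> cases y.odd <;> simp [koszul, add_comm]
      · simp [Matrix.mul_apply, Fin.sum_univ_two]
      · simp [Matrix.mul_apply, Fin.sum_univ_two, e0]

/-- The superderivation of parity `p` with values `v` on the generators. -/
def superDer (p : Bool) (v : Gen m → Density m) (h : Admissible p v) :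
    Density m →ₗ[ℂ] Density m where
  toFun F := derHom p v h F 0 1
  map_add' F G := by rw [map_add]; rfl
  map_smul' r F := by rw [map_smul]; rfl

theorem derHom_gen (p : Bool) (v : Gen m → Density m) (h : Admissible p v) (x : Gen m) :
    derHom p v h (gen x) = !![twist p (gen x), v x; 0, gen x] := by
  rw [derHom, gen, lift_mk, FreeAlgebra.lift_ι_apply]; rfl

theorem superDer_gen (p : Bool) (v : Gen m → Density m) (h : Admissible p v) (x : Gen m) :
    superDer p v h (gen x) = v x := by
  show derHom p v h (gen x) 0 1 = v x
  rw [derHom_gen]; rfl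

theorem induction {C : Density m → Prop} (hc : ∀ r : ℂ, C (algebraMap ℂ _ r))
    (hg : ∀ x, C (gen x)) (ha : ∀ F G, C F → C G → C (F + G))
    (hm : ∀ F G, C F → C G → C (F * G)) (F : Density m) : C F := by
  obtain ⟨a, rfl⟩ := mk_surjective F
  induction a using FreeAlgebra.induction with
  | grade0 r => rw [AlgHom.commutes]; exact hc r
  | grade1 x => exact hg x
  | mul a b h1 h2 => rw [map_mul]; exact hm _ _ h1 h2
  | add a b h1 h2 => rw [map_add]; exact ha _ _ h1 h2

theorem derHom_entries (p : Bool) (v : Gen m → Density m) (h : Admissible p v) (F : Density m) :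
    derHom p v h F 0 0 = twist p F ∧ derHom p v h F 1 0 = 0 ∧ derHom p v h F 1 1 = F := by
  induction F using Density.induction with
  | hc r => simp [Matrix.algebraMap_matrix_apply]
  | hg x => rw [derHom_gen]; simp
  | ha F G hF hG => simp [hF, hG]
  | hm F G hF hG => simp [Matrix.mul_apply, Fin.sum_univ_two, hF, hG]

theorem superDer_mul (p : Bool) (v : Gen m → Density m) (h : Admissible p v)
    (F G : Density m) :
    superDer p v h (F * G) = superDer p v h F * G + twist p F * superDer p v h G := by
  show derHom p v h (F * G) 0 1 = derHom p v h F 0 1 * G + twist p F * derHom p v h G 0 1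
  rw [map_mul, Matrix.mul_apply, Fin.sum_univ_two, (derHom_entries p v h F).1,
    (derHom_entries p v h G).2.2, add_comm]

/-- Values of `∂ = ∂_z` on generators. -/
def dzVal : Gen m → Density m
  | .inl f => coef (Entire.der f)
  | .inr j => gen (.inr ⟨j.field, j.order + 1, j.hor⟩)

theorem dzVal_admissible : Admissible (m := m) false dzVal where
  add f g := by simp only [dzVal, map_add, coef_add]
  mul f g := by simp only [dzVal, Entire.der_mul, coef_add, coef_mul]
  const r := by
    have h := coef_const (m := m) 0
    simp only [dzVal, Entire.der_const]
    simpa using h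
  comm x y := by
    cases x with
    | inl f => simpa [dzVal, Gen.odd, coef] using gen_comm (.inl (Entire.der f)) y
    | inr j => simpa [dzVal, Gen.odd] using gen_comm (.inr ⟨j.field, j.order + 1, j.hor⟩) y

/-- The total holomorphic derivative `∂ = ∂_z`, an even derivation. -/
def dz : Density m →ₗ[ℂ] Density m := superDer false dzVal dzVal_admissible

/-- Values of `d'` on generators. -/
def dprVal : Gen m → Density m
  | .inl _ => 0
  | .inr j => if j.hor then 0 else gen (.inr ⟨j.field, j.order, true⟩)

theorem dprVal_admissible : Admissible (m := m) true dprVal where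
  add f g := by simp [dprVal]
  mul f g := by simp [dprVal]
  const r := by simp [dprVal]
  comm x y := by
    cases x with
    | inl f => simp [dprVal]
    | inr j =>
      obtain ⟨φ, n, b⟩ := j
      cases b
      · simpa [dprVal, Gen.odd] using gen_comm (.inr ⟨φ, n, true⟩) y
      · simp [dprVal]

/-- The leafwise differential `d'`, an odd derivation; it kills holomorphic functions of `z`. -/
def dpr : Density m →ₗ[ℂ] Density m := superDer true dprVal dprVal_admissible

/-- Values of `∂/∂j` on generators. -/
def pdVal (j : Jet m) : Gen m → Density m
  | .inl _ => 0
  | .inr i => if i = j then 1 else 0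

theorem pdVal_admissible (j : Jet m) : Admissible (Gen.odd (.inr j)) (pdVal j) where
  add f g := by simp [pdVal]
  mul f g := by simp [pdVal]
  const r := by simp [pdVal]
  comm x y := by
    cases x with
    | inl f => simp [pdVal]
    | inr i =>
      by_cases h : i = j
      · subst h; simp [pdVal, koszul]
      · simp [pdVal, h]

/-- The left partial derivative `∂/∂j` with respect to the jet `j`. -/
def pd (j : Jet m) : Density m →ₗ[ℂ] Density m :=
  superDer (Gen.odd (.inr j)) (pdVal j) (pdVal_admissible j)

/-- Only finitely many jets of a superfield occur in a density. -/
theorem pd_finite (φ : Superfield m) (b : Bool) (F : Density m) :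
    {n : ℕ | pd ⟨φ, n, b⟩ F ≠ 0}.Finite := by
  induction F using Density.induction with
  | hc r =>
    have h : ∀ n, pd (⟨φ, n, b⟩ : Jet m) (algebraMap ℂ _ r) = 0 := fun n => by
      show derHom _ _ _ (algebraMap ℂ _ r) 0 1 = 0
      rw [AlgHom.commutes]; simp [Matrix.algebraMap_matrix_apply]
    simp [h]
  | hg x =>
    cases x with
    | inl f => simp [pd, superDer_gen, pdVal]
    | inr i =>
      refine (Set.finite_singleton i.order).subset fun n hn => ?_
      by_contra hne
      apply hn
      have : i ≠ ⟨φ, n, b⟩ := fun e => hne (by rw [e]; rfl)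
      simp [pd, superDer_gen, pdVal, this]
  | ha F G hF hG =>
    refine (hF.union hG).subset fun n hn => ?_
    by_contra hne
    simp only [Set.mem_union, Set.mem_ofPred_eq, not_or, not_not] at hne
    exact hn (by rw [map_add, hne.1, hne.2, add_zero])
  | hm F G hF hG =>
    refine (hF.union hG).subset fun n hn => ?_
    by_contra hne
    simp only [Set.mem_union, Set.mem_ofPred_eq, not_or, not_not] at hne
    refine hn ?_
    have h1 := hne.1
    have h2 := hne.2
    unfold pd at h1 h2 ⊢
    rw [superDer_mul, h1, h2, zero_mul, mul_zero, add_zero]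

/-- The left variational derivative `δ/δφ`:
`∑_n (-∂)^n (∂/∂(∂^n φ) - (-1)^{|φ|} d' ∂/∂(∂^n d'φ))`; the sum is finite. -/
def varDer (φ : Superfield m) (F : Density m) : Density m :=
  ∑ᶠ n : ℕ, ((-dz) ^ n)
    (pd ⟨φ, n, false⟩ F - koszul φ.odd true • dpr (pd ⟨φ, n, true⟩ F))

/-- A density for the BV bracket of two local functionals, with
`{𝐀, 𝐁} = {𝐁, 𝐀} = δ` and `{𝐙, 𝚿} = {𝚿, 𝐙} = δ`, graded symmetric of odd degree. For each
conjugate pair (odd field `o`, even field `e`) it is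
`(δF/δo)(δG/δe) + (-1)^{|F|} (δF/δe)(δG/δo)`; note `|δF/δe| = |F|`. -/
def bv (F G : Density m) : Density m :=
  (∑ c : Fin m, ∑ p : GaugeIdx,
    (varDer (.A c p) F * varDer (.B c p) G + invol (varDer (.B c p) F) * varDer (.A c p) G)) +
  ∑ c : Fin m, ∑ I : Fin 4, ∑ u : Fin 4,
    (varDer (.Psi c I u) F * varDer (.Z c I u) G
      + invol (varDer (.Z c I u) F) * varDer (.Psi c I u) G)

/-- The Lie superbracket on parity-shifted local functionals attached to the BV bracket by the
usual décalage sign: `(F, G) ↦ (-1)^{|F|} {F, G}`. -/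
def lieBV (F G : Density m) : Density m := bv (invol F) G

/-- Total derivatives. -/
def totalDerivatives (m : ℕ) : Submodule ℂ (Density m) :=
  LinearMap.range (dz (m := m)) ⊔ LinearMap.range (dpr (m := m))

end Density

/-- Local functionals: densities modulo total derivatives. -/
abbrev LocalFunctional (m : ℕ) : Type := Density m ⧸ Density.totalDerivatives m

/-- The local functional `∫ F` of a density `F`. -/
def locInt {m : ℕ} : Density m →ₗ[ℂ] LocalFunctional m := (Density.totalDerivatives m).mkQ

/-! ## The holomorphic-topological twist of BLG theory -/

/-- The Levi-Civita symbol on four indices. -/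
def levi (i : Fin 4 → Fin 4) : ℂ :=
  ((∏ a : Fin 4, ∏ b ∈ Finset.Ioi a, (SignType.sign ((i b : ℤ) - (i a : ℤ)) : ℤ) : ℤ) : ℂ)

namespace BLG

open Density

variable {m : ℕ}

/-- The antisymmetric matrix with entries `X p` above the diagonal: an element of `𝔰𝔬(4)`, which
also acts by this matrix on `R = ℂ⁴`. -/
def soMatrix (X : GaugeIdx → Density m) : Matrix (Fin 4) (Fin 4) (Density m) := fun u v =>
  if h : u < v then X ⟨(u, v), h⟩ else if h : v < u then -X ⟨(v, u), h⟩ else 0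

/-- The gauge superfield `𝐀` as a matrix. -/
def gaugeA (c : Fin m) : Matrix (Fin 4) (Fin 4) (Density m) := soMatrix fun p => fld (.A c p)

/-- The superfield `𝐁` as a matrix of coefficients in the dual basis. -/
def gaugeB (c : Fin m) : Matrix (Fin 4) (Fin 4) (Density m) := soMatrix fun p => fld (.B c p)

/-- The superfields `𝐙^I`. -/
def Z (c : Fin m) (I u : Fin 4) : Density m := fld (.Z c I u)

/-- The superfields `𝚿_I`. -/
def Psi (c : Fin m) (I u : Fin 4) : Density m := fld (.Psi c I u)

/-- The invariant pairing `Tr` on `𝔰𝔬(4) = 𝔰𝔩(2)₊ ⊕ 𝔰𝔩(2)₋` of opposite signs on the two factors,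
`Tr(XY) = ¼ ε_{uvwx} X_{uv} Y_{wx}`. Its inverse is given by the same formula in the dual basis,
so that `K^{ab} (ρ_a)_{st} (ρ_b)_{uv} = ε_{stuv}`. -/
def Tr (X Y : Matrix (Fin 4) (Fin 4) (Density m)) : Density m :=
  (1 / 4 : ℂ) • ∑ u : Fin 4, ∑ v : Fin 4, ∑ w : Fin 4, ∑ x : Fin 4,
    levi ![u, v, w, x] • (X u v * Y w x)

/-- The image `K^{ab} 𝐁_b` of `𝐁` in `𝔰𝔬(4)` under `Tr`. -/
def sharpB (c : Fin m) : Matrix (Fin 4) (Fin 4) (Density m) := fun u v =>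
  (1 / 2 : ℂ) • ∑ w : Fin 4, ∑ x : Fin 4, levi ![u, v, w, x] • gaugeB c w x

/-- The curvature `F'(𝐀) = d'𝐀 + 𝐀²`. -/
def curvature (c : Fin m) : Matrix (Fin 4) (Fin 4) (Density m) := fun u v =>
  dpr (gaugeA c u v) + (gaugeA c * gaugeA c) u v

/-- `d'_𝐀 𝐙^I`. -/
def covZ (c : Fin m) (I u : Fin 4) : Density m :=
  dpr (Z c I u) + ∑ v : Fin 4, gaugeA c u v * Z c I v

/-- The superpotential
`(π / (2·3!·k)) ε_{IJKL} K^{ab} ρ_a(𝐙^I, 𝐙^J) ρ_b(𝐙^K, 𝐙^L)` at level `k`. -/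
def superpotential (k : ℂ) (c : Fin m) : Density m :=
  (Real.pi / (2 * 6 * k) : ℂ) • ∑ I : Fin 4 → Fin 4, ∑ u : Fin 4 → Fin 4,
    (levi I * levi u) • (Z c (I 0) (u 0) * Z c (I 1) (u 1) * Z c (I 2) (u 2) * Z c (I 3) (u 3))

/-- The Lagrangian of the `HT`-twisted theory with level `k c` in the copy `c`:
`𝐁 F'(𝐀) + (k/4π) Tr(𝐀 ∂𝐀) + 𝚿_I d'_𝐀 𝐙^I + 𝐖`. -/
def action (k : Fin m → ℂ) : Density m :=
  ∑ c : Fin m,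
    ((∑ p : GaugeIdx, fld (.B c p) * curvature c p.1.1 p.1.2)
      + (k c / (4 * Real.pi) : ℂ) • Tr (gaugeA c) ((gaugeA c).map dz)
      + (∑ I : Fin 4, ∑ u : Fin 4, Psi c I u * covZ c I u)
      + superpotential (k c) c)

/-- The functional `∫ F` is `Q_HT`-closed: `{S, ∫ F} = 0`. -/
def QClosed (k : Fin m → ℂ) (F : Density m) : Prop := locInt (bv (action k) F) = 0

/-- The functional `∫ F` is `Q_HT`-exact: `∫ F = {S, ∫ H}` for some `H`. -/
def QExact (k : Fin m → ℂ) (F : Density m) : Prop :=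
  ∃ H : Density m, locInt F = locInt (bv (action k) H)

/-- The covariant derivative `∂_𝐁 = ∂ - (2π/k) 𝐁` of an `R`-valued density. -/
def covB (k : Fin m → ℂ) (c : Fin m) (X : Fin 4 → Density m) (u : Fin 4) : Density m :=
  dz (X u) - (2 * Real.pi / k c : ℂ) • ∑ v : Fin 4, sharpB c u v * X v

/-- The stress tensor `𝐓_V = V (-𝐁 ∂𝐀 + ¾ 𝚿_I ∂𝐙^I - ¼ 𝐙^I ∂𝚿_I)`. -/
def currentT (V : Entire) : Density m :=
  coef V * ∑ c : Fin m,
    (-(∑ p : GaugeIdx, fld (.B c p) * dz (fld (.A c p)))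
      + ∑ I : Fin 4, ∑ u : Fin 4,
        ((3 / 4 : ℂ) • (Psi c I u * dz (Z c I u)) - (1 / 4 : ℂ) • (Z c I u * dz (Psi c I u))))

/-- The covariant stress tensor `𝐓̂_V = V (¾ 𝚿_I ∂_𝐁 𝐙^I - ¼ 𝐙^I ∂_𝐁 𝚿_I)`. -/
def currentTHat (k : Fin m → ℂ) (V : Entire) : Density m :=
  coef V * ∑ c : Fin m, ∑ I : Fin 4, ∑ u : Fin 4,
    ((3 / 4 : ℂ) • (Psi c I u * covB k c (Z c I) u)
      - (1 / 4 : ℂ) • (Z c I u * covB k c (Psi c I) u))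

/-- `𝐋_U = U^I_J 𝚿_I 𝐙^J`. -/
def currentL (U : Matrix (Fin 4) (Fin 4) Entire) : Density m :=
  ∑ c : Fin m, ∑ I : Fin 4, ∑ J : Fin 4, ∑ u : Fin 4, coef (U I J) * Psi c I u * Z c J u

/-- `𝚯_Γ = ½ Γ^{IJ} (𝚿_I 𝚿_J - ½ ε_{IJKL} 𝐙^K ∂_𝐁 𝐙^L)`. -/
def currentTheta (k : Fin m → ℂ) (G : Matrix (Fin 4) (Fin 4) Entire) : Density m :=
  (1 / 2 : ℂ) • ∑ c : Fin m, ∑ I : Fin 4, ∑ J : Fin 4, ∑ u : Fin 4,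
    coef (G I J) * (Psi c I u * Psi c J u
      - (1 / 2 : ℂ) • ∑ K : Fin 4, ∑ L : Fin 4,
          levi ![I, J, K, L] • (Z c K u * covB k c (Z c L) u))

/-- `𝚵_Σ = ½ Σ_{IJ} 𝐙^I 𝐙^J`. -/
def currentXi (G : Matrix (Fin 4) (Fin 4) Entire) : Density m :=
  (1 / 2 : ℂ) • ∑ c : Fin m, ∑ I : Fin 4, ∑ J : Fin 4, ∑ u : Fin 4,
    coef (G I J) * (Z c I u * Z c J u)

end BLG

/-! ## The parameters of the currents -/

/-- `𝒪_ℂ ⊗ 𝔰𝔩(4)`. -/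
def tracelessFun : Submodule ℂ (Matrix (Fin 4) (Fin 4) Entire) where
  carrier := {U | U.trace = 0}
  zero_mem' := Matrix.trace_zero _ _
  add_mem' {U W} hU hW := by
    show (U + W).trace = 0
    rw [Matrix.trace_add, hU, hW, add_zero]
  smul_mem' r U hU := by
    show (r • U).trace = 0
    rw [Matrix.trace_smul, hU, smul_zero]

/-- `K_ℂ^{-1/2} ⊗ Λ²ℂ⁴`, with `K_ℂ` trivialised by `dz`. -/
def altFun : Submodule ℂ (Matrix (Fin 4) (Fin 4) Entire) where
  carrier := {G | G.transpose = -G}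
  zero_mem' := by simp
  add_mem' {U W} hU hW := by
    show (U + W).transpose = -(U + W)
    rw [Matrix.transpose_add, hU, hW, neg_add]
  smul_mem' r U hU := by
    show (r • U).transpose = -(r • U)
    rw [Matrix.transpose_smul, hU, smul_neg]

/-- `K_ℂ^{1/2} ⊗ Sym²(ℂ⁴)^*`, with `K_ℂ` trivialised by `dz`. -/
def symFun : Submodule ℂ (Matrix (Fin 4) (Fin 4) Entire) where
  carrier := {G | G.transpose = G}
  zero_mem' := by simp
  add_mem' {U W} hU hW := by
    show (U + W).transpose = U + W
    rw [Matrix.transpose_add, hU, hW]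
  smul_mem' r U hU := by
    show (r • U).transpose = r • U
    rw [Matrix.transpose_smul, hU]

/-- `(V, U, Γ, Σ) ∈ Vect(ℂ) ⊕ 𝒪_ℂ ⊗ 𝔰𝔩(4) ⊕ Π(K_ℂ^{-1/2} ⊗ Λ²ℂ⁴ ⊕ K_ℂ^{1/2} ⊗ Sym²(ℂ⁴)^*)`:
even part `(V, U)`, odd part `(Γ, Σ)`. -/
abbrev CurrentParam : Type := (Entire × tracelessFun) × (altFun × symFun)

namespace BLG

variable {m : ℕ}

/-- The current `𝐓_V + 𝐋_U + 𝚯_Γ + 𝚵_Σ`. -/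
def current (k : Fin m → ℂ) (x : CurrentParam) : Density m :=
  currentT x.1.1 + currentL x.1.2.1 + currentTheta k x.2.1.1 + currentXi x.2.2.1

/-- The current `𝐓̂_V + 𝐋_U + 𝚯_Γ + 𝚵_Σ`. -/
def currentHat (k : Fin m → ℂ) (x : CurrentParam) : Density m :=
  currentTHat k x.1.1 + currentL x.1.2.1 + currentTheta k x.2.1.1 + currentXi x.2.2.1

end BLG

end

/-! ### Parity and supercommutativity of densities -/

noncomputable section

namespace Density

variable {m : ℕ}

/-! Modulo total derivatives, the BV bracket with a homogeneous functional `F` acts as a derivation: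
`locInt_bv` identifies it with the evolutionary vector field `ham` of `F`, which supercommutes with
`∂` and `d'`. For the action this is the BRST operator `qHT`; for `𝐓_V` it is the Lie derivative
`lieDer`. Most of what follows is computed from the values of these derivations on fields.

The algebra of the hatted currents. They contain no `𝐀`, so `𝐁`, which pairs only with `𝐀`, is inert
in their mutual brackets and merely serves as the connection in `∂_𝐁`. As `𝔰𝔬(4)` preserves the dot
product on `R`, each hatted current is a combination of gauge invariant bilinears `bil M X Y` in
`𝐙`, `𝚿` and their covariant derivatives, with `M` a 4×4 matrix of entire functions; `∂_𝐁` can be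
integrated by parts, and a bracket amounts to a matrix product. Two facts about the duality on
antisymmetric matrices enter: `Γ *Γ' + Γ' *Γ = -pf(Γ, Γ')` (`mul_dual_add`), which makes the bracket
of two `𝚯` a stress tensor, and equivariance under `𝔰𝔩(4)` (`dual_sl`). The outcome is
`paramBracket`. With `𝐓` instead of `𝐓̂`, the brackets with the stress tensor follow from conformal
weights and are again exact identities; only the bracket of two `𝚯` returns `𝐓̂` rather than `𝐓`,
which is why that version closes up to exact functionals.

Closedness and exactness. The superpotential of a copy is `2π/k` times the determinant of the 4×4
matrix of the `𝐙` (`superpotential_eq`), so its gradient is an adjugate matrix. On `𝐙`, `𝚿` and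
their `∂_𝐁`-derivatives the BRST operator is `d'_𝐀` plus errors: the gradient of `𝐖` in the
variation of `𝚿`, and the `𝔰𝔬(4)` moment map in the variation of `∂_𝐁` (`qHT_covD`). In a gauge
invariant bilinear the `d'_𝐀` part is a total derivative. The errors cancel by identities for
determinants: adjugate times matrix gives the flavour and gauge invariance of `𝐖`, and a cofactor
expansion (`sum_levi_adjugate`) converts the moment map acting on `𝐙` into the gradient of `𝐖`, as
needed for `𝚯`. For `𝐓̂` one uses that `𝐖` has weight one and that the invariant square of the odd
moment map vanishes. Finally `V (π/2k) 𝐁·𝐁` is a primitive of `𝐓̂_V - 𝐓_V` (`qHT_sqB`).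

The identification with `E(1|6)`. Inside `K(1|6)` it is cut out by duality relations that express a
component of degree at least three through the complementary one (`E16_apply`, `mem_E16_of_apply`).
This leaves 1 + 6 + 15 + 10 free functions: the constant term, `ℂ⁶ ≅ Λ²ℂ⁴`, `𝔰𝔬(6) ≅ 𝔰𝔩(4)` and half
of `Λ³ℂ⁶`, which is `Sym²(ℂ⁴)^*`; `toParam` realises this with gamma matrices. Closure under the
contact bracket and its agreement with `paramBracket` are identities between bilinear differential
expressions with dyadic Gaussian coefficients. They are rewritten in free jets and verified
coefficient by coefficient by kernel computation (`isZero_bracketComb`, `isZero_contactComb_sub`).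
-/

@[simp] theorem koszul_false_left (b : Bool) : koszul false b = 1 := by simp [koszul]
@[simp] theorem koszul_false_right (a : Bool) : koszul a false = 1 := by simp [koszul]
@[simp] theorem koszul_true_true : koszul true true = -1 := by simp [koszul]

theorem algHom_ext {B : Type} [Ring B] [Algebra ℂ B] {f g : Density m →ₐ[ℂ] B}
    (h : ∀ x, f (gen x) = g (gen x)) : f = g := by
  refine AlgHom.ext fun F => ?_
  induction F using Density.induction with
  | hc r => simp
  | hg x => exact h x
  | ha F G hF hG => rw [map_add, map_add, hF, hG]
  | hm F G hF hG => rw [map_mul, map_mul, hF, hG]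

@[simp] theorem twist_false (F : Density m) : twist false F = F := by
  have : twist (m := m) false = AlgHom.id ℂ _ := algHom_ext fun x => by simp [twist_gen]
  rw [this]; rfl

theorem twist_true (F : Density m) : twist true F = invol F := rfl

theorem invol_gen (x : Gen m) : invol (gen x) = koszul true x.odd • gen x := twist_gen _ _

theorem invol_invol (F : Density m) : invol (invol F) = F := by
  have : (invol (m := m)).comp invol = AlgHom.id ℂ _ := algHom_ext fun x => by
    cases h : x.odd <;> simp [invol_gen, h]
  exact DFunLike.congr_fun this F

theorem twist_invol (p : Bool) (F : Density m) : twist p (invol F) = invol (twist p F) := by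
  cases p <;> simp [twist_true]

/-- `F` is homogeneous of parity `p`. -/
def IsPar (p : Bool) (F : Density m) : Prop := invol F = koszul p true • F

theorem IsPar.twist {p : Bool} {F : Density m} (h : IsPar p F) (q : Bool) :
    twist q F = koszul q p • F := by
  cases q
  · simp
  · rw [twist_true, h]; cases p <;> simp

theorem IsPar.invol {p : Bool} {F : Density m} (h : IsPar p F) :
    invol F = koszul p true • F := h

theorem isPar_gen (x : Gen m) : IsPar x.odd (gen x) := by
  rw [IsPar, invol_gen]; cases x.odd <;> simp

theorem isPar_coef (f : Entire) : IsPar false (coef f : Density m) := isPar_gen (.inl f)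

theorem isPar_fld (φ : Superfield m) : IsPar φ.odd (fld φ) := by
  simpa [Gen.odd, fld] using isPar_gen (.inr ⟨φ, 0, false⟩)

theorem isPar_algebraMap (r : ℂ) : IsPar false (algebraMap ℂ (Density m) r) := by
  simp [IsPar]

theorem isPar_one : IsPar false (1 : Density m) := by simp [IsPar]

theorem isPar_zero (p : Bool) : IsPar p (0 : Density m) := by simp [IsPar]

theorem IsPar.add {p : Bool} {F G : Density m} (hF : IsPar p F) (hG : IsPar p G) :
    IsPar p (F + G) := by
  rw [IsPar, map_add, hF, hG, smul_add]

theorem IsPar.neg {p : Bool} {F : Density m} (hF : IsPar p F) : IsPar p (-F) := by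
  rw [IsPar, map_neg, hF, smul_neg]

theorem IsPar.sub {p : Bool} {F G : Density m} (hF : IsPar p F) (hG : IsPar p G) :
    IsPar p (F - G) := by
  rw [IsPar, map_sub, hF, hG, smul_sub]

theorem IsPar.smul {p : Bool} {F : Density m} (hF : IsPar p F) (r : ℂ) : IsPar p (r • F) := by
  rw [IsPar, map_smul, hF, smul_comm]

theorem IsPar.sum {ι : Type*} {s : Finset ι} {p : Bool} {F : ι → Density m}
    (hF : ∀ i ∈ s, IsPar p (F i)) : IsPar p (∑ i ∈ s, F i) := by
  rw [IsPar, map_sum, Finset.smul_sum]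
  exact Finset.sum_congr rfl fun i hi => hF i hi

theorem IsPar.mul {p q : Bool} {F G : Density m} (hF : IsPar p F) (hG : IsPar q G) :
    IsPar (xor p q) (F * G) := by
  rw [IsPar, map_mul, hF, hG, smul_mul_smul_comm]
  cases p <;> cases q <;> simp

theorem eq_zero_of_isPar {F : Density m} (h0 : IsPar false F) (h1 : IsPar true F) : F = 0 := by
  have h : F = -F := by
    have a : Density.invol F = F := by simpa using h0.invol
    have b : Density.invol F = -F := by simpa using h1.invol
    exact a.symm.trans b
  have h2 : (2 : ℂ) • F = 0 := by
    rw [two_smul]; nth_rewrite 1 [h]; simp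
  exact (smul_eq_zero.mp h2).resolve_left two_ne_zero

/-- Every density is the sum of an even and an odd one, and properties of homogeneous densities
can be proved by induction. -/
theorem exists_hom_decomposition {C : Bool → Density m → Prop}
    (hc : ∀ r, C false (algebraMap ℂ _ r)) (h0 : C true 0) (hg : ∀ x : Gen m, C x.odd (gen x))
    (ha : ∀ p F G, IsPar p F → IsPar p G → C p F → C p G → C p (F + G))
    (hm : ∀ p q F G, IsPar p F → IsPar q G → C p F → C q G → C (xor p q) (F * G))
    (F : Density m) :
    ∃ F0 F1, F = F0 + F1 ∧ IsPar false F0 ∧ IsPar true F1 ∧ C false F0 ∧ C true F1 := by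
  have h00 : C false 0 := by simpa using hc 0
  induction F using Density.induction with
  | hc r => exact ⟨_, 0, (add_zero _).symm, isPar_algebraMap r, isPar_zero _, hc r, h0⟩
  | hg x =>
    have h1 := isPar_gen x
    have h2 := hg x
    cases h : x.odd <;> rw [h] at h1 h2
    · exact ⟨_, 0, (add_zero _).symm, h1, isPar_zero _, h2, h0⟩
    · exact ⟨0, _, (zero_add _).symm, isPar_zero _, h1, h00, h2⟩
  | ha F G hF hG =>
    obtain ⟨F0, F1, rfl, a0, a1, c0, c1⟩ := hF
    obtain ⟨G0, G1, rfl, b0, b1, d0, d1⟩ := hG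
    exact ⟨F0 + G0, F1 + G1, by abel, a0.add b0, a1.add b1, ha _ _ _ a0 b0 c0 d0,
      ha _ _ _ a1 b1 c1 d1⟩
  | hm F G hF hG =>
    obtain ⟨F0, F1, rfl, a0, a1, c0, c1⟩ := hF
    obtain ⟨G0, G1, rfl, b0, b1, d0, d1⟩ := hG
    exact ⟨F0 * G0 + F1 * G1, F0 * G1 + F1 * G0, by noncomm_ring, (a0.mul b0).add (a1.mul b1),
      (a0.mul b1).add (a1.mul b0),
      ha _ _ _ (a0.mul b0) (a1.mul b1) (hm _ _ _ _ a0 b0 c0 d0) (hm _ _ _ _ a1 b1 c1 d1),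
      ha _ _ _ (a0.mul b1) (a1.mul b0) (hm _ _ _ _ a0 b1 c0 d1) (hm _ _ _ _ a1 b0 c1 d0)⟩

/-- The even and odd parts supplied by the decomposition are unique, because a density of both
parities is zero; so the property obtained for the part of parity `p` is the property of `F` itself.
-/
theorem hom_induction {C : Bool → Density m → Prop}
    (hc : ∀ r, C false (algebraMap ℂ _ r)) (h0 : C true 0) (hg : ∀ x : Gen m, C x.odd (gen x))
    (ha : ∀ p F G, IsPar p F → IsPar p G → C p F → C p G → C p (F + G))
    (hm : ∀ p q F G, IsPar p F → IsPar q G → C p F → C q G → C (xor p q) (F * G))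
    {p : Bool} {F : Density m} (hF : IsPar p F) : C p F := by
  obtain ⟨F0, F1, rfl, a0, a1, c0, c1⟩ := exists_hom_decomposition hc h0 hg ha hm F
  cases p
  · have h : IsPar false F1 := by simpa using hF.sub a0
    rwa [eq_zero_of_isPar h a1, add_zero]
  · have h : IsPar true F0 := by simpa using hF.sub a1
    rwa [eq_zero_of_isPar a0 h, zero_add]

theorem gen_mul_eq (x : Gen m) (G : Density m) : gen x * G = twist x.odd G * gen x := by
  induction G using Density.induction with
  | hc r => simp [Algebra.commutes]
  | hg y => rw [twist_gen, gen_comm, smul_mul_assoc]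
  | ha F G hF hG => rw [map_add, mul_add, add_mul, hF, hG]
  | hm F G hF hG => rw [map_mul, ← mul_assoc, hF, mul_assoc, hG, mul_assoc]

/-- A homogeneous density supercommutes with everything. -/
theorem IsPar.mul_eq {p : Bool} {F : Density m} (hF : IsPar p F) (G : Density m) :
    F * G = Density.twist p G * F := by
  refine hom_induction (C := fun p F => ∀ G, F * G = Density.twist p G * F) ?_ ?_ ?_ ?_ ?_ hF G
  · intro r G; simp [Algebra.commutes]
  · simp
  · exact gen_mul_eq
  · intro p F G _ _ hF hG H; rw [add_mul, mul_add, hF, hG]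
  · intro p q F G _ _ hF hG H
    rw [mul_assoc, hG, ← mul_assoc, hF, mul_assoc]
    congr 1
    cases p <;> cases q <;> simp [twist_true, invol_invol]

theorem IsPar.comm {p q : Bool} {F G : Density m} (hF : IsPar p F) (hG : IsPar q G) :
    F * G = koszul p q • (G * F) := by
  rw [hF.mul_eq, hG.twist, smul_mul_assoc]

theorem IsPar.even_comm {F : Density m} (hF : IsPar false F) (G : Density m) :
    F * G = G * F := by
  rw [hF.mul_eq, twist_false]

theorem coef_comm (f : Entire) (G : Density m) : coef f * G = G * coef f :=
  (isPar_coef f).even_comm G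

/-! ### Superderivations -/

theorem superDer_algebraMap (p : Bool) (v : Gen m → Density m) (h : Admissible p v) (r : ℂ) :
    superDer p v h (algebraMap ℂ _ r) = 0 := by
  show derHom p v h (algebraMap ℂ _ r) 0 1 = 0
  rw [AlgHom.commutes]; simp [Matrix.algebraMap_matrix_apply]

/-- The hypothesis `hv` makes the derivation homogeneous of parity `p`, and both sides obey the same
twisted Leibniz rule. -/
theorem invol_superDer {p : Bool} {v : Gen m → Density m} (h : Admissible p v)
    (hv : ∀ x, IsPar (xor p x.odd) (v x)) (F : Density m) :
    invol (superDer p v h F) = koszul p true • superDer p v h (invol F) := by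
  induction F using Density.induction with
  | hc r => simp [superDer_algebraMap]
  | hg x =>
    rw [superDer_gen, hv x, invol_gen, map_smul, superDer_gen]
    cases p <;> cases x.odd <;> simp
  | ha F G hF hG => simp [hF, hG]
  | hm F G hF hG =>
    rw [superDer_mul, map_add, map_mul, map_mul, hF, hG, map_mul, superDer_mul, twist_invol,
      smul_mul_assoc, mul_smul_comm, smul_add]

theorem IsPar.superDer {p q : Bool} {v : Gen m → Density m} (h : Admissible p v)
    (hv : ∀ x, IsPar (xor p x.odd) (v x)) {F : Density m} (hF : IsPar q F) :
    IsPar (xor p q) (superDer p v h F) := by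
  rw [IsPar, invol_superDer h hv, hF.invol, map_smul, smul_smul]
  cases p <;> cases q <;> simp

theorem isPar_dzVal (x : Gen m) : IsPar (xor false x.odd) (dzVal x) := by
  cases x with
  | inl f => simpa [dzVal, Gen.odd] using isPar_coef (Entire.der f)
  | inr j => simpa [dzVal, Gen.odd] using isPar_gen (.inr ⟨j.field, j.order + 1, j.hor⟩)

theorem isPar_dprVal (x : Gen m) : IsPar (xor true x.odd) (dprVal x) := by
  cases x with
  | inl f => exact isPar_zero _
  | inr j =>
    obtain ⟨φ, n, b⟩ := j
    cases b
    · simpa [dprVal, Gen.odd] using isPar_gen (.inr ⟨φ, n, true⟩)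
    · simpa [dprVal] using isPar_zero _

theorem isPar_pdVal (j : Jet m) (x : Gen m) :
    IsPar (xor (Gen.odd (.inr j)) x.odd) (pdVal j x) := by
  cases x with
  | inl f => exact isPar_zero _
  | inr i =>
    by_cases h : i = j
    · subst h; simpa [pdVal] using isPar_one
    · simpa [pdVal, h] using isPar_zero _

theorem IsPar.dz {p : Bool} {F : Density m} (hF : IsPar p F) : IsPar p (dz F) := by
  simpa [Density.dz] using hF.superDer dzVal_admissible isPar_dzVal

theorem IsPar.dpr {p : Bool} {F : Density m} (hF : IsPar p F) : IsPar (!p) (dpr F) := by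
  simpa [Density.dpr] using hF.superDer dprVal_admissible isPar_dprVal

theorem IsPar.pd {p : Bool} {F : Density m} (hF : IsPar p F) (j : Jet m) :
    IsPar (xor (Gen.odd (.inr j)) p) (pd j F) :=
  hF.superDer (pdVal_admissible j) (isPar_pdVal j)

theorem dz_mul (F G : Density m) : dz (F * G) = dz F * G + F * dz G := by
  rw [dz, superDer_mul, twist_false]

theorem dpr_mul (F G : Density m) : dpr (F * G) = dpr F * G + invol F * dpr G := by
  rw [dpr, superDer_mul, twist_true]

theorem IsPar.dpr_mul {p : Bool} {F : Density m} (hF : IsPar p F) (G : Density m) :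
    Density.dpr (F * G) = Density.dpr F * G + koszul p true • (F * Density.dpr G) := by
  rw [Density.dpr_mul, hF.invol, smul_mul_assoc]

@[simp] theorem dz_coef (f : Entire) : dz (coef f : Density m) = coef (Entire.der f) :=
  superDer_gen _ _ _ _

@[simp] theorem dpr_coef (f : Entire) : dpr (coef f : Density m) = 0 :=
  superDer_gen _ _ _ _

theorem dz_gen (j : Jet m) : dz (gen (.inr j)) = gen (.inr ⟨j.field, j.order + 1, j.hor⟩) :=
  superDer_gen _ _ _ _

theorem dpr_gen (φ : Superfield m) (n : ℕ) :
    dpr (gen (.inr ⟨φ, n, false⟩)) = gen (.inr ⟨φ, n, true⟩) :=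
  (superDer_gen _ _ _ _).trans (by simp [dprVal])

theorem dpr_gen_hor (φ : Superfield m) (n : ℕ) : dpr (gen (.inr ⟨φ, n, true⟩)) = 0 :=
  (superDer_gen _ _ _ _).trans (by simp [dprVal])

theorem dz_invol (F : Density m) : dz (invol F) = invol (dz F) := by
  have := invol_superDer (m := m) dzVal_admissible isPar_dzVal F
  simpa [dz] using this.symm

theorem dpr_invol (F : Density m) : dpr (invol F) = -invol (dpr F) := by
  have := invol_superDer (m := m) dprVal_admissible isPar_dprVal F
  rw [koszul_true_true, neg_one_smul] at this
  exact (neg_eq_iff_eq_neg.mpr this).symm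

theorem dpr_dz (F : Density m) : dpr (dz F) = dz (dpr F) := by
  induction F using Density.induction with
  | hc r => simp [dz, dpr, superDer_algebraMap]
  | hg x =>
    cases x with
    | inl f => show dpr (dz (coef f)) = dz (dpr (coef f)); simp
    | inr j =>
      obtain ⟨φ, n, b⟩ := j
      cases b
      · rw [dz_gen, dpr_gen, dpr_gen, dz_gen]
      · rw [dz_gen, dpr_gen_hor, dpr_gen_hor, map_zero]
  | ha F G hF hG => simp [hF, hG]
  | hm F G hF hG =>
    simp only [dz_mul, dpr_mul, map_add, hF, hG, ← dz_invol]; abel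

theorem dpr_dpr (F : Density m) : dpr (dpr F) = 0 := by
  induction F using Density.induction with
  | hc r => simp [dpr, superDer_algebraMap]
  | hg x =>
    cases x with
    | inl f => show dpr (dpr (coef f)) = 0; simp
    | inr j =>
      obtain ⟨φ, n, b⟩ := j
      cases b
      · rw [dpr_gen, dpr_gen_hor]
      · rw [dpr_gen_hor, map_zero]
  | ha F G hF hG => simp [hF, hG]
  | hm F G hF hG =>
    rw [dpr_mul, map_add, dpr_mul, dpr_mul, hF, hG, dpr_invol]; simp

/-! ### Integration by parts -/

@[simp] theorem locInt_dz (F : Density m) : locInt (dz F) = 0 :=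
  (Submodule.Quotient.mk_eq_zero _).mpr (Submodule.mem_sup_left ⟨F, rfl⟩)

@[simp] theorem locInt_dpr (F : Density m) : locInt (dpr F) = 0 :=
  (Submodule.Quotient.mk_eq_zero _).mpr (Submodule.mem_sup_right ⟨F, rfl⟩)

theorem locInt_dz_mul (F G : Density m) : locInt (dz F * G) = -locInt (F * dz G) := by
  have h := locInt_dz (F * G)
  rw [dz_mul, map_add] at h
  exact eq_neg_of_add_eq_zero_left h

theorem IsPar.locInt_dpr_mul {p : Bool} {F : Density m} (hF : IsPar p F) (G : Density m) :
    locInt (Density.dpr F * G) = -(koszul p true • locInt (F * Density.dpr G)) := by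
  have h := locInt_dpr (F * G)
  rw [hF.dpr_mul, map_add, map_smul] at h
  exact eq_neg_of_add_eq_zero_left h

end Density

namespace Density

variable {m : ℕ}

/-! ### The Euler operator with a test density -/

theorem pd_mul (j : Jet m) (F G : Density m) :
    pd j (F * G) = pd j F * G + twist (Gen.odd (.inr j)) F * pd j G :=
  superDer_mul _ _ _ _ _

theorem pd_gen (j i : Jet m) : pd j (gen (.inr i)) = if i = j then 1 else 0 :=
  superDer_gen _ _ _ _

@[simp] theorem pd_coef (j : Jet m) (f : Entire) : pd j (coef f) = 0 :=
  superDer_gen _ _ _ _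

@[simp] theorem pd_algebraMap (j : Jet m) (r : ℂ) : pd j (algebraMap ℂ _ r) = 0 :=
  superDer_algebraMap _ _ _ _

/-- The contribution of the jets of order `n` to `eulerOp φ F G`. -/
def eulerTerm (φ : Superfield m) (F G : Density m) (n : ℕ) : Density m :=
  ((-dz) ^ n) (pd ⟨φ, n, false⟩ F * G - koszul φ.odd true • dpr (pd ⟨φ, n, true⟩ F * G))

/-- The formal adjoint of the Fréchet derivative of `F` in the direction of `φ`, applied to `G`.
For `G = 1` it is the variational derivative. -/
def eulerOp (φ : Superfield m) (F G : Density m) : Density m := ∑ᶠ n : ℕ, eulerTerm φ F G n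

theorem varDer_eq (φ : Superfield m) (F : Density m) : varDer φ F = eulerOp φ F 1 := by
  simp [varDer, eulerOp, eulerTerm]

theorem eulerTerm_finite (φ : Superfield m) (F G : Density m) :
    (Function.support (eulerTerm φ F G)).Finite := by
  refine ((pd_finite φ false F).union (pd_finite φ true F)).subset fun n hn => ?_
  by_contra h
  simp only [Set.mem_union, Set.mem_ofPred_eq, not_or, not_not] at h
  exact hn (by simp [eulerTerm, h.1, h.2])

theorem eulerOp_add_left (φ : Superfield m) (F F' G : Density m) :
    eulerOp φ (F + F') G = eulerOp φ F G + eulerOp φ F' G := by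
  rw [eulerOp, eulerOp, eulerOp,
    ← finsum_add_distrib (eulerTerm_finite φ F G) (eulerTerm_finite φ F' G)]
  refine finsum_congr fun n => ?_
  rw [eulerTerm, eulerTerm, eulerTerm, ← map_add]
  congr 1
  simp only [map_add, add_mul, smul_add]
  abel

theorem eulerOp_smul_left (φ : Superfield m) (r : ℂ) (F G : Density m) :
    eulerOp φ (r • F) G = r • eulerOp φ F G := by
  rw [eulerOp, eulerOp, smul_finsum]
  refine finsum_congr fun n => ?_
  rw [eulerTerm, eulerTerm, ← LinearMap.map_smul]
  simp only [map_smul, smul_mul_assoc]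
  rw [smul_comm, ← smul_sub, LinearMap.map_smul]

theorem eulerOp_add_right (φ : Superfield m) (F G G' : Density m) :
    eulerOp φ F (G + G') = eulerOp φ F G + eulerOp φ F G' := by
  rw [eulerOp, eulerOp, eulerOp,
    ← finsum_add_distrib (eulerTerm_finite φ F G) (eulerTerm_finite φ F G')]
  refine finsum_congr fun n => ?_
  rw [eulerTerm, eulerTerm, eulerTerm, ← map_add]
  congr 1
  simp only [mul_add, map_add, smul_add]
  abel

theorem eulerOp_smul_right (φ : Superfield m) (r : ℂ) (F G : Density m) :
    eulerOp φ F (r • G) = r • eulerOp φ F G := by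
  rw [eulerOp, eulerOp, smul_finsum]
  refine finsum_congr fun n => ?_
  rw [eulerTerm, eulerTerm, ← LinearMap.map_smul]
  simp only [map_smul, mul_smul_comm]
  rw [smul_comm, ← smul_sub, LinearMap.map_smul]

/-- `eulerOp` as a bilinear map. -/
def eulerLin (φ : Superfield m) : Density m →ₗ[ℂ] Density m →ₗ[ℂ] Density m :=
  LinearMap.mk₂ ℂ (eulerOp φ) (eulerOp_add_left φ) (eulerOp_smul_left φ) (eulerOp_add_right φ)
    (eulerOp_smul_right φ)

theorem eulerLin_apply (φ : Superfield m) (F G : Density m) : eulerLin φ F G = eulerOp φ F G :=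
  rfl

/-- The variational derivative as a linear map. -/
theorem varDer_eq_eulerLin (φ : Superfield m) (F : Density m) :
    varDer φ F = eulerLin φ F 1 := varDer_eq φ F

@[simp] theorem eulerLin_algebraMap (φ : Superfield m) (r : ℂ) (G : Density m) :
    eulerLin φ (algebraMap ℂ _ r) G = 0 := by
  simp [eulerLin_apply, eulerOp, eulerTerm]

@[simp] theorem eulerLin_coef (φ : Superfield m) (f : Entire) (G : Density m) :
    eulerLin φ (coef f) G = 0 := by
  simp [eulerLin_apply, eulerOp, eulerTerm]

theorem eulerLin_gen (φ ψ : Superfield m) (k : ℕ) (G : Density m) :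
    eulerLin φ (gen (.inr ⟨ψ, k, false⟩)) G = if ψ = φ then ((-dz) ^ k) G else 0 := by
  rw [eulerLin_apply, eulerOp, finsum_eq_single _ k]
  · by_cases h : ψ = φ <;> simp [eulerTerm, pd_gen, h]
  · intro n hn; simp [eulerTerm, pd_gen, hn.symm]

theorem eulerLin_gen_hor (φ ψ : Superfield m) (k : ℕ) (G : Density m) :
    eulerLin φ (gen (.inr ⟨ψ, k, true⟩)) G =
      if ψ = φ then -(koszul φ.odd true • ((-dz) ^ k) (dpr G)) else 0 := by
  rw [eulerLin_apply, eulerOp, finsum_eq_single _ k]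
  · by_cases h : ψ = φ <;> simp [eulerTerm, pd_gen, h]
  · intro n hn; simp [eulerTerm, pd_gen, hn.symm]

theorem eulerLin_fld (φ ψ : Superfield m) (G : Density m) :
    eulerLin φ (fld ψ) G = if ψ = φ then G else 0 :=
  eulerLin_gen φ ψ 0 G

theorem dz_fld (ψ : Superfield m) : dz (fld ψ) = gen (.inr ⟨ψ, 1, false⟩) := dz_gen _

theorem dpr_fld (ψ : Superfield m) : dpr (fld ψ) = gen (.inr ⟨ψ, 0, true⟩) := dpr_gen _ _

theorem eulerLin_dz_fld (φ ψ : Superfield m) (G : Density m) :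
    eulerLin φ (dz (fld ψ)) G = if ψ = φ then -dz G else 0 := by
  rw [dz_fld, eulerLin_gen]; simp

theorem eulerLin_dpr_fld (φ ψ : Superfield m) (G : Density m) :
    eulerLin φ (dpr (fld ψ)) G = if ψ = φ then -(koszul φ.odd true • dpr G) else 0 := by
  rw [dpr_fld, eulerLin_gen_hor]; simp

/-- Both derivatives are brought to the far left, so that the rest becomes a new test density. The
parity of the jet then drops out of the sign, which is why `eulerLin_mul` has only the Koszul sign
of the two factors. -/
theorem pd_mul_mul {p q : Bool} {F F' : Density m} (hF : IsPar p F) (hF' : IsPar q F')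
    (j : Jet m) (G : Density m) :
    pd j (F * F') * G = pd j F * (F' * G) + koszul p q • (pd j F' * (F * G)) := by
  rw [pd_mul, add_mul, mul_assoc, hF.twist, smul_mul_assoc, smul_mul_assoc,
    hF.comm (hF'.pd j), smul_mul_assoc, smul_smul, mul_assoc]
  congr 2
  cases p <;> cases q <;> cases Gen.odd (.inr j) <;> simp

/-- The product rule. -/
theorem eulerLin_mul {p q : Bool} {F F' : Density m} (hF : IsPar p F) (hF' : IsPar q F')
    (φ : Superfield m) (G : Density m) :
    eulerLin φ (F * F') G = eulerLin φ F (F' * G) + koszul p q • eulerLin φ F' (F * G) := by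
  rw [eulerLin_apply, eulerLin_apply, ← map_smul, eulerLin_apply, eulerOp, eulerOp, eulerOp,
    ← finsum_add_distrib (eulerTerm_finite φ F _) (eulerTerm_finite φ F' _)]
  refine finsum_congr fun n => ?_
  rw [eulerTerm, eulerTerm, eulerTerm, ← map_add, pd_mul_mul hF hF', pd_mul_mul hF hF']
  congr 1
  simp only [mul_smul_comm, map_add, map_smul, smul_add]
  abel

theorem isPar_pow_dz {p : Bool} {F : Density m} (hF : IsPar p F) (n : ℕ) :
    IsPar p (((-dz) ^ n) F) := by
  induction n with
  | zero => exact hF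
  | succ n ih => rw [pow_succ', Module.End.mul_apply]; exact ih.dz.neg

theorem IsPar.eulerLin {p q : Bool} {F G : Density m} (hF : IsPar p F) (hG : IsPar q G)
    (φ : Superfield m) : IsPar (xor φ.odd (xor p q)) (eulerLin φ F G) := by
  rw [eulerLin_apply, eulerOp]
  refine finsum_induction (IsPar _) (isPar_zero _) (fun _ _ => IsPar.add) fun n => ?_
  refine isPar_pow_dz (IsPar.sub ?_ (IsPar.smul ?_ _)) n
  · simpa [Gen.odd] using (hF.pd ⟨φ, n, false⟩).mul hG
  · have h := ((hF.pd ⟨φ, n, true⟩).mul hG).dpr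
    revert h
    cases h1 : φ.odd <;> cases p <;> cases q <;> simp [Gen.odd, h1]

theorem IsPar.varDer {p : Bool} {F : Density m} (hF : IsPar p F) (φ : Superfield m) :
    IsPar (xor φ.odd p) (varDer φ F) := by
  rw [varDer_eq_eulerLin]; simpa using hF.eulerLin isPar_one φ

theorem varDer_add (φ : Superfield m) (F G : Density m) :
    varDer φ (F + G) = varDer φ F + varDer φ G := by
  simp [varDer_eq_eulerLin]

theorem varDer_invol (φ : Superfield m) (F : Density m) :
    varDer φ (invol F) = koszul φ.odd true • invol (varDer φ F) := by
  obtain ⟨F0, F1, rfl, a0, a1, -, -⟩ := exists_hom_decomposition (C := fun _ _ => True)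
    (fun _ => trivial) trivial (fun _ => trivial) (fun _ _ _ _ _ _ _ => trivial)
    (fun _ _ _ _ _ _ _ _ => trivial) F
  rw [map_add, varDer_add, varDer_add, map_add, a0.invol, a1.invol, (a0.varDer φ).invol,
    (a1.varDer φ).invol]
  simp only [varDer_eq_eulerLin, map_smul, LinearMap.smul_apply, koszul_false_left, one_smul,
    smul_add, smul_smul]
  cases φ.odd <;> simp

/-! ### Evolutionary derivations -/

/-- Values on generators of the evolutionary derivation of parity `p` with characteristic `P`:
it annihilates coefficient functions and supercommutes with `∂` and `d'`. -/
def evoVal (p : Bool) (P : Superfield m → Density m) : Gen m → Density m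
  | .inl _ => 0
  | .inr ⟨φ, n, false⟩ => (dz ^ n) (P φ)
  | .inr ⟨φ, n, true⟩ => koszul p true • (dz ^ n) (dpr (P φ))

theorem isPar_dz_pow {p : Bool} {F : Density m} (hF : IsPar p F) (n : ℕ) :
    IsPar p ((dz ^ n) F) := by
  induction n with
  | zero => exact hF
  | succ n ih => rw [pow_succ', Module.End.mul_apply]; exact ih.dz

theorem isPar_evoVal {p : Bool} {P : Superfield m → Density m}
    (hP : ∀ φ, IsPar (xor p φ.odd) (P φ)) (x : Gen m) :
    IsPar (xor p x.odd) (evoVal p P x) := by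
  match x with
  | .inl f => exact isPar_zero _
  | .inr ⟨φ, n, false⟩ => simpa [Gen.odd, evoVal] using isPar_dz_pow (hP φ) n
  | .inr ⟨φ, n, true⟩ => 
    have h := (isPar_dz_pow (hP φ).dpr n).smul (koszul p true)
    have e : (xor p (Gen.odd (.inr ⟨φ, n, true⟩))) = !(xor p φ.odd) := by simp [Gen.odd]
    rw [e]; exact h

theorem evoVal_admissible {p : Bool} {P : Superfield m → Density m}
    (hP : ∀ φ, IsPar (xor p φ.odd) (P φ)) : Admissible p (evoVal p P) where
  add f g := by simp [evoVal]
  mul f g := by simp [evoVal]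
  const r := by simp [evoVal]
  comm x y := by
    rw [(isPar_evoVal hP x).comm (isPar_gen y), Bool.xor_comm]

/-- The evolutionary derivation of parity `p` with characteristic `P`. -/
def evo (p : Bool) (P : Superfield m → Density m) (hP : ∀ φ, IsPar (xor p φ.odd) (P φ)) :
    Density m →ₗ[ℂ] Density m := superDer p (evoVal p P) (evoVal_admissible hP)

section Evo

variable {p : Bool} {P : Superfield m → Density m} (hP : ∀ φ, IsPar (xor p φ.odd) (P φ))

theorem evo_fld (φ : Superfield m) : evo p P hP (fld φ) = P φ := superDer_gen _ _ _ _

theorem evo_mul (F G : Density m) :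
    evo p P hP (F * G) = evo p P hP F * G + twist p F * evo p P hP G := superDer_mul _ _ _ _ _

theorem evo_algebraMap (r : ℂ) : evo p P hP (algebraMap ℂ _ r) = 0 := superDer_algebraMap _ _ _ _

@[simp] theorem evo_coef (f : Entire) : evo p P hP (coef f) = 0 := superDer_gen _ _ _ _

theorem IsPar.evo {q : Bool} {F : Density m} (hF : IsPar q F) :
    IsPar (xor p q) (Density.evo p P hP F) := hF.superDer _ (isPar_evoVal hP)

theorem evo_dz (F : Density m) : evo p P hP (dz F) = dz (evo p P hP F) := by
  induction F using Density.induction with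
  | hc r => simp [dz, superDer_algebraMap, evo_algebraMap]
  | hg x =>
    match x with
    | .inl f => show evo p P hP (dz (coef f)) = dz (evo p P hP (coef f)); simp
    | .inr ⟨φ, n, false⟩ =>
      rw [dz_gen, evo, superDer_gen, superDer_gen, evoVal, evoVal, pow_succ',
        Module.End.mul_apply]
    | .inr ⟨φ, n, true⟩ =>
      rw [dz_gen, evo, superDer_gen, superDer_gen, evoVal, evoVal, pow_succ',
        Module.End.mul_apply, map_smul]
  | ha F G hF hG => simp [hF, hG]
  | hm F G hF hG =>
    have h : twist p (dz F) = dz (twist p F) := by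
      cases p
      · simp
      · exact (dz_invol F).symm
    simp only [dz_mul, evo_mul, map_add, hF, hG, h]; abel

theorem dpr_dz_pow (n : ℕ) (F : Density m) : dpr ((dz ^ n) F) = (dz ^ n) (dpr F) := by
  induction n with
  | zero => rfl
  | succ n ih => rw [pow_succ', Module.End.mul_apply, dpr_dz, ih, Module.End.mul_apply]

theorem evo_dpr (F : Density m) :
    evo p P hP (dpr F) = koszul p true • dpr (evo p P hP F) := by
  induction F using Density.induction with
  | hc r => simp [dpr, superDer_algebraMap, evo_algebraMap]
  | hg x =>
    match x with
    | .inl f => show evo p P hP (dpr (coef f)) = _ • dpr (evo p P hP (coef f)); simp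
    | .inr ⟨φ, n, false⟩ =>
      rw [dpr_gen, evo, superDer_gen, superDer_gen, evoVal, evoVal, dpr_dz_pow]
    | .inr ⟨φ, n, true⟩ =>
      rw [dpr_gen_hor, evo, superDer_gen, evoVal, map_smul, dpr_dz_pow, dpr_dpr]; simp
  | ha F G hF hG => simp [hF, hG]
  | hm F G hF hG =>
    have h : twist p (dpr F) = koszul p true • dpr (twist p F) := by
      cases p
      · simp
      · rw [twist_true, twist_true, dpr_invol]; simp
    have h1 : evo p P hP (invol F) = koszul p true • invol (evo p P hP F) := by
      rw [evo, invol_superDer _ (isPar_evoVal hP), smul_smul]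
      cases p <;> simp
    simp only [dpr_mul, evo_mul, map_add, hF, hG, h, h1, twist_invol]
    cases p <;> simp <;> abel

theorem locInt_mul_dz_pow (n : ℕ) (F G : Density m) :
    locInt (F * ((-dz) ^ n) G) = locInt ((dz ^ n) F * G) := by
  induction n generalizing F with
  | zero => rfl
  | succ n ih =>
    rw [pow_succ', Module.End.mul_apply, LinearMap.neg_apply, mul_neg, map_neg,
      ← locInt_dz_mul, ih, pow_succ, Module.End.mul_apply]

/-- All superfields, organised as in the BV bracket. -/
def sumFields {M : Type*} [AddCommMonoid M] (f : Superfield m → M) : M :=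
  (∑ c : Fin m, ∑ p : GaugeIdx, (f (.A c p) + f (.B c p))) +
    ∑ c : Fin m, ∑ I : Fin 4, ∑ u : Fin 4, (f (.Z c I u) + f (.Psi c I u))

theorem sumFields_add {M : Type*} [AddCommMonoid M] (f g : Superfield m → M) :
    sumFields (fun φ => f φ + g φ) = sumFields f + sumFields g := by
  simp only [sumFields, Finset.sum_add_distrib]; abel

theorem sumFields_smul (r : ℂ) {M : Type*} [AddCommMonoid M] [Module ℂ M]
    (f : Superfield m → M) :
    sumFields (fun φ => r • f φ) = r • sumFields f := by
  simp only [sumFields, smul_add, Finset.smul_sum]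

theorem map_sumFields {M N : Type*} [AddCommMonoid M] [AddCommMonoid N] (g : M →+ N)
    (f : Superfield m → M) : g (sumFields f) = sumFields fun φ => g (f φ) := by
  simp only [sumFields, map_add, map_sum]

theorem sumFields_ite {M : Type*} [AddCommMonoid M] (ψ : Superfield m) (f : Superfield m → M) :
    sumFields (fun φ => if ψ = φ then f φ else 0) = f ψ := by
  cases ψ with
  | A c p => simp [sumFields, ite_and]
  | B c p => simp [sumFields, ite_and]
  | Z c I u => simp [sumFields, ite_and]
  | Psi c I u => simp [sumFields, ite_and]

/-- Integration by parts for an evolutionary derivation, with a test density. -/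
theorem locInt_evo_mul (F G : Density m) :
    locInt (evo p P hP F * G) = sumFields fun φ => locInt (P φ * eulerLin φ F G) := by
  -- The claim must hold for every test density at once: in the product step one factor is absorbed
  -- into `G`. The product rule needs homogeneous factors, hence the even–odd decomposition.
  suffices h : ∃ F0 F1, F = F0 + F1 ∧ IsPar false F0 ∧ IsPar true F1 ∧
      (∀ G, locInt (evo p P hP F0 * G) = sumFields fun φ => locInt (P φ * eulerLin φ F0 G)) ∧
      ∀ G, locInt (evo p P hP F1 * G) = sumFields fun φ => locInt (P φ * eulerLin φ F1 G) by
    obtain ⟨F0, F1, rfl, -, -, c0, c1⟩ := h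
    simp only [map_add, add_mul, LinearMap.add_apply, mul_add, c0, c1, sumFields_add]
  refine exists_hom_decomposition (C := fun _ F => ∀ G, locInt (evo p P hP F * G) =
    sumFields fun φ => locInt (P φ * eulerLin φ F G)) ?_ ?_ ?_ ?_ ?_ F
  · intro r G
    simp [evo_algebraMap, sumFields]
  · intro G
    simp [sumFields]
  · intro x G
    match x with
    | .inl f =>
      show locInt (evo p P hP (coef f) * G) = sumFields fun φ => locInt (P φ * eulerLin φ (coef f) G)
      simp [sumFields]
    | .inr ⟨ψ, n, false⟩ =>
      rw [evo, superDer_gen]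
      simp only [eulerLin_gen, mul_ite, mul_zero, apply_ite locInt, map_zero]
      rw [sumFields_ite, locInt_mul_dz_pow]; rfl
    | .inr ⟨ψ, n, true⟩ =>
      rw [evo, superDer_gen]
      simp only [eulerLin_gen_hor, mul_ite, mul_zero, apply_ite locInt, map_zero]
      rw [sumFields_ite, evoVal, mul_neg, mul_smul_comm, map_neg, map_smul, locInt_mul_dz_pow,
        ← dpr_dz_pow, smul_mul_assoc, map_smul, (isPar_dz_pow (hP ψ) n).locInt_dpr_mul]
      cases p <;> cases ψ.odd <;> simp
  · intro r F F' _ _ hF hF' G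
    simp only [map_add, add_mul, LinearMap.add_apply, mul_add, hF, hF', sumFields_add]
  · intro q r F F' a a' hF hF' G
    simp only [eulerLin_mul a a', mul_add, map_add, mul_smul_comm, map_smul]
    rw [sumFields_add, sumFields_smul, ← hF, ← hF', evo_mul, add_mul, map_add, a.twist,
      mul_assoc, smul_mul_assoc, smul_mul_assoc, a.comm (a'.evo hP), smul_mul_assoc, smul_smul,
      mul_assoc, map_smul]
    congr 2
    cases p <;> cases q <;> cases r <;> simp

theorem locInt_evo (F : Density m) :
    locInt (evo p P hP F) = sumFields fun φ => locInt (P φ * varDer φ F) := by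
  simpa [varDer_eq_eulerLin] using locInt_evo_mul hP F 1

end Evo

/-- The field conjugate to a given one. -/
def _root_.Superfield.conj : Superfield m → Superfield m
  | .A c p => .B c p
  | .B c p => .A c p
  | .Z c I u => .Psi c I u
  | .Psi c I u => .Z c I u

theorem _root_.Superfield.conj_odd (φ : Superfield m) : φ.conj.odd = !φ.odd := by
  cases φ <;> rfl

/-- The characteristic of the Hamiltonian vector field of `F` of parity `p`. -/
def hamChar (p : Bool) (F : Density m) (φ : Superfield m) : Density m :=
  koszul p φ.odd • varDer φ.conj F

theorem isPar_hamChar {p : Bool} {F : Density m} (hF : IsPar p F) (φ : Superfield m) :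
    IsPar (xor (!p) φ.odd) (hamChar p F φ) := by
  have h := (hF.varDer φ.conj).smul (koszul p φ.odd)
  rw [Superfield.conj_odd] at h
  have e : (xor (!p) φ.odd) = xor (!φ.odd) p := by cases p <;> cases φ.odd <;> rfl
  rw [e]; exact h

/-- The Hamiltonian vector field of a homogeneous functional. -/
def ham {p : Bool} {F : Density m} (hF : IsPar p F) : Density m →ₗ[ℂ] Density m :=
  evo (!p) (hamChar p F) (isPar_hamChar hF)

/-- Integration by parts moves all derivatives off the characteristic. After this, brackets with the
action and with `𝐓_V` can be computed by the Leibniz rule from their values on fields. -/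
theorem locInt_bv {p : Bool} {F : Density m} (hF : IsPar p F) (G : Density m) :
    locInt (bv F G) = locInt (ham hF G) := by
  rw [ham, locInt_evo, bv]
  refine Eq.trans ?_ (map_sumFields locInt.toAddMonoidHom fun φ => hamChar p F φ * varDer φ G)
  refine congrArg locInt ?_
  simp only [sumFields, hamChar, Superfield.conj, Superfield.odd]
  congr 1
  · refine Finset.sum_congr rfl fun c _ => Finset.sum_congr rfl fun i _ => ?_
    rw [(hF.varDer (.B c i)).invol, add_comm]
    cases p <;> simp [Superfield.odd]
  · refine Finset.sum_congr rfl fun c _ => Finset.sum_congr rfl fun I _ =>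
      Finset.sum_congr rfl fun u _ => ?_
    rw [(hF.varDer (.Z c I u)).invol]
    cases p <;> simp [Superfield.odd]

theorem bv_add_left (F F' G : Density m) : bv (F + F') G = bv F G + bv F' G := by
  simp only [bv, varDer_add, map_add, add_mul, Finset.sum_add_distrib]; abel

theorem bv_add_right (F G G' : Density m) : bv F (G + G') = bv F G + bv F G' := by
  simp only [bv, varDer_add, mul_add, Finset.sum_add_distrib]; abel

theorem lieBV_add_left (F F' G : Density m) : lieBV (F + F') G = lieBV F G + lieBV F' G := by
  simp only [lieBV, map_add, bv_add_left]

theorem lieBV_add_right (F G G' : Density m) : lieBV F (G + G') = lieBV F G + lieBV F G' :=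
  bv_add_right _ _ _

/-- The décalage sign cancels the involution on the term with the even-field derivative of `F` and
reappears on the other term, where passing an odd variational derivative costs a minus sign. -/
theorem lieBV_eq (F G : Density m) : lieBV F G =
    (∑ c : Fin m, ∑ p : GaugeIdx,
      (varDer (.B c p) F * varDer (.A c p) G - invol (varDer (.A c p) F) * varDer (.B c p) G)) +
    ∑ c : Fin m, ∑ I : Fin 4, ∑ u : Fin 4,
      (varDer (.Z c I u) F * varDer (.Psi c I u) G
        - invol (varDer (.Psi c I u) F) * varDer (.Z c I u) G) := by
  simp only [lieBV, bv, varDer_invol, Superfield.odd, koszul_true_true, koszul_false_left,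
    one_smul, neg_one_smul, invol_invol, neg_mul, sub_eq_neg_add]

theorem lieBV_smul_left (r : ℂ) (F G : Density m) : lieBV (r • F) G = r • lieBV F G := by
  simp only [lieBV_eq, varDer_eq_eulerLin, map_smul, LinearMap.smul_apply, smul_mul_assoc,
    ← smul_sub, Finset.smul_sum, smul_add]

/-- Graded antisymmetry of the Lie superbracket, on the level of densities. -/
theorem lieBV_antisymm {p q : Bool} {F G : Density m} (hF : IsPar p F) (hG : IsPar q G) :
    lieBV F G = -(koszul (!p) (!q) • lieBV G F) := by
  rw [lieBV_eq, lieBV_eq, smul_add, neg_add]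
  simp only [Finset.smul_sum, ← Finset.sum_neg_distrib]
  congr 1
  · refine Finset.sum_congr rfl fun c _ => Finset.sum_congr rfl fun i _ => ?_
    rw [(hF.varDer _).invol, (hG.varDer _).invol, smul_mul_assoc, smul_mul_assoc,
      (hF.varDer (.B c i)).comm (hG.varDer _), (hF.varDer (.A c i)).comm (hG.varDer _)]
    cases p <;> cases q <;> simp [Superfield.odd] <;> abel
  · refine Finset.sum_congr rfl fun c _ => Finset.sum_congr rfl fun I _ =>
      Finset.sum_congr rfl fun u _ => ?_
    rw [(hF.varDer _).invol, (hG.varDer _).invol, smul_mul_assoc, smul_mul_assoc,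
      (hF.varDer (.Z c I u)).comm (hG.varDer _), (hF.varDer (.Psi c I u)).comm (hG.varDer _)]
    cases p <;> cases q <;> simp [Superfield.odd] <;> abel

end Density

/-! ### Coefficient functions inside the densities -/

namespace Density

variable {m : ℕ}

/-- The inclusion of the coefficient functions as an algebra homomorphism. -/
def coefHom (m : ℕ) : Entire →ₐ[ℂ] Density m where
  toFun := coef
  map_one' := by simpa using coef_const (m := m) 1
  map_mul' := coef_mul
  map_zero' := by simpa using coef_const (m := m) 0
  map_add' := coef_add
  commutes' := coef_const

@[simp] theorem coef_zero : (coef 0 : Density m) = 0 := map_zero (coefHom m)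
@[simp] theorem coef_one : (coef 1 : Density m) = 1 := map_one (coefHom m)
theorem coef_neg (f : Entire) : (coef (-f) : Density m) = -coef f := map_neg (coefHom m) f
theorem coef_smul (r : ℂ) (f : Entire) : (coef (r • f) : Density m) = r • coef f :=
  map_smul (coefHom m) r f
theorem coef_sum {ι : Type*} (s : Finset ι) (f : ι → Entire) :
    (coef (∑ i ∈ s, f i) : Density m) = ∑ i ∈ s, coef (f i) := map_sum (coefHom m) f s

/-- A coefficient function involves no jets and is even, so it passes into the test density. -/
theorem eulerLin_coef_mul (φ : Superfield m) (f : Entire) (F G : Density m) :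
    eulerLin φ (coef f * F) G = eulerLin φ F (coef f * G) := by
  obtain ⟨F0, F1, rfl, a0, a1, -, -⟩ := exists_hom_decomposition (C := fun _ _ => True)
    (fun _ => trivial) trivial (fun _ => trivial) (fun _ _ _ _ _ _ _ => trivial)
    (fun _ _ _ _ _ _ _ _ => trivial) F
  rw [mul_add, map_add, LinearMap.add_apply, eulerLin_mul (isPar_coef f) a0,
    eulerLin_mul (isPar_coef f) a1]
  simp

end Density

/-! ### Gauge matrices and symmetries of the Levi-Civita symbol -/

namespace BLG

open Density

variable {m : ℕ}

theorem isPar_Z (c : Fin m) (I u : Fin 4) : IsPar false (Z c I u) := isPar_fld _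
theorem isPar_Psi (c : Fin m) (I u : Fin 4) : IsPar true (Psi c I u) := isPar_fld _

theorem isPar_soMatrix {p : Bool} {X : GaugeIdx → Density m} (h : ∀ i, IsPar p (X i))
    (u v : Fin 4) : IsPar p (soMatrix X u v) := by
  unfold soMatrix
  split_ifs
  · exact h _
  · exact (h _).neg
  · exact isPar_zero _

theorem isPar_gaugeA (c : Fin m) (u v : Fin 4) : IsPar true (gaugeA c u v) :=
  isPar_soMatrix (fun p => isPar_fld (.A c p)) u v

theorem isPar_gaugeB (c : Fin m) (u v : Fin 4) : IsPar false (gaugeB c u v) :=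
  isPar_soMatrix (fun p => isPar_fld (.B c p)) u v

theorem isPar_sharpB (c : Fin m) (u v : Fin 4) : IsPar false (sharpB c u v) :=
  IsPar.smul (IsPar.sum fun _ _ => IsPar.sum fun _ _ => (isPar_gaugeB c _ _).smul _) _

theorem soMatrix_antisymm (X : GaugeIdx → Density m) (u v : Fin 4) :
    soMatrix X u v = -soMatrix X v u := by
  unfold soMatrix
  rcases lt_trichotomy u v with h | h | h
  · simp [h, h.not_gt]
  · simp [h]
  · simp [h, h.not_gt]

/-- The integer Levi-Civita symbol. -/
def leviInt (i : Fin 4 → Fin 4) : ℤ :=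
  ∏ a : Fin 4, ∏ b ∈ Finset.Ioi a, (SignType.sign ((i b : ℤ) - (i a : ℤ)) : ℤ)

theorem levi_eq (i : Fin 4 → Fin 4) : levi i = (leviInt i : ℂ) := rfl

theorem levi_swap01 (a b c d : Fin 4) : levi ![b, a, c, d] = -levi ![a, b, c, d] := by
  have h : ∀ a b c d : Fin 4, leviInt ![b, a, c, d] = -leviInt ![a, b, c, d] := by decide +kernel
  rw [levi_eq, levi_eq, h]; simp

theorem levi_swap12 (a b c d : Fin 4) : levi ![a, c, b, d] = -levi ![a, b, c, d] := by
  have h : ∀ a b c d : Fin 4, leviInt ![a, c, b, d] = -leviInt ![a, b, c, d] := by decide +kernel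
  rw [levi_eq, levi_eq, h]; simp

theorem levi_swap23 (a b c d : Fin 4) : levi ![a, b, d, c] = -levi ![a, b, c, d] := by
  have h : ∀ a b c d : Fin 4, leviInt ![a, b, d, c] = -leviInt ![a, b, c, d] := by decide +kernel
  rw [levi_eq, levi_eq, h]; simp

theorem levi_rotate (a b c d : Fin 4) : levi ![c, d, a, b] = levi ![a, b, c, d] := by
  have h : ∀ a b c d : Fin 4, leviInt ![c, d, a, b] = leviInt ![a, b, c, d] := by decide +kernel
  rw [levi_eq, levi_eq, h]

theorem sharpB_antisymm (c : Fin m) (u v : Fin 4) : sharpB c u v = -sharpB c v u := by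
  unfold sharpB
  rw [← smul_neg, ← Finset.sum_neg_distrib]
  congr 1
  refine Finset.sum_congr rfl fun w _ => ?_
  rw [← Finset.sum_neg_distrib]
  refine Finset.sum_congr rfl fun x _ => ?_
  rw [levi_swap01, neg_smul]

/-! ### Families of matter type -/

/-- A family of densities with a copy index, a flavour index and a gauge index. -/
abbrev Fam (m : ℕ) : Type := Fin m → Fin 4 → Fin 4 → Density m

/-- All members of the family have parity `p`. -/
def FamPar (p : Bool) (X : Fam m) : Prop := ∀ c I u, IsPar p (X c I u)

/-- The family `𝐙`. -/
def ZF : Fam m := Z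

/-- The family `𝚿`. -/
def PsiF : Fam m := Psi

theorem famPar_ZF : FamPar false (ZF (m := m)) := isPar_Z
theorem famPar_PsiF : FamPar true (PsiF (m := m)) := isPar_Psi

/-- The action of a matrix of coefficient functions on the flavour index. -/
def act (M : Matrix (Fin 4) (Fin 4) Entire) (X : Fam m) : Fam m := fun c I u =>
  ∑ J : Fin 4, coef (M I J) * X c J u

/-- The gauge invariant bilinear expression `M_{IJ} X^I · Y^J`, summed over the copies. -/
def bil (M : Matrix (Fin 4) (Fin 4) Entire) (X Y : Fam m) : Density m :=
  ∑ c : Fin m, ∑ I : Fin 4, ∑ J : Fin 4, ∑ u : Fin 4, coef (M I J) * (X c I u * Y c J u)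

/-- The covariant derivative `∂_𝐁` of a family. -/
def covD (k : Fin m → ℂ) (X : Fam m) : Fam m := fun c I u => covB k c (X c I) u

/-- The covariant leafwise differential `d'_𝐀` of a family. -/
def covDpr (X : Fam m) : Fam m := fun c I u => dpr (X c I u) + ∑ v : Fin 4, gaugeA c u v * X c I v

theorem FamPar.act {p : Bool} {X : Fam m} (hX : FamPar p X)
    (M : Matrix (Fin 4) (Fin 4) Entire) : FamPar p (act M X) := fun c I u =>
  IsPar.sum fun J _ => by simpa using (isPar_coef (M I J)).mul (hX c J u)

theorem FamPar.add {p : Bool} {X Y : Fam m} (hX : FamPar p X) (hY : FamPar p Y) :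
    FamPar p (X + Y) := fun c I u => (hX c I u).add (hY c I u)

theorem FamPar.covD {p : Bool} {X : Fam m} (hX : FamPar p X) (k : Fin m → ℂ) :
    FamPar p (covD k X) := fun c I u =>
  (hX c I u).dz.sub (IsPar.smul (IsPar.sum fun v _ => by
    simpa using (isPar_sharpB c u v).mul (hX c I v)) _)

theorem FamPar.covDpr {p : Bool} {X : Fam m} (hX : FamPar p X) :
    FamPar (!p) (covDpr X) := fun c I u =>
  (hX c I u).dpr.add (IsPar.sum fun v _ => by
    simpa using (isPar_gaugeA c u v).mul (hX c I v))

theorem FamPar.bil {p q : Bool} {X Y : Fam m} (hX : FamPar p X) (hY : FamPar q Y)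
    (M : Matrix (Fin 4) (Fin 4) Entire) : IsPar (xor p q) (bil M X Y) :=
  IsPar.sum fun c _ => IsPar.sum fun I _ => IsPar.sum fun J _ => IsPar.sum fun u _ => by
    simpa using (isPar_coef (M I J)).mul ((hX c I u).mul (hY c J u))

section Bilinear

variable (M N : Matrix (Fin 4) (Fin 4) Entire) (X X' Y Y' : Fam m) (r : ℂ)

theorem bil_add : bil (M + N) X Y = bil M X Y + bil N X Y := by
  simp only [bil, Matrix.add_apply, coef_add, add_mul, Finset.sum_add_distrib]

theorem bil_smul : bil (r • M) X Y = r • bil M X Y := by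
  simp only [bil, Matrix.smul_apply, coef_smul, smul_mul_assoc, Finset.smul_sum]

theorem bil_neg : bil (-M) X Y = -bil M X Y := by
  rw [← neg_one_smul ℂ, bil_smul, neg_one_smul]

theorem bil_sub : bil (M - N) X Y = bil M X Y - bil N X Y := by
  rw [sub_eq_add_neg, bil_add, bil_neg, sub_eq_add_neg]

theorem bil_add_left : bil M (X + X') Y = bil M X Y + bil M X' Y := by
  simp only [bil, Pi.add_apply, add_mul, mul_add, Finset.sum_add_distrib]

theorem bil_add_right : bil M X (Y + Y') = bil M X Y + bil M X Y' := by
  simp only [bil, Pi.add_apply, mul_add, Finset.sum_add_distrib]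

theorem bil_smul_left : bil M (r • X) Y = r • bil M X Y := by
  simp only [bil, Pi.smul_apply, smul_mul_assoc, mul_smul_comm, Finset.smul_sum]

theorem bil_smul_right : bil M X (r • Y) = r • bil M X Y := by
  simp only [bil, Pi.smul_apply, mul_smul_comm, Finset.smul_sum]

theorem bil_neg_left : bil M (-X) Y = -bil M X Y := by
  rw [← neg_one_smul ℂ, bil_smul_left, neg_one_smul]

theorem bil_neg_right : bil M X (-Y) = -bil M X Y := by
  rw [← neg_one_smul ℂ, bil_smul_right, neg_one_smul]

theorem bil_sub_left : bil M (X - X') Y = bil M X Y - bil M X' Y := by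
  rw [sub_eq_add_neg, bil_add_left, bil_neg_left, sub_eq_add_neg]

theorem bil_sub_right : bil M X (Y - Y') = bil M X Y - bil M X Y' := by
  rw [sub_eq_add_neg, bil_add_right, bil_neg_right, sub_eq_add_neg]

theorem bil_act_right : bil M X (act N Y) = bil (M * N) X Y := by
  simp only [bil, act, Matrix.mul_apply, coef_sum, coef_mul, Finset.mul_sum, Finset.sum_mul]
  refine Finset.sum_congr rfl fun c _ => Finset.sum_congr rfl fun I _ => ?_
  rw [Finset.sum_comm]
  conv_rhs => rw [Finset.sum_comm]
  refine Finset.sum_congr rfl fun u _ => ?_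
  rw [Finset.sum_comm]
  refine Finset.sum_congr rfl fun K _ => Finset.sum_congr rfl fun J _ => ?_
  rw [mul_assoc, ← mul_assoc (X c I u), ← coef_comm (N J K), mul_assoc]

theorem bil_act_left : bil M (act N X) Y = bil (N.transpose * M) X Y := by
  simp only [bil, act, Matrix.mul_apply, Matrix.transpose_apply, coef_sum, coef_mul,
    Finset.mul_sum, Finset.sum_mul]
  refine Finset.sum_congr rfl fun c _ => ?_
  rw [Finset.sum_comm]
  conv_rhs => rw [Finset.sum_comm]
  refine Finset.sum_congr rfl fun J _ => ?_
  rw [Finset.sum_comm]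
  conv_rhs => rw [Finset.sum_comm]
  refine Finset.sum_congr rfl fun u _ => ?_
  rw [Finset.sum_comm]
  refine Finset.sum_congr rfl fun K _ => Finset.sum_congr rfl fun I _ => ?_
  rw [coef_comm (N I K) (coef (M I J)), mul_assoc, mul_assoc]

/-- Graded symmetry of the bilinear expressions. -/
theorem bil_swap {p q : Bool} {X Y : Fam m} (hX : FamPar p X) (hY : FamPar q Y) :
    bil M X Y = koszul p q • bil M.transpose Y X := by
  simp only [bil, Finset.smul_sum, Matrix.transpose_apply]
  refine Finset.sum_congr rfl fun c _ => ?_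
  rw [Finset.sum_comm]
  refine Finset.sum_congr rfl fun J _ => Finset.sum_congr rfl fun I _ =>
    Finset.sum_congr rfl fun u _ => ?_
  rw [(hX c I u).comm (hY c J u), mul_smul_comm]

/-- Infinitesimal `𝔰𝔬(4)`-invariance of the dot product on `R`, with Koszul signs. It is used for
the even connection `𝐁` in `dz_dot` and for the odd connection `𝐀` in `dpr_dot`. -/
theorem sum_antisymm_dot (S : Fin 4 → Fin 4 → Density m) (hS : ∀ u v, S u v = -S v u)
    {p q : Bool} (hp : ∀ u v, IsPar p (S u v)) {x : Fin 4 → Density m} (hx : ∀ u, IsPar q (x u))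
    (y : Fin 4 → Density m) :
    ∑ u, (∑ v, S u v * x v) * y u + koszul p q • ∑ u, x u * ∑ v, S u v * y v = 0 := by
  simp only [Finset.sum_mul, Finset.mul_sum, Finset.smul_sum]
  rw [Finset.sum_comm, ← Finset.sum_add_distrib]
  refine Finset.sum_eq_zero fun u _ => ?_
  rw [← Finset.sum_add_distrib]
  refine Finset.sum_eq_zero fun v _ => ?_
  rw [← mul_assoc (x u), (hx u).comm (hp u v), hS v u, smul_mul_assoc, smul_smul, neg_mul, neg_mul]
  cases p <;> cases q <;> simp

theorem bil_eq : bil M X Y =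
    ∑ c : Fin m, ∑ I : Fin 4, ∑ J : Fin 4, coef (M I J) * ∑ u : Fin 4, X c I u * Y c J u := by
  simp only [bil, Finset.mul_sum]

/-- On a gauge invariant product the `𝐁`-terms of the two covariant derivatives cancel, so `∂` may
be replaced by `∂_𝐁` on each factor. -/
theorem dz_dot (k : Fin m → ℂ) (c : Fin m) {p : Bool} {x : Fin 4 → Density m}
    (hx : ∀ u, IsPar p (x u)) (y : Fin 4 → Density m) :
    dz (∑ u, x u * y u) = ∑ u, covB k c x u * y u + ∑ u, x u * covB k c y u := by
  have h := sum_antisymm_dot (sharpB c) (sharpB_antisymm c) (isPar_sharpB c) hx y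
  rw [koszul_false_left, one_smul] at h
  simp only [map_sum, dz_mul, covB, sub_mul, mul_sub, Finset.sum_add_distrib,
    Finset.sum_sub_distrib, smul_mul_assoc, mul_smul_comm, ← Finset.smul_sum]
  rw [eq_neg_of_add_eq_zero_left h, smul_neg]
  abel

/-- The same for `d'`: the `𝐀`-terms cancel, with the sign of `𝐀` passing `x`. -/
theorem dpr_dot (c : Fin m) {p : Bool} {x : Fin 4 → Density m}
    (hx : ∀ u, IsPar p (x u)) (y : Fin 4 → Density m) :
    dpr (∑ u, x u * y u) = ∑ u, (dpr (x u) + ∑ v, gaugeA c u v * x v) * y u +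
      koszul p true • ∑ u, x u * (dpr (y u) + ∑ v, gaugeA c u v * y v) := by
  have h := sum_antisymm_dot (gaugeA c) (soMatrix_antisymm _) (isPar_gaugeA c) hx y
  have e : koszul p true = koszul true p := by cases p <;> rfl
  simp only [map_sum, (hx _).dpr_mul, add_mul, mul_add, Finset.sum_add_distrib,
    ← Finset.smul_sum, smul_add]
  rw [eq_neg_of_add_eq_zero_left h, e]
  abel

theorem dz_bil (k : Fin m → ℂ) {p : Bool} {X : Fam m} (hX : FamPar p X) :
    dz (bil M X Y) = bil (M.map Entire.der) X Y + bil M (covD k X) Y + bil M X (covD k Y) := by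
  simp only [bil_eq, map_sum, ← Finset.sum_add_distrib]
  refine Finset.sum_congr rfl fun c _ => Finset.sum_congr rfl fun I _ =>
    Finset.sum_congr rfl fun J _ => ?_
  rw [dz_mul, dz_coef, dz_dot k c (hX c I), mul_add, add_assoc]
  rfl

theorem dpr_bil {p : Bool} {X : Fam m} (hX : FamPar p X) :
    dpr (bil M X Y) = bil M (covDpr X) Y + koszul p true • bil M X (covDpr Y) := by
  simp only [bil_eq, map_sum, Finset.smul_sum (s := (Finset.univ : Finset (Fin m))),
    Finset.smul_sum (s := (Finset.univ : Finset (Fin 4))), ← Finset.sum_add_distrib]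
  refine Finset.sum_congr rfl fun c _ => Finset.sum_congr rfl fun I _ =>
    Finset.sum_congr rfl fun J _ => ?_
  rw [(isPar_coef _).dpr_mul, dpr_coef, dpr_dot c (hX c I)]
  rw [zero_mul, zero_add, koszul_false_left, one_smul, mul_add, mul_smul_comm]
  rfl

theorem covD_act (k : Fin m → ℂ) : covD k (act M X) = act (M.map Entire.der) X + act M (covD k X) := by
  funext c I u
  simp only [covD, covB, act, Pi.add_apply, map_sum, dz_mul, dz_coef, Matrix.map_apply,
    Finset.sum_add_distrib, mul_sub, Finset.sum_sub_distrib, Finset.mul_sum, mul_smul_comm,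
    Finset.smul_sum]
  rw [add_sub_assoc]
  congr 2
  rw [Finset.sum_comm]
  refine Finset.sum_congr rfl fun J _ => Finset.sum_congr rfl fun v _ => ?_
  rw [← mul_assoc, ← mul_assoc, coef_comm]

end Bilinear

section Scalar
variable (V : Entire) (X Y : Fam m)

theorem bil_scalar : bil (V • (1 : Matrix (Fin 4) (Fin 4) Entire)) X Y =
    coef V * ∑ c : Fin m, ∑ I : Fin 4, ∑ u : Fin 4, X c I u * Y c I u := by
  simp only [bil, Finset.mul_sum, Matrix.smul_apply, Matrix.one_apply, smul_eq_mul, mul_ite, mul_one,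
    mul_zero]
  refine Finset.sum_congr rfl fun c _ => Finset.sum_congr rfl fun I _ => ?_
  rw [Finset.sum_eq_single I]
  · simp
  · intro J _ h; simp [h.symm]
  · simp

end Scalar

/-! ### The currents as bilinear expressions -/

/-- The dual matrix `½ ε_{IJKL} Γ^{IJ}`. -/
def dual (G : Matrix (Fin 4) (Fin 4) Entire) : Matrix (Fin 4) (Fin 4) Entire := fun K L =>
  (1 / 2 : ℂ) • ∑ I : Fin 4, ∑ J : Fin 4, levi ![I, J, K, L] • G I J

theorem currentL_eq (U : Matrix (Fin 4) (Fin 4) Entire) :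
    currentL U = bil U (PsiF (m := m)) ZF := by
  simp only [currentL, bil, mul_assoc]; rfl

theorem currentXi_eq (S : Matrix (Fin 4) (Fin 4) Entire) :
    currentXi S = (1 / 2 : ℂ) • bil S (ZF (m := m)) ZF := by
  simp only [currentXi, bil]; rfl

theorem sum_comm_pairs {M : Type*} [AddCommMonoid M] (f : Fin 4 → Fin 4 → Fin 4 → Fin 4 → M) :
    ∑ I, ∑ J, ∑ K, ∑ L, f I J K L = ∑ K, ∑ L, ∑ I, ∑ J, f I J K L := by
  simp only [← Fintype.sum_prod_type' (f := fun (_ _ : Fin 4) => (_ : M))]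
  rw [Finset.sum_comm]

theorem coef_dual (G : Matrix (Fin 4) (Fin 4) Entire) (K L : Fin 4) :
    (coef (dual G K L) : Density m) =
      (1 / 2 : ℂ) • ∑ I : Fin 4, ∑ J : Fin 4, levi ![I, J, K, L] • coef (G I J) := by
  simp only [dual, coef_smul, coef_sum]

theorem sum_dual_mul (G : Matrix (Fin 4) (Fin 4) Entire) (a : Fin 4 → Fin 4 → Density m) :
    ∑ K : Fin 4, ∑ L : Fin 4, coef (dual G K L) * a K L =
      ∑ I : Fin 4, ∑ J : Fin 4, coef (G I J) *
        ((1 / 2 : ℂ) • ∑ K : Fin 4, ∑ L : Fin 4, levi ![I, J, K, L] • a K L) := by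
  simp only [coef_dual, smul_mul_assoc, mul_smul_comm, ← Finset.smul_sum, Finset.sum_mul,
    Finset.mul_sum]
  rw [← sum_comm_pairs]

theorem currentTheta_eq (k : Fin m → ℂ) (G : Matrix (Fin 4) (Fin 4) Entire) :
    currentTheta k G = (1 / 2 : ℂ) • bil G PsiF PsiF - (1 / 2 : ℂ) • bil (dual G) ZF (covD k ZF) := by
  rw [← smul_sub, bil_eq, bil_eq, ← Finset.sum_sub_distrib, currentTheta]
  refine congrArg (HSMul.hSMul (1 / 2 : ℂ)) (Finset.sum_congr rfl fun c _ => ?_)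
  rw [sum_dual_mul G fun K L => ∑ u, ZF c K u * covD k ZF c L u, ← Finset.sum_sub_distrib]
  refine Finset.sum_congr rfl fun I _ => ?_
  rw [← Finset.sum_sub_distrib]
  refine Finset.sum_congr rfl fun J _ => ?_
  rw [← Finset.mul_sum, Finset.sum_sub_distrib, ← mul_sub, ← Finset.smul_sum]
  refine congrArg (fun x => coef (G I J) * (_ - (1 / 2 : ℂ) • x)) ?_
  rw [Finset.sum_comm]
  refine Finset.sum_congr rfl fun K _ => ?_
  rw [Finset.sum_comm]
  refine Finset.sum_congr rfl fun L _ => ?_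
  rw [← Finset.smul_sum]
  rfl

theorem currentTHat_eq (k : Fin m → ℂ) (V : Entire) :
    currentTHat k V = (3 / 4 : ℂ) • bil (V • (1 : Matrix (Fin 4) (Fin 4) Entire)) PsiF (covD k ZF)
      - (1 / 4 : ℂ) • bil (V • (1 : Matrix (Fin 4) (Fin 4) Entire)) ZF (covD k PsiF) := by
  have h : currentTHat k V = coef V * ((3 / 4 : ℂ) • (∑ c : Fin m, ∑ I : Fin 4, ∑ u : Fin 4,
      PsiF c I u * covD k ZF c I u) - (1 / 4 : ℂ) • ∑ c : Fin m, ∑ I : Fin 4, ∑ u : Fin 4,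
      ZF c I u * covD k PsiF c I u) := by
    simp only [currentTHat, Finset.smul_sum, ← Finset.sum_sub_distrib, ZF, PsiF, covD]
  rw [h, bil_scalar, bil_scalar, mul_sub, mul_smul_comm, mul_smul_comm]

end BLG

/-! ### The Euler operator of a total derivative -/

namespace Density

variable {m : ℕ}

/-- The adjoint of `∂` is `-∂`. The test density again makes the statement stable under products. -/
theorem eulerLin_dz (φ : Superfield m) (F G : Density m) :
    eulerLin φ (dz F) G = -eulerLin φ F (dz G) := by
  suffices h : ∃ F0 F1, F = F0 + F1 ∧ IsPar false F0 ∧ IsPar true F1 ∧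
      (∀ G, eulerLin φ (dz F0) G = -eulerLin φ F0 (dz G)) ∧
      ∀ G, eulerLin φ (dz F1) G = -eulerLin φ F1 (dz G) by
    obtain ⟨F0, F1, rfl, -, -, c0, c1⟩ := h
    simp only [map_add, LinearMap.add_apply, c0, c1, neg_add]
  refine exists_hom_decomposition
    (C := fun _ F => ∀ G, eulerLin φ (dz F) G = -eulerLin φ F (dz G)) ?_ ?_ ?_ ?_ ?_ F
  · intro r G
    rw [dz, superDer_algebraMap]; simp
  · intro G; simp
  · intro x G
    match x with
    | .inl f =>
      show eulerLin φ (dz (coef f)) G = -eulerLin φ (coef f) (dz G)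
      simp
    | .inr ⟨ψ, n, false⟩ =>
      rw [dz_gen, eulerLin_gen, eulerLin_gen, pow_succ, Module.End.mul_apply]
      split_ifs <;> simp
    | .inr ⟨ψ, n, true⟩ =>
      rw [dz_gen, eulerLin_gen_hor, eulerLin_gen_hor, pow_succ, Module.End.mul_apply, dpr_dz]
      split_ifs <;> simp
  · intro p F F' _ _ h h' G
    simp only [map_add, LinearMap.add_apply, h, h', neg_add]
  · intro p q F F' a a' h h' G
    rw [dz_mul, map_add, LinearMap.add_apply, eulerLin_mul a.dz a', eulerLin_mul a a'.dz,
      eulerLin_mul a a', h, h', dz_mul, dz_mul, map_add, map_add]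
    simp only [smul_neg, smul_add]
    abel

end Density

/-! ### Variational derivatives of the covariant currents -/

namespace BLG

open Density

variable {m : ℕ}

section Act

variable (M N : Matrix (Fin 4) (Fin 4) Entire) (X Y : Fam m) (r : ℂ)

theorem act_smul_left : act (r • M) X = r • act M X := by
  funext c I u; simp [act, coef_smul, Finset.smul_sum]

theorem act_neg_left : act (-M) X = -act M X := by
  rw [← neg_one_smul ℂ, act_smul_left, neg_one_smul]

theorem covD_smul (k : Fin m → ℂ) : covD k (r • X) = r • covD k X := by
  funext c I u
  simp only [covD, covB, Pi.smul_apply, map_smul, mul_smul_comm, smul_sub, Finset.smul_sum]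
  congr 1
  exact Finset.sum_congr rfl fun v _ => smul_comm _ _ _

theorem covD_neg (k : Fin m → ℂ) : covD k (-X) = -covD k X := by
  rw [← neg_one_smul ℂ, covD_smul, neg_one_smul]

end Act

/-- The contribution of the members of a family to the Euler operator. -/
def adj (φ : Superfield m) (X G : Fam m) : Density m :=
  ∑ c : Fin m, ∑ I : Fin 4, ∑ u : Fin 4, eulerLin φ (X c I u) (G c I u)

theorem varDer_bil (φ : Superfield m) (M : Matrix (Fin 4) (Fin 4) Entire) {p q : Bool}
    {X Y : Fam m} (hX : FamPar p X) (hY : FamPar q Y) :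
    varDer φ (bil M X Y) = adj φ X (act M Y) + koszul p q • adj φ Y (act M.transpose X) := by
  have h : ∀ c I J u, eulerLin φ (coef (M I J) * (X c I u * Y c J u)) 1 =
      eulerLin φ (X c I u) (coef (M I J) * Y c J u) +
        koszul p q • eulerLin φ (Y c J u) (coef (M I J) * X c I u) := by
    intro c I J u
    rw [eulerLin_coef_mul, eulerLin_mul (hX c I u) (hY c J u), mul_one, coef_comm, coef_comm]
  simp only [varDer_eq_eulerLin, bil, map_sum, LinearMap.sum_apply, h, Finset.sum_add_distrib,
    adj, act, Finset.smul_sum, Matrix.transpose_apply]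
  refine congrArg₂ (· + ·) ?_ ?_
  · refine Finset.sum_congr rfl fun c _ => Finset.sum_congr rfl fun I _ => ?_
    rw [Finset.sum_comm]
  · refine Finset.sum_congr rfl fun c _ => ?_
    rw [Finset.sum_comm]
    refine Finset.sum_congr rfl fun J _ => ?_
    rw [Finset.sum_comm]

theorem adj_ZF (c : Fin m) (I u : Fin 4) (G : Fam m) : adj (.Z c I u) ZF G = G c I u := by
  simp [adj, ZF, Z, eulerLin_fld, ite_and]

theorem adj_PsiF (c : Fin m) (I u : Fin 4) (G : Fam m) : adj (.Psi c I u) PsiF G = G c I u := by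
  simp [adj, PsiF, Psi, eulerLin_fld, ite_and]

theorem adj_Z_PsiF (c : Fin m) (I u : Fin 4) (G : Fam m) : adj (.Z c I u) PsiF G = 0 := by
  simp [adj, PsiF, Psi, eulerLin_fld]

theorem adj_Psi_ZF (c : Fin m) (I u : Fin 4) (G : Fam m) : adj (.Psi c I u) ZF G = 0 := by
  simp [adj, ZF, Z, eulerLin_fld]

theorem adj_A_ZF (c : Fin m) (p : GaugeIdx) (G : Fam m) : adj (.A c p) ZF G = 0 := by
  simp [adj, ZF, Z, eulerLin_fld]

theorem adj_A_PsiF (c : Fin m) (p : GaugeIdx) (G : Fam m) : adj (.A c p) PsiF G = 0 := by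
  simp [adj, PsiF, Psi, eulerLin_fld]

theorem eulerLin_gaugeB {φ : Superfield m} (hφ : ∀ c p, Superfield.B c p ≠ φ) (c : Fin m)
    (u v : Fin 4) (G : Density m) : eulerLin φ (gaugeB c u v) G = 0 := by
  unfold gaugeB soMatrix
  split_ifs <;> simp [eulerLin_fld, hφ]

theorem eulerLin_sharpB {φ : Superfield m} (hφ : ∀ c p, Superfield.B c p ≠ φ) (c : Fin m)
    (u v : Fin 4) (G : Density m) : eulerLin φ (sharpB c u v) G = 0 := by
  simp [sharpB, eulerLin_gaugeB hφ]

/-- `∂_𝐁` is skew-adjoint: `∂` by integration by parts and `𝐁` because its matrix is antisymmetric.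
Fields other than `𝐁` see the connection as a constant. -/
theorem adj_covD {φ : Superfield m} (hφ : ∀ c p, Superfield.B c p ≠ φ) (k : Fin m → ℂ)
    {p : Bool} {X : Fam m} (hX : FamPar p X) (G : Fam m) :
    adj φ (covD k X) G = -adj φ X (covD k G) := by
  simp only [adj, ← Finset.sum_neg_distrib]
  refine Finset.sum_congr rfl fun c _ => Finset.sum_congr rfl fun I _ => ?_
  simp only [covD, covB, map_sub, LinearMap.sub_apply, map_smul, LinearMap.smul_apply, map_sum,
    LinearMap.sum_apply, eulerLin_dz, eulerLin_mul (isPar_sharpB _ _ _) (hX _ _ _),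
    eulerLin_sharpB hφ, zero_add, koszul_false_left, one_smul, Finset.sum_sub_distrib,
    Finset.sum_neg_distrib, neg_sub, ← Finset.smul_sum]
  rw [sub_eq_neg_add, neg_add_eq_sub, sub_eq_sub_iff_add_eq_add]
  have h : ∑ u, ∑ v, eulerLin φ (X c I v) (sharpB c u v * G c I u) =
      -∑ u, ∑ v, eulerLin φ (X c I u) (sharpB c u v * G c I v) := by
    rw [Finset.sum_comm]
    simp only [← Finset.sum_neg_distrib]
    refine Finset.sum_congr rfl fun u _ => Finset.sum_congr rfl fun v _ => ?_
    rw [sharpB_antisymm c v u, neg_mul, map_neg]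
  rw [h, smul_neg]
  abel

/-- The scalar matrix with diagonal entry `V`. -/
def scal (V : Entire) : Matrix (Fin 4) (Fin 4) Entire := V • 1

@[simp] theorem scal_transpose (V : Entire) : (scal V).transpose = scal V := by
  simp [scal, Matrix.transpose_smul]

@[simp] theorem map_der_scal (V : Entire) : (scal V).map Entire.der = scal (Entire.der V) := by
  ext i j
  by_cases h : i = j <;> simp [scal, h]

@[simp] theorem mul_scal (M : Matrix (Fin 4) (Fin 4) Entire) (V : Entire) : M * scal V = V • M := by
  simp [scal]

@[simp] theorem scal_mul (M : Matrix (Fin 4) (Fin 4) Entire) (V : Entire) : scal V * M = V • M := by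
  simp [scal]

theorem Z_ne_B {m : ℕ} {c : Fin m} {I u : Fin 4} (c' : Fin m) (p : GaugeIdx) :
    Superfield.B c' p ≠ .Z c I u := by simp

theorem Psi_ne_B {m : ℕ} {c : Fin m} {I u : Fin 4} (c' : Fin m) (p : GaugeIdx) :
    Superfield.B c' p ≠ .Psi c I u := by simp

theorem A_ne_B {m : ℕ} {c : Fin m} {p : GaugeIdx} (c' : Fin m) (p' : GaugeIdx) :
    Superfield.B c' p' ≠ .A c p := by simp

variable (k : Fin m → ℂ)

theorem famPar_DZ : FamPar false (covD k ZF) := famPar_ZF.covD k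
theorem famPar_DPsi : FamPar true (covD k PsiF) := famPar_PsiF.covD k

/-- `δ/δ𝐀`, `δ/δ𝐙` and `δ/δ𝚿` of a density are `0`, `FZ` and `FPsi`. -/
structure MatterVar (F : Density m) (FZ FPsi : Fam m) : Prop where
  A (c : Fin m) (p : GaugeIdx) : varDer (.A c p) F = 0
  Z (c : Fin m) (I u : Fin 4) : varDer (.Z c I u) F = FZ c I u
  Psi (c : Fin m) (I u : Fin 4) : varDer (.Psi c I u) F = FPsi c I u

theorem bil_one (X Y : Fam m) :
    bil 1 X Y = ∑ c : Fin m, ∑ I : Fin 4, ∑ u : Fin 4, X c I u * Y c I u := by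
  simpa using bil_scalar 1 X Y

/-- The bracket of functionals independent of `𝐀`. -/
theorem MatterVar.lieBV {F G : Density m} {FZ FPsi GZ GPsi : Fam m} (hF : MatterVar F FZ FPsi)
    (hG : MatterVar G GZ GPsi) :
    lieBV F G = bil 1 FZ GPsi - bil 1 (fun c I u => invol (FPsi c I u)) GZ := by
  rw [lieBV_eq, bil_one, bil_one]
  simp only [hF.A, hG.A, hF.Z, hG.Z, hF.Psi, hG.Psi, mul_zero, map_zero, zero_mul, sub_zero,
    Finset.sum_const_zero, zero_add, Finset.sum_sub_distrib]

theorem varDer_smul (φ : Superfield m) (r : ℂ) (F : Density m) :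
    varDer φ (r • F) = r • varDer φ F := by
  simp [varDer_eq_eulerLin]

theorem varDer_sub (φ : Superfield m) (F G : Density m) :
    varDer φ (F - G) = varDer φ F - varDer φ G := by
  simp [varDer_eq_eulerLin]

/-- Integrating by parts, the coefficients `¾` and `¼` add up to one full `V ∂_𝐁`; the remaining
terms in `V'` record the weights `¼` of `𝐙` and `¾` of `𝚿`. -/
theorem matterVar_THat (V : Entire) : MatterVar (currentTHat k V)
    (-act (scal V) (covD k PsiF) - (3 / 4 : ℂ) • act (scal (Entire.der V)) PsiF)
    (act (scal V) (covD k ZF) + (1 / 4 : ℂ) • act (scal (Entire.der V)) ZF) := by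
  have e : currentTHat k V = (3 / 4 : ℂ) • bil (scal V) PsiF (covD k ZF)
      - (1 / 4 : ℂ) • bil (scal V) ZF (covD k PsiF) := currentTHat_eq k V
  refine ⟨fun c p => ?_, fun c I u => ?_, fun c I u => ?_⟩ <;>
    rw [e, varDer_sub, varDer_smul, varDer_smul, varDer_bil _ _ famPar_PsiF (famPar_DZ k),
      varDer_bil _ _ famPar_ZF (famPar_DPsi k)]
  · simp [adj_covD A_ne_B k famPar_ZF, adj_covD A_ne_B k famPar_PsiF, adj_A_ZF, adj_A_PsiF]
  · simp only [adj_covD Z_ne_B k famPar_ZF, adj_covD Z_ne_B k famPar_PsiF, adj_ZF, adj_Z_PsiF,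
      covD_act, scal_transpose, map_der_scal, Pi.add_apply, Pi.sub_apply, Pi.neg_apply,
      Pi.smul_apply, koszul_false_left, koszul_false_right]
    module
  · simp only [adj_covD Psi_ne_B k famPar_ZF, adj_covD Psi_ne_B k famPar_PsiF, adj_PsiF,
      adj_Psi_ZF, covD_act, scal_transpose, map_der_scal, Pi.add_apply, Pi.smul_apply, koszul_false_left, koszul_false_right]
    module

theorem matterVar_L (U : Matrix (Fin 4) (Fin 4) Entire) :
    MatterVar (m := m) (currentL U) (act U.transpose PsiF) (act U ZF) := by
  refine ⟨fun c p => ?_, fun c I u => ?_, fun c I u => ?_⟩ <;>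
    rw [currentL_eq, varDer_bil _ _ famPar_PsiF famPar_ZF]
  · simp [adj_A_ZF, adj_A_PsiF]
  · simp [adj_ZF, adj_Z_PsiF]
  · simp [adj_Psi_ZF, adj_PsiF]

theorem matterVar_Xi {S : Matrix (Fin 4) (Fin 4) Entire} (hS : S.transpose = S) :
    MatterVar (m := m) (currentXi S) (act S ZF) 0 := by
  refine ⟨fun c p => ?_, fun c I u => ?_, fun c I u => ?_⟩ <;>
    rw [currentXi_eq, varDer_smul, varDer_bil _ _ famPar_ZF famPar_ZF]
  · simp [adj_A_ZF]
  · rw [adj_ZF, adj_ZF, hS, koszul_false_left]; module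
  · simp [adj_Psi_ZF]

theorem dual_transpose {G : Matrix (Fin 4) (Fin 4) Entire} : (dual G).transpose = -dual G := by
  ext K L : 2
  simp only [Matrix.transpose_apply, Matrix.neg_apply, dual]
  have h : ∀ I J, levi ![I, J, L, K] • G I J = -(levi ![I, J, K, L] • G I J) := fun I J => by
    rw [levi_swap23, neg_smul]
  simp only [h, Finset.sum_neg_distrib, smul_neg]

/-- As `∂_𝐁` is skew-adjoint and the dual matrix antisymmetric, varying either `𝐙` in the second
term gives the same `*Γ ∂_𝐁 𝐙`; one of the two variations also lets `∂` fall on `*Γ`. -/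
theorem matterVar_Theta {G : Matrix (Fin 4) (Fin 4) Entire} (hG : G.transpose = -G) :
    MatterVar (currentTheta k G)
      (-act (dual G) (covD k ZF) - (1 / 2 : ℂ) • act ((dual G).map Entire.der) ZF)
      (act G PsiF) := by
  refine ⟨fun c p => ?_, fun c I u => ?_, fun c I u => ?_⟩ <;>
    rw [currentTheta_eq, varDer_sub, varDer_smul, varDer_smul,
      varDer_bil _ _ famPar_PsiF famPar_PsiF, varDer_bil _ _ famPar_ZF (famPar_DZ k)]
  · simp [adj_covD A_ne_B k famPar_ZF, adj_A_ZF, adj_A_PsiF]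
  · simp only [adj_covD Z_ne_B k famPar_ZF, adj_ZF, adj_Z_PsiF, covD_act, dual_transpose,
      act_neg_left, covD_neg, Pi.add_apply, Pi.sub_apply, Pi.neg_apply, Pi.smul_apply,
      koszul_false_left]
    module
  · simp only [adj_covD Psi_ne_B k famPar_ZF, adj_PsiF, adj_Psi_ZF, hG, act_neg_left,
      Pi.neg_apply, koszul_false_left, koszul_true_true]
    module

end BLG

/-! ### Matrix calculus and integration by parts for bilinears -/

namespace BLG

open Density

variable {m : ℕ} (k : Fin m → ℂ)

abbrev EMat : Type := Matrix (Fin 4) (Fin 4) Entire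

/-- The derivative of a matrix of coefficient functions. -/
def der (M : EMat) : EMat := M.map Entire.der

theorem der_apply (M : EMat) (i j : Fin 4) : der M i j = Entire.der (M i j) := rfl

theorem der_neg (M : EMat) : der (-M) = -der M := by ext i j; simp [der]
theorem der_sub (M N : EMat) : der (M - N) = der M - der N := by ext i j; simp [der]
theorem der_smul (V : Entire) (M : EMat) : der (V • M) = Entire.der V • M + V • der M := by
  refine Matrix.ext fun i j => ?_
  simp only [der_apply, Matrix.smul_apply, Matrix.add_apply, smul_eq_mul, Entire.der_mul]
  ring

theorem der_mul (M N : EMat) : der (M * N) = der M * N + M * der N := by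
  refine Matrix.ext fun i j => ?_
  simp only [der_apply, Matrix.mul_apply, Matrix.add_apply, map_sum, Entire.der_mul,
    ← Finset.sum_add_distrib]
  exact Finset.sum_congr rfl fun _ _ => by ring

theorem der_transpose (M : EMat) : der M.transpose = (der M).transpose := rfl

theorem der_scal (V : Entire) : der (scal V) = scal (Entire.der V) := map_der_scal V

theorem smul_scal (V W : Entire) : V • scal W = scal (V * W) := by
  simp [scal, smul_smul]

theorem scal_sub (V W : Entire) : scal (V - W) = scal V - scal W := sub_smul V W (1 : EMat)
theorem scal_neg (V : Entire) : scal (-V) = -scal V := neg_smul V (1 : EMat)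
theorem locInt_bil_covD {p : Bool} {X : Fam m} (hX : FamPar p X) (M : EMat) (Y : Fam m) :
    locInt (bil M (covD k X) Y) =
      -locInt (bil M X (covD k Y)) - locInt (bil (der M) X Y) := by
  have h := locInt_dz (bil M X Y)
  rw [dz_bil M Y k hX, map_add, map_add] at h
  rw [← sub_eq_zero, ← h, der]; abel

theorem bil_Z_Psi (M : EMat) : bil M ZF (PsiF (m := m)) = bil M.transpose PsiF ZF := by
  rw [bil_swap M famPar_ZF famPar_PsiF]; simp
theorem bil_DZ_Psi (M : EMat) : bil M (covD k ZF) PsiF = bil M.transpose PsiF (covD k ZF) := by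
  rw [bil_swap M (famPar_DZ k) famPar_PsiF]; simp
theorem bil_Z_DPsi (M : EMat) : bil M ZF (covD k PsiF) = bil M.transpose (covD k PsiF) ZF := by
  rw [bil_swap M famPar_ZF (famPar_DPsi k)]; simp
theorem bil_DZ_DPsi (M : EMat) :
    bil M (covD k ZF) (covD k PsiF) = bil M.transpose (covD k PsiF) (covD k ZF) := by
  rw [bil_swap M (famPar_DZ k) (famPar_DPsi k)]; simp
theorem bil_DZ_Z (M : EMat) : bil M (covD k ZF) ZF = bil M.transpose ZF (covD k ZF) := by
  rw [bil_swap M (famPar_DZ k) famPar_ZF]; simp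
theorem bil_Z_Z (M : EMat) : bil M ZF (ZF (m := m)) = bil M.transpose ZF ZF := by
  rw [bil_swap M famPar_ZF famPar_ZF]; simp
theorem bil_DZ_DZ (M : EMat) :
    bil M (covD k ZF) (covD k ZF) = bil M.transpose (covD k ZF) (covD k ZF) := by
  rw [bil_swap M (famPar_DZ k) (famPar_DZ k)]; simp
theorem bil_Psi_Psi (M : EMat) : bil M PsiF (PsiF (m := m)) = -bil M.transpose PsiF PsiF := by
  rw [bil_swap M famPar_PsiF famPar_PsiF]; simp
theorem bil_DPsi_Psi (M : EMat) :
    bil M (covD k PsiF) PsiF = -bil M.transpose PsiF (covD k PsiF) := by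
  rw [bil_swap M (famPar_DPsi k) famPar_PsiF]; simp

theorem eq_zero_of_eq_neg {E : Type*} [AddCommGroup E] [Module ℂ E] {x : E} (h : x = -x) :
    x = 0 := by
  have h2 : (2 : ℂ) • x = 0 := by rw [two_smul]; nth_rewrite 1 [h]; simp
  exact (smul_eq_zero.mp h2).resolve_left two_ne_zero

theorem bil_Z_Z_of_antisymm {M : EMat} (hM : M.transpose = -M) : bil M ZF (ZF (m := m)) = 0 :=
  eq_zero_of_eq_neg (by rw [← bil_neg, ← hM, ← bil_Z_Z])

theorem bil_DZ_DZ_of_antisymm {M : EMat} (hM : M.transpose = -M) :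
    bil M (covD k ZF) (covD k ZF) = 0 :=
  eq_zero_of_eq_neg (by rw [← bil_neg, ← hM, ← bil_DZ_DZ])

/-- Graded symmetry and integration by parts show that the integral equals minus itself minus the
term in which `∂` hits `M`; this is solved for the integral. `locInt_bil_DZ_Z` is the same argument
for the even fields and symmetric `M`. -/
theorem locInt_bil_DPsi_Psi {M : EMat} (hM : M.transpose = -M) :
    locInt (bil M (covD k PsiF) PsiF) = (-1 / 2 : ℂ) • locInt (bil (der M) PsiF PsiF) := by
  have h1 := locInt_bil_covD k famPar_PsiF M PsiF
  have h2 := congrArg locInt (bil_DPsi_Psi k M)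
  rw [hM, bil_neg, neg_neg] at h2
  rw [← h2] at h1
  have h3 : (2 : ℂ) • locInt (bil M (covD k PsiF) PsiF) = -locInt (bil (der M) PsiF PsiF) := by
    rw [two_smul]; nth_rewrite 1 [h1]; abel
  rw [neg_div, neg_smul, ← smul_neg, ← h3, smul_smul]; norm_num

theorem locInt_bil_DZ_Z {M : EMat} (hM : M.transpose = M) :
    locInt (bil M (covD k ZF) ZF) = (-1 / 2 : ℂ) • locInt (bil (der M) ZF ZF) := by
  have h1 := locInt_bil_covD k famPar_ZF M ZF
  have h2 := congrArg locInt (bil_DZ_Z k M)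
  rw [hM] at h2
  rw [← h2] at h1
  have h3 : (2 : ℂ) • locInt (bil M (covD k ZF) ZF) = -locInt (bil (der M) ZF ZF) := by
    rw [two_smul]; nth_rewrite 1 [h1]; abel
  rw [neg_div, neg_smul, ← smul_neg, ← h3, smul_smul]; norm_num

/-! ### The dual of an antisymmetric matrix -/

theorem dual_add (G H : EMat) : dual (G + H) = dual G + dual H := by
  refine Matrix.ext fun K L => ?_
  simp only [dual, Matrix.add_apply, smul_add, Finset.sum_add_distrib]

theorem dual_csmul (r : ℂ) (G : EMat) : dual (r • G) = r • dual G := by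
  refine Matrix.ext fun K L => ?_
  simp only [dual, Matrix.smul_apply, Finset.smul_sum]
  exact Finset.sum_congr rfl fun I _ => Finset.sum_congr rfl fun J _ => by module

theorem dual_smul (V : Entire) (G : EMat) : dual (V • G) = V • dual G := by
  refine Matrix.ext fun K L => ?_
  simp only [dual, Matrix.smul_apply, smul_eq_mul, Finset.mul_sum, mul_smul_comm]

theorem dual_sub (G H : EMat) : dual (G - H) = dual G - dual H := by
  have h : dual (-H) = -dual H := Matrix.ext fun K L => by
    simp only [dual, Matrix.neg_apply, smul_neg, Finset.sum_neg_distrib]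
  rw [sub_eq_add_neg, dual_add, h, sub_eq_add_neg]

theorem dual_der (G : EMat) : dual (der G) = der (dual G) := by
  refine Matrix.ext fun K L => ?_
  simp only [dual, der_apply, map_smul, map_sum]

/-- With `K`, `L` fixed the symbol is supported on `(I, J)` and `(J, I)` with opposite signs;
antisymmetry makes the two terms equal, which cancels the factor `½`. -/
theorem dual_apply {G : EMat} (hG : G.transpose = -G) {I J K L : Fin 4}
    (h : leviInt ![I, J, K, L] = 1) : dual G K L = G I J := by
  have key : ∀ I J K L : Fin 4, leviInt ![I, J, K, L] = 1 → ∀ a b, leviInt ![a, b, K, L] =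
      (if a = I ∧ b = J then 1 else 0) - (if a = J ∧ b = I then 1 else 0) := by decide +kernel
  have hne : ∀ I J K L : Fin 4, leviInt ![I, J, K, L] = 1 → I ≠ J := by decide +kernel
  have hIJ := hne I J K L h
  have e : G J I = -G I J := congrFun (congrFun hG I) J
  have hs : ∀ a b, levi ![a, b, K, L] • G a b =
      (if a = I then (if b = J then G a b else 0) else 0) -
        (if a = J then (if b = I then G a b else 0) else 0) := by
    intro a b
    rw [levi_eq, key I J K L h a b]
    by_cases h1 : a = I <;> by_cases h2 : b = J <;> by_cases h3 : a = J <;> by_cases h4 : b = I <;>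
      simp_all
  simp only [dual, hs, Finset.sum_sub_distrib]
  simp only [Finset.sum_ite_eq', Finset.mem_univ, if_true, Finset.sum_ite_irrel,
    Finset.sum_const_zero]
  rw [e]
  module

theorem dual_eq {G : EMat} (hG : G.transpose = -G) :
    dual G = !![0, G 2 3, -G 1 3, G 1 2; -G 2 3, 0, G 0 3, -G 0 2;
      G 1 3, -G 0 3, 0, G 0 1; -G 1 2, G 0 2, -G 0 1, 0] := by
  have h0 : ∀ i, dual G i i = 0 := fun i => by
    have h : dual G i i = -dual G i i := congrFun (congrFun (dual_transpose (G := G)) i) i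
    exact eq_zero_of_eq_neg h
  have ha : ∀ i j, dual G j i = -dual G i j := fun i j =>
    congrFun (congrFun (dual_transpose (G := G)) i) j
  have e : ∀ i j, G j i = -G i j := fun i j => congrFun (congrFun hG i) j
  have h01 : dual G 0 1 = G 2 3 := dual_apply hG (by decide)
  have h02 : dual G 0 2 = -G 1 3 := by rw [← e]; exact dual_apply hG (by decide)
  have h03 : dual G 0 3 = G 1 2 := dual_apply hG (by decide)
  have h12 : dual G 1 2 = G 0 3 := dual_apply hG (by decide)
  have h13 : dual G 1 3 = -G 0 2 := by rw [← e]; exact dual_apply hG (by decide)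
  have h23 : dual G 2 3 = G 0 1 := dual_apply hG (by decide)
  refine Matrix.ext fun i j => ?_
  fin_cases i <;> fin_cases j <;>
    simp [h0, ha 0 1, ha 0 2, ha 0 3, ha 1 2, ha 1 3, ha 2 3, h01, h02, h03, h12, h13, h23]

theorem eq_of_antisymm {G : EMat} (hG : G.transpose = -G) :
    G = !![0, G 0 1, G 0 2, G 0 3; -G 0 1, 0, G 1 2, G 1 3;
      -G 0 2, -G 1 2, 0, G 2 3; -G 0 3, -G 1 3, -G 2 3, 0] := by
  have e : ∀ i j, G j i = -G i j := fun i j => congrFun (congrFun hG i) j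
  have h0 : ∀ i, G i i = 0 := fun i => eq_zero_of_eq_neg (e i i)
  refine Matrix.ext fun i j => ?_
  fin_cases i <;> fin_cases j <;> simp [h0, e 0 1, e 0 2, e 0 3, e 1 2, e 1 3, e 2 3]

/-- The polarised Pfaffian. -/
def pf (G H : EMat) : Entire :=
  G 0 1 * H 2 3 + G 2 3 * H 0 1 - G 0 2 * H 1 3 - G 1 3 * H 0 2 + G 0 3 * H 1 2 + G 1 2 * H 0 3

section CommRing

variable {R : Type*} [CommRing R]

/-- The antisymmetric matrix with given entries above the diagonal. -/
def altMatrix (a b c d e f : R) : Matrix (Fin 4) (Fin 4) R :=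
  !![0, a, b, c; -a, 0, d, e; -b, -d, 0, f; -c, -e, -f, 0]

/-- Polarisation of `Γ *Γ = -Pf(Γ)`: the antisymmetric 4×4 matrices satisfy the Clifford relation of
a six-dimensional quadratic space. -/
theorem altMatrix_mul_add (a b c d e f a' b' c' d' e' f' : R) :
    altMatrix a b c d e f * altMatrix f' (-e') d' c' (-b') a' +
      altMatrix a' b' c' d' e' f' * altMatrix f (-e) d c (-b) a =
    -((a * f' + f * a' - b * e' - e * b' + c * d' + d * c') • 1) := by
  refine Matrix.ext fun i j => ?_
  fin_cases i <;> fin_cases j <;>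
    simp [altMatrix] <;> ring

set_option maxHeartbeats 1000000 in
-- Infinitesimal invariance of the Levi-Civita symbol under `𝔰𝔩(4)`. Tracelessness is indispensable
-- and enters by eliminating `U 3 3`.
theorem altMatrix_sl (U : Matrix (Fin 4) (Fin 4) R) (a b c d e f : R)
    (ht : U 3 3 = -U 0 0 - U 1 1 - U 2 2) :
    altMatrix ((U * altMatrix a b c d e f + altMatrix a b c d e f * U.transpose) 2 3)
      (-(U * altMatrix a b c d e f + altMatrix a b c d e f * U.transpose) 1 3)
      ((U * altMatrix a b c d e f + altMatrix a b c d e f * U.transpose) 1 2)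
      ((U * altMatrix a b c d e f + altMatrix a b c d e f * U.transpose) 0 3)
      (-(U * altMatrix a b c d e f + altMatrix a b c d e f * U.transpose) 0 2)
      ((U * altMatrix a b c d e f + altMatrix a b c d e f * U.transpose) 0 1) =
    -(U.transpose * altMatrix f (-e) d c (-b) a + altMatrix f (-e) d c (-b) a * U) := by
  refine Matrix.ext fun i j => ?_
  fin_cases i <;> fin_cases j <;>
    simp only [Matrix.neg_apply, Matrix.add_apply, Matrix.mul_apply, Fin.sum_univ_four,
      Matrix.transpose_apply, Fin.zero_eta, Fin.mk_one, Fin.reduceFinMk] <;>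
    simp only [altMatrix, Matrix.of_apply, Matrix.cons_val, ht] <;> ring

end CommRing

theorem eq_altMatrix {G : EMat} (hG : G.transpose = -G) :
    G = altMatrix (G 0 1) (G 0 2) (G 0 3) (G 1 2) (G 1 3) (G 2 3) := eq_of_antisymm hG

theorem dual_eq_altMatrix {G : EMat} (hG : G.transpose = -G) :
    dual G = altMatrix (G 2 3) (-G 1 3) (G 1 2) (G 0 3) (-G 0 2) (G 0 1) := by
  rw [dual_eq hG, altMatrix, neg_neg, neg_neg]

theorem mul_dual_add {G H : EMat} (hG : G.transpose = -G) (hH : H.transpose = -H) :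
    G * dual H + H * dual G = -scal (pf G H) := by
  have h := altMatrix_mul_add (G 0 1) (G 0 2) (G 0 3) (G 1 2) (G 1 3) (G 2 3)
    (H 0 1) (H 0 2) (H 0 3) (H 1 2) (H 1 3) (H 2 3)
  rwa [← eq_altMatrix hG, ← eq_altMatrix hH, ← dual_eq_altMatrix hG, ← dual_eq_altMatrix hH] at h

theorem dual_sl {U G : EMat} (hU : U.trace = 0) (hG : G.transpose = -G) :
    dual (U * G + G * U.transpose) = -(U.transpose * dual G + dual G * U) := by
  have hA : (U * G + G * U.transpose).transpose = -(U * G + G * U.transpose) := by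
    rw [Matrix.transpose_add, Matrix.transpose_mul, Matrix.transpose_mul, hG,
      Matrix.transpose_transpose, Matrix.neg_mul, Matrix.mul_neg, neg_add, add_comm]
  have ht : U 3 3 = -U 0 0 - U 1 1 - U 2 2 := by
    have : U 0 0 + U 1 1 + U 2 2 + U 3 3 = 0 := by
      rw [← hU, Matrix.trace, Fin.sum_univ_four]; rfl
    linear_combination this
  have h := altMatrix_sl U (G 0 1) (G 0 2) (G 0 3) (G 1 2) (G 1 3) (G 2 3) ht
  rwa [← eq_altMatrix hG, ← dual_eq_altMatrix hG, ← dual_eq_altMatrix hA] at h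

end BLG

/-! ### Brackets of the covariant currents -/

namespace BLG

open Density

variable {m : ℕ} (k : Fin m → ℂ)

theorem bil_invol_left {p : Bool} {X : Fam m} (hX : FamPar p X) (M : EMat) (Y : Fam m) :
    bil M (fun c I u => invol (X c I u)) Y = koszul p true • bil M X Y := by
  rw [← bil_smul_left]
  refine congrArg (fun X' => bil M X' Y) (funext fun c => funext fun I => funext fun u => ?_)
  rw [(hX c I u).invol]; simp

theorem bil_zero_left (M : EMat) (Y : Fam m) : bil M 0 Y = 0 := by
  simpa using bil_smul_left M (0 : Fam m) Y 0

theorem bil_zero_right (M : EMat) (Y : Fam m) : bil M Y 0 = 0 := by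
  simpa using bil_smul_right M Y (0 : Fam m) 0

theorem MatterVar.lieBV_of_par {F G : Density m} {FZ FPsi GZ GPsi : Fam m} {p : Bool}
    (hF : MatterVar F FZ FPsi) (hG : MatterVar G GZ GPsi) (hp : FamPar p FPsi) :
    Density.lieBV F G = bil 1 FZ GPsi - koszul p true • bil 1 FPsi GZ := by
  rw [hF.lieBV hG, bil_invol_left hp]

theorem FamPar.smul {p : Bool} {X : Fam m} (hX : FamPar p X) (r : ℂ) : FamPar p (r • X) :=
  fun c I u => (hX c I u).smul r

theorem smul_one_eq_scal (V : Entire) : V • (1 : EMat) = scal V := rfl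

/-- The terms in `V W` and in `V' W'` cancel, and those in `V W'` and `V' W` regroup into the stress
tensor; no integration by parts is needed, so the identity holds for densities. -/
theorem lieBV_THat_THat (V W : Entire) :
    lieBV (currentTHat k V) (currentTHat k W) =
      currentTHat k (V * Entire.der W - Entire.der V * W) := by
  rw [(matterVar_THat k V).lieBV_of_par (matterVar_THat k W)
    (((famPar_DZ k).act _).add ((famPar_ZF.act _).smul _)), currentTHat_eq]
  simp only [bil_add_left, bil_add_right, bil_sub_left, bil_sub_right, bil_neg_left, bil_neg_right,
    bil_smul_left, bil_smul_right, bil_act_left, bil_act_right, mul_scal, scal_transpose, Matrix.one_mul,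
    smul_one_eq_scal, smul_scal, bil_DZ_DPsi, bil_DZ_Psi, bil_Z_DPsi, bil_Z_Psi, scal_sub, bil_sub,
    Matrix.transpose_sub]
  rw [koszul_false_left, mul_comm W V,
    mul_comm (Entire.der W) V, mul_comm W (Entire.der V), mul_comm (Entire.der W) (Entire.der V)]
  module

theorem locInt_lieBV_THat_L (V : Entire) (U : EMat) :
    locInt (lieBV (currentTHat k V) (currentL U)) = locInt (currentL (V • der U)) := by
  rw [(matterVar_THat k V).lieBV_of_par (matterVar_L U)
    (((famPar_DZ k).act _).add ((famPar_ZF.act _).smul _)), currentL_eq]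
  simp only [bil_add_left, bil_sub_left, bil_neg_left, bil_smul_left, bil_act_left, bil_act_right,
    scal_mul, scal_transpose, Matrix.one_mul,  bil_DZ_Psi, bil_Z_Psi, Matrix.transpose_smul,
    Matrix.transpose_transpose, map_sub, map_add, map_neg, map_smul, locInt_bil_covD k famPar_PsiF,
    der_smul, bil_add, koszul_false_left]
  module

theorem locInt_lieBV_THat_Theta (V : Entire) {G : EMat} (hG : G.transpose = -G) :
    locInt (lieBV (currentTHat k V) (currentTheta k G)) =
      locInt (currentTheta k (V • der G - (1 / 2 : ℂ) • Entire.der V • G)) := by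
  rw [(matterVar_THat k V).lieBV_of_par (matterVar_Theta k hG)
    (((famPar_DZ k).act _).add ((famPar_ZF.act _).smul _)), currentTheta_eq]
  -- These antisymmetries remove the terms quadratic in `∂_𝐁 𝐙` and in `𝐙`, whose two factors are
  -- equal and even.
  have h1 : (V • dual G).transpose = -(V • dual G) := by
    rw [Matrix.transpose_smul, dual_transpose, smul_neg]
  have h2 : (Entire.der V • der (dual G)).transpose = -(Entire.der V • der (dual G)) := by
    rw [Matrix.transpose_smul, ← der_transpose, dual_transpose, der_neg, smul_neg]
  have h3 : (V • der (dual G)).transpose = -(V • der (dual G)) := by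
    rw [Matrix.transpose_smul, ← der_transpose, dual_transpose, der_neg, smul_neg]
  have h4 : (V • G).transpose = -(V • G) := by rw [Matrix.transpose_smul, hG, smul_neg]
  rw [← der]
  simp only [bil_add_left, bil_sub_left, bil_neg_left, bil_smul_left, bil_sub_right,
    bil_neg_right, bil_smul_right, bil_act_left, bil_act_right,
    scal_mul, scal_transpose, Matrix.one_mul,  bil_DZ_Z, h3, bil_DZ_DZ_of_antisymm k h1,
    bil_Z_Z_of_antisymm h2,
    map_sub, map_add, map_neg, map_smul, locInt_bil_DPsi_Psi k h4, bil_neg,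
    der_smul, bil_add, bil_sub, bil_smul, koszul_false_left, dual_sub, dual_csmul, dual_smul,
    dual_der, map_zero]
  module

theorem locInt_lieBV_THat_Xi (V : Entire) {S : EMat} (hS : S.transpose = S) :
    locInt (lieBV (currentTHat k V) (currentXi S)) =
      locInt (currentXi (V • der S + (1 / 2 : ℂ) • Entire.der V • S)) := by
  rw [(matterVar_THat k V).lieBV_of_par (matterVar_Xi hS)
    (((famPar_DZ k).act _).add ((famPar_ZF.act _).smul _)), currentXi_eq]
  have h4 : (V • S).transpose = V • S := by rw [Matrix.transpose_smul, hS]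
  simp only [bil_add_left, bil_smul_left, bil_zero_right, bil_act_left, bil_act_right,
    scal_mul, scal_transpose, Matrix.one_mul,
    map_sub, map_add, map_smul, locInt_bil_DZ_Z k h4,
    der_smul, bil_add, bil_smul, koszul_false_left, map_zero]
  module

theorem lieBV_L_L (U W : EMat) :
    lieBV (currentL (m := m) U) (currentL W) = currentL (U * W - W * U) := by
  rw [(matterVar_L U).lieBV_of_par (matterVar_L W) (famPar_ZF.act _), currentL_eq]
  simp only [bil_act_left, bil_act_right, Matrix.one_mul, Matrix.transpose_transpose, bil_Z_Psi,
    Matrix.transpose_mul, bil_sub, koszul_false_left, one_smul]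

/-- The leading terms rotate `Γ` by `dual_sl`. Since `𝚯` contains a derivative of `𝐙`, a
non-constant `U` leaves an inhomogeneous term: the symmetric matrix `Uᵀ *Γ - *Γ U` stands between
`𝐙` and `∂_𝐁 𝐙`, and integrating by parts turns it into a `𝚵`. -/
theorem locInt_lieBV_L_Theta {U G : EMat} (hU : U.trace = 0) (hG : G.transpose = -G) :
    locInt (lieBV (currentL U) (currentTheta k G)) =
      locInt (currentTheta k (U * G + G * U.transpose)) +
      locInt (currentXi
        ((-1 / 2 : ℂ) • ((der U).transpose * dual G - dual G * der U))) := by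
  rw [(matterVar_L U).lieBV_of_par (matterVar_Theta k hG) (famPar_ZF.act _), currentTheta_eq,
    currentXi_eq, dual_sl hU hG, ← der]
  have h1 : bil (G * U.transpose) PsiF (PsiF (m := m)) = bil (U * G) PsiF PsiF := by
    rw [bil_Psi_Psi, Matrix.transpose_mul, hG, Matrix.transpose_transpose, Matrix.mul_neg, bil_neg,
      neg_neg]
  have hd : (der (dual G)).transpose = -der (dual G) := by
    rw [← der_transpose, dual_transpose, der_neg]
  have h2 : (U.transpose * dual G - dual G * U).transpose =
      U.transpose * dual G - dual G * U := by
    rw [Matrix.transpose_sub, Matrix.transpose_mul, Matrix.transpose_mul, dual_transpose,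
      Matrix.transpose_transpose, Matrix.neg_mul, Matrix.mul_neg]
    abel
  -- The integration by parts that produces the `𝚵`-term.
  have h3 := locInt_bil_DZ_Z (m := m) k h2
  have h5 : bil (der (dual G) * U) ZF (ZF (m := m)) = -bil (U.transpose * der (dual G)) ZF ZF := by
    rw [bil_Z_Z, Matrix.transpose_mul, hd, Matrix.mul_neg, bil_neg]
  rw [bil_DZ_Z, h2, der_sub, der_mul, der_mul, der_transpose] at h3
  simp only [bil_sub, bil_add, map_sub, map_add, h5, map_neg] at h3
  simp only [bil_sub_right,
    bil_neg_right, bil_smul_right, bil_act_left, bil_act_right, Matrix.one_mul, bil_sub, bil_add, bil_neg,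
    bil_smul, h1, map_sub, map_add, map_neg, map_smul, koszul_false_left,
    Matrix.transpose_transpose]
  linear_combination (norm := module) (1 / 2 : ℂ) • h3

theorem lieBV_L_Xi (U : EMat) {S : EMat} (hS : S.transpose = S) :
    lieBV (currentL (m := m) U) (currentXi S) = currentXi (-(U.transpose * S + S * U)) := by
  rw [(matterVar_L U).lieBV_of_par (matterVar_Xi hS) (famPar_ZF.act _), currentXi_eq]
  have h1 : bil (S * U) ZF (ZF (m := m)) = bil (U.transpose * S) ZF ZF := by
    rw [bil_Z_Z, Matrix.transpose_mul, hS]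
  simp only [bil_act_left, bil_act_right, bil_zero_right, Matrix.one_mul, bil_neg, bil_add, h1,
    koszul_false_left]
  module

/-- The terms of the form `𝚿 ∂_𝐁 𝐙` carry the matrix `Γ *Γ' + Γ' *Γ`, which is scalar by
`mul_dual_add` and hence gives a stress tensor. Terms where `∂` hits the dual matrices form an `𝐋`;
the multiple of `∂pf` comes from integrating the `𝐙 ∂_𝐁 𝚿` half of the stress tensor by parts. -/
theorem locInt_lieBV_Theta_Theta {G H : EMat} (hG : G.transpose = -G) (hH : H.transpose = -H) :
    locInt (lieBV (currentTheta k G) (currentTheta k H)) =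
      locInt (currentTHat k (-pf G H)) +
      locInt (currentL ((1 / 2 : ℂ) • (G * der (dual H) + H * der (dual G)) +
        (1 / 4 : ℂ) • scal (Entire.der (pf G H)))) := by
  rw [(matterVar_Theta k hG).lieBV_of_par (matterVar_Theta k hH) (famPar_PsiF.act _), currentL_eq,
    currentTHat_eq, ← scal, scal_neg, ← der, ← der]
  have hd : ∀ G : EMat, (der (dual G)).transpose = -der (dual G) := fun G => by
    rw [← der_transpose, dual_transpose, der_neg]
  have h1 := congrArg (fun M => locInt (bil M PsiF (covD k ZF))) (mul_dual_add hG hH)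
  simp only [bil_add, bil_neg, map_add, map_neg] at h1
  simp only [bil_sub_right, bil_sub_left, bil_neg_left, bil_smul_left,
    bil_neg_right, bil_smul_right, bil_act_left, bil_act_right, Matrix.one_mul, bil_add,
    bil_smul, map_sub, map_add, map_neg, map_smul, koszul_true_true,
    bil_DZ_Psi, bil_Z_Psi, Matrix.transpose_mul, hG, hH, hd,
    dual_transpose, Matrix.neg_mul, Matrix.mul_neg, bil_neg, neg_neg, bil_Z_DPsi, scal_transpose,
    locInt_bil_covD k famPar_PsiF, der_scal, Matrix.transpose_neg]
  linear_combination (norm := module) h1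

theorem lieBV_Theta_Xi {G S : EMat} (hG : G.transpose = -G) (hS : S.transpose = S) :
    lieBV (currentTheta k G) (currentXi S) = currentL (-(G * S)) := by
  rw [(matterVar_Theta k hG).lieBV_of_par (matterVar_Xi hS) (famPar_PsiF.act _), currentL_eq]
  simp only [bil_act_left, bil_act_right, bil_zero_right, Matrix.one_mul, bil_neg, koszul_true_true, hG,
    Matrix.neg_mul]
  module

theorem lieBV_Xi_Xi {S T : EMat} (hS : S.transpose = S) (hT : T.transpose = T) :
    lieBV (currentXi (m := m) S) (currentXi T) = 0 := by
  have h : FamPar false (0 : Fam m) := fun c I u => by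
    simpa using (isPar_Z c I u).smul 0
  rw [(matterVar_Xi hS).lieBV_of_par (matterVar_Xi hT) h]
  simp [bil_zero_left, bil_zero_right]

end BLG

/-! ### The bracket on the parameters of the currents -/

namespace BLG

open Density

variable {m : ℕ} (k : Fin m → ℂ)

theorem isPar_currentTHat (V : Entire) : IsPar true (currentTHat k V) := by
  rw [currentTHat_eq]
  exact ((famPar_PsiF.bil (famPar_DZ k) _).smul _).sub ((famPar_ZF.bil (famPar_DPsi k) _).smul _)

theorem isPar_currentL (U : EMat) : IsPar true (currentL (m := m) U) := by
  rw [currentL_eq]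
  exact famPar_PsiF.bil famPar_ZF _

theorem isPar_currentTheta (G : EMat) : IsPar false (currentTheta k G) := by
  rw [currentTheta_eq]
  exact ((famPar_PsiF.bil famPar_PsiF _).smul _).sub ((famPar_ZF.bil (famPar_DZ k) _).smul _)

theorem isPar_currentXi (S : EMat) : IsPar false (currentXi (m := m) S) := by
  rw [currentXi_eq]
  exact (famPar_ZF.bil famPar_ZF _).smul _

/-- `V ↦ 𝐓̂_V` as a linear map. -/
def tHatLin : Entire →ₗ[ℂ] Density m where
  toFun := currentTHat k
  map_add' V W := by
    simp only [currentTHat, coef_add, add_mul]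
  map_smul' r V := by
    simp only [currentTHat, coef_smul, smul_mul_assoc, RingHom.id_apply]

/-- `V ↦ 𝐓_V` as a linear map. -/
def tLin (m : ℕ) : Entire →ₗ[ℂ] Density m where
  toFun := currentT
  map_add' V W := by
    simp only [currentT, coef_add, add_mul]
  map_smul' r V := by
    simp only [currentT, coef_smul, smul_mul_assoc, RingHom.id_apply]

/-- `U ↦ 𝐋_U` as a linear map. -/
def lLin (m : ℕ) : EMat →ₗ[ℂ] Density m where
  toFun := currentL
  map_add' V W := by simp only [currentL_eq, bil_add]
  map_smul' r V := by simp only [currentL_eq, bil_smul, RingHom.id_apply]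

/-- `Γ ↦ 𝚯_Γ` as a linear map. -/
def thetaLin : EMat →ₗ[ℂ] Density m where
  toFun := currentTheta k
  map_add' V W := by
    simp only [currentTheta_eq, bil_add, dual_add]
    module
  map_smul' r V := by
    simp only [currentTheta_eq, bil_smul, dual_csmul, RingHom.id_apply]
    module

/-- `Σ ↦ 𝚵_Σ` as a linear map. -/
def xiLin (m : ℕ) : EMat →ₗ[ℂ] Density m where
  toFun := currentXi
  map_add' V W := by simp only [currentXi_eq, bil_add, smul_add]
  map_smul' r V := by simp only [currentXi_eq, bil_smul, RingHom.id_apply, smul_comm r]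

/-- Needed for the tracelessness of the `𝔰𝔩(4)`-component of `paramBracket`. -/
theorem pf_eq_trace {G H : EMat} (hG : G.transpose = -G) (hH : H.transpose = -H) :
    (G * dual H).trace = (-2 : ℂ) • pf G H := by
  have e : ∀ i j, G j i = -G i j := fun i j => congrFun (congrFun hG i) j
  rw [dual_eq hH, Matrix.trace, Fin.sum_univ_four]
  simp only [Matrix.diag, Matrix.mul_apply, Fin.sum_univ_four, Matrix.of_apply, Matrix.cons_val, pf,
    e 0 1, e 0 2, e 0 3, e 1 2, e 1 3, e 2 3, neg_smul, ofNat_smul_eq_nsmul]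
  ring

theorem der_pf (G H : EMat) : Entire.der (pf G H) = pf (der G) H + pf G (der H) := by
  simp only [pf, map_add, map_sub, Entire.der_mul, der_apply]
  ring

theorem pf_comm (G H : EMat) : pf G H = pf H G := by
  simp only [pf]; ring

theorem trace_mul_symm {G S : EMat} (hG : G.transpose = -G) (hS : S.transpose = S) :
    (G * S).trace = 0 := by
  refine eq_zero_of_eq_neg ?_
  nth_rewrite 1 [← Matrix.trace_transpose]
  rw [Matrix.transpose_mul, hG, hS, Matrix.mul_neg, Matrix.trace_neg, Matrix.trace_mul_comm]

theorem trace_der (M : EMat) : (der M).trace = Entire.der M.trace := by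
  simp only [Matrix.trace, Matrix.diag, der_apply, map_sum]

/-- The Lie superbracket of the parameters of the currents. -/
def paramBracket (x y : CurrentParam) : CurrentParam :=
  ((x.1.1 * Entire.der y.1.1 - Entire.der x.1.1 * y.1.1 - pf x.2.1.1 y.2.1.1,
    ⟨x.1.1 • der y.1.2.1 - y.1.1 • der x.1.2.1 + (x.1.2.1 * y.1.2.1 - y.1.2.1 * x.1.2.1)
      + ((1 / 2 : ℂ) • (x.2.1.1 * der (dual y.2.1.1) + y.2.1.1 * der (dual x.2.1.1))
        + (1 / 4 : ℂ) • scal (Entire.der (pf x.2.1.1 y.2.1.1)))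
      - x.2.1.1 * y.2.2.1 - y.2.1.1 * x.2.2.1, by
      obtain ⟨⟨V, U, hU⟩, ⟨G, hG⟩, S, hS⟩ := x
      obtain ⟨⟨W, X, hX⟩, ⟨H, hH⟩, T, hT⟩ := y
      have hdG : (der G).transpose = -der G := by
        rw [← der_transpose, (hG : _ = -G), der_neg]
      have hdH : (der H).transpose = -der H := by
        rw [← der_transpose, (hH : _ = -H), der_neg]
      have hU : U.trace = 0 := hU
      have hX : X.trace = 0 := hX
      show Matrix.trace _ = 0
      -- The two products with derivatives of dual matrices have total trace `-∂pf`, which the four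
      -- diagonal entries `¼ ∂pf` compensate.
      simp only [Matrix.trace_sub, Matrix.trace_add, Matrix.trace_smul, trace_der, hU, hX, map_zero,
        mul_zero, Matrix.trace_mul_comm X U, ← dual_der, pf_eq_trace hG hdH, pf_eq_trace hH hdG,
        trace_mul_symm hG hT, trace_mul_symm hH hS, der_pf, pf_comm H, scal, Matrix.trace_one,
        Fintype.card_fin, smul_eq_mul, ← nsmul_eq_mul, mul_comm _ ((4 : ℕ) : Entire)]
      module⟩),
   (⟨x.1.1 • der y.2.1.1 - (1 / 2 : ℂ) • Entire.der x.1.1 • y.2.1.1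
      - (y.1.1 • der x.2.1.1 - (1 / 2 : ℂ) • Entire.der y.1.1 • x.2.1.1)
      + (x.1.2.1 * y.2.1.1 + y.2.1.1 * x.1.2.1.transpose)
      - (y.1.2.1 * x.2.1.1 + x.2.1.1 * y.1.2.1.transpose), by
      obtain ⟨⟨V, U, hU⟩, ⟨G, hG⟩, S, hS⟩ := x
      obtain ⟨⟨W, X, hX⟩, ⟨H, hH⟩, T, hT⟩ := y
      have hG : G.transpose = -G := hG
      have hH : H.transpose = -H := hH
      show Matrix.transpose _ = -_
      simp only [Matrix.transpose_sub, Matrix.transpose_add, Matrix.transpose_smul,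
        Matrix.transpose_mul, ← der_transpose, hG, hH, der_neg, Matrix.transpose_transpose,
        smul_neg, Matrix.neg_mul, Matrix.mul_neg]
      abel⟩,
    ⟨x.1.1 • der y.2.2.1 + (1 / 2 : ℂ) • Entire.der x.1.1 • y.2.2.1
      - (y.1.1 • der x.2.2.1 + (1 / 2 : ℂ) • Entire.der y.1.1 • x.2.2.1)
      + (-1 / 2 : ℂ) •
        ((der x.1.2.1).transpose * dual y.2.1.1 - dual y.2.1.1 * der x.1.2.1)
      - (-1 / 2 : ℂ) •
        ((der y.1.2.1).transpose * dual x.2.1.1 - dual x.2.1.1 * der y.1.2.1)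
      - (x.1.2.1.transpose * y.2.2.1 + y.2.2.1 * x.1.2.1)
      + (y.1.2.1.transpose * x.2.2.1 + x.2.2.1 * y.1.2.1), by
      obtain ⟨⟨V, U, hU⟩, ⟨G, hG⟩, S, hS⟩ := x
      obtain ⟨⟨W, X, hX⟩, ⟨H, hH⟩, T, hT⟩ := y
      have hS : S.transpose = S := hS
      have hT : T.transpose = T := hT
      show Matrix.transpose _ = _
      simp only [Matrix.transpose_sub, Matrix.transpose_add, Matrix.transpose_smul,
        Matrix.transpose_mul, ← der_transpose, hS, hT, Matrix.transpose_transpose,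
        dual_transpose, Matrix.neg_mul, Matrix.mul_neg]
      module⟩))

/-- The BV brackets of the currents `T_V + 𝐋_U + 𝚯_Γ + 𝚵_Σ`, for a given stress tensor `T`, in a
quotient of the space of local functionals. -/
theorem lieBV_current_of {Q : Type*} [AddCommGroup Q] [Module ℂ Q] (ℓ : Density m →ₗ[ℂ] Q)
    (hℓ : ∀ F G, locInt F = locInt G → ℓ F = ℓ G) (T : Entire →ₗ[ℂ] Density m)
    (hT : ∀ V, IsPar true (T V)) (hT' : ∀ V, ℓ (T V) = ℓ (currentTHat k V))
    (hTT : ∀ V W, ℓ (lieBV (T V) (T W)) = ℓ (T (V * Entire.der W - Entire.der V * W)))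
    (hTL : ∀ V U, ℓ (lieBV (T V) (currentL U)) = ℓ (currentL (V • der U)))
    (hTG : ∀ V (G : EMat), G.transpose = -G → ℓ (lieBV (T V) (currentTheta k G)) =
      ℓ (currentTheta k (V • der G - (1 / 2 : ℂ) • Entire.der V • G)))
    (hTS : ∀ V (S : EMat), S.transpose = S → ℓ (lieBV (T V) (currentXi S)) =
      ℓ (currentXi (V • der S + (1 / 2 : ℂ) • Entire.der V • S))) (x y : CurrentParam) :
    ℓ (lieBV (T x.1.1 + currentL x.1.2.1 + currentTheta k x.2.1.1 + currentXi x.2.2.1)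
      (T y.1.1 + currentL y.1.2.1 + currentTheta k y.2.1.1 + currentXi y.2.2.1)) =
    ℓ (T (paramBracket x y).1.1 + currentL (paramBracket x y).1.2.1
      + currentTheta k (paramBracket x y).2.1.1 + currentXi (paramBracket x y).2.2.1) := by
  obtain ⟨⟨V, U, hU⟩, ⟨G, hG⟩, S, hS⟩ := x
  obtain ⟨⟨W, X, hX⟩, ⟨H, hH⟩, R, hR⟩ := y
  have hL : ∀ U, currentL U = lLin m U := fun _ => rfl
  have hX' : ∀ S, currentXi S = xiLin m S := fun _ => rfl
  have hΘ : ∀ S, currentTheta k S = thetaLin k S := fun _ => rfl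
  have hLT : ∀ V U, ℓ (lieBV (currentL U) (T V)) = -ℓ (currentL (V • der U)) := fun V U => by
    rw [← hTL, lieBV_antisymm (isPar_currentL U) (hT V)]; simp
  have hGT : ∀ V (G : EMat), G.transpose = -G → ℓ (lieBV (currentTheta k G) (T V)) =
      -ℓ (currentTheta k (V • der G - (1 / 2 : ℂ) • Entire.der V • G)) := fun V G hG => by
    rw [← hTG V G hG, lieBV_antisymm (isPar_currentTheta k G) (hT V)]; simp
  have hST : ∀ V (S : EMat), S.transpose = S → ℓ (lieBV (currentXi S) (T V)) =
      -ℓ (currentXi (V • der S + (1 / 2 : ℂ) • Entire.der V • S)) := fun V S hS => by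
    rw [← hTS V S hS, lieBV_antisymm (isPar_currentXi S) (hT V)]; simp
  have hLG : ∀ {U G : EMat}, U.trace = 0 → G.transpose = -G →
      ℓ (lieBV (currentL U) (currentTheta k G)) =
      ℓ (currentTheta k (U * G + G * U.transpose)) +
      ℓ (currentXi ((-1 / 2 : ℂ) • ((der U).transpose * dual G - dual G * der U))) :=
    fun hU hG => by
      rw [← map_add]
      exact hℓ _ _ (by rw [locInt_lieBV_L_Theta k hU hG, map_add])
  have hGL : ∀ {U G : EMat}, U.trace = 0 → G.transpose = -G →
      ℓ (lieBV (currentTheta k G) (currentL U)) =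
      -(ℓ (currentTheta k (U * G + G * U.transpose)) +
      ℓ (currentXi ((-1 / 2 : ℂ) • ((der U).transpose * dual G - dual G * der U)))) :=
    fun {U G} hU hG => by
      rw [← hLG hU hG, lieBV_antisymm (isPar_currentTheta k G) (isPar_currentL U)]; simp
  have hSL : ∀ (U : EMat) {S : EMat}, S.transpose = S →
      ℓ (lieBV (currentXi S) (currentL U)) = -ℓ (currentXi (-(U.transpose * S + S * U))) :=
    fun U S hS => by
      rw [← lieBV_L_Xi U hS, lieBV_antisymm (isPar_currentXi S) (isPar_currentL U)]; simp
  -- The only bracket that does not know which stress tensor is in use: it always yields `𝐓̂`, and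
  -- `hT'` exchanges it for `T` in the quotient.
  have hGG : ℓ (lieBV (currentTheta k G) (currentTheta k H)) = ℓ (T (-pf G H)) +
      ℓ (currentL ((1 / 2 : ℂ) • (G * der (dual H) + H * der (dual G)) +
        (1 / 4 : ℂ) • scal (Entire.der (pf G H)))) := by
    rw [hT', ← map_add]
    exact hℓ _ _ (by rw [locInt_lieBV_Theta_Theta k hG hH, map_add])
  have hSG : ∀ {G S : EMat}, G.transpose = -G → S.transpose = S →
      lieBV (currentXi S) (currentTheta k G) = currentL (-(G * S)) := fun {G S} hG hS => by
    rw [← lieBV_Theta_Xi k hG hS, lieBV_antisymm (isPar_currentXi S) (isPar_currentTheta k G)]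
    simp
  simp only [lieBV_add_left, lieBV_add_right, map_add, hTT, hTL, hTG _ _ hH, hTS _ _ hR, hLT,
    hGT _ _ hG, hST _ _ hS, lieBV_L_L, hLG hU hH, lieBV_L_Xi U hR, hGL hX hG, hGG,
    lieBV_Theta_Xi k hG hR, hSL X hS, hSG hH hS, lieBV_Xi_Xi hS hR, paramBracket]
  simp only [hL, hX', hΘ, map_add, map_sub, map_neg, map_smul, map_zero]
  module

theorem locInt_lieBV_currentHat (x y : CurrentParam) :
    locInt (lieBV (currentHat k x) (currentHat k y)) =
      locInt (currentHat k (paramBracket x y)) :=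
  lieBV_current_of k locInt (fun _ _ h => h) (tHatLin k) (isPar_currentTHat k) (fun _ => rfl)
    (fun V W => congrArg locInt (lieBV_THat_THat k V W)) (locInt_lieBV_THat_L k)
    (fun V _ hG => locInt_lieBV_THat_Theta k V hG) (fun V _ hS => locInt_lieBV_THat_Xi k V hS) x y

end BLG

/-! ### The stress tensor as a Lie derivative; conformal weights -/

namespace Density

variable {m : ℕ}

theorem eulerLin_fld_mul_dz_fld (φ a b : Superfield m) (G : Density m) :
    eulerLin φ (fld a * dz (fld b)) G = (if a = φ then dz (fld b) * G else 0)
      - koszul a.odd b.odd • (if b = φ then dz (fld a * G) else 0) := by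
  rw [eulerLin_mul (isPar_fld a) (isPar_fld b).dz, eulerLin_fld, eulerLin_dz_fld, sub_eq_add_neg,
    ← smul_neg]
  split_ifs <;> simp

end Density

namespace BLG

open Density

variable {m : ℕ}

theorem varDer_currentT (φ : Superfield m) (V : Entire) :
    varDer φ (currentT V) = ∑ c : Fin m,
      (-(∑ p : GaugeIdx, eulerLin φ (fld (.B c p) * dz (fld (.A c p))) (coef V))
      + ∑ I : Fin 4, ∑ u : Fin 4,
        ((3 / 4 : ℂ) • eulerLin φ (fld (.Psi c I u) * dz (fld (.Z c I u))) (coef V)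
          - (1 / 4 : ℂ) • eulerLin φ (fld (.Z c I u) * dz (fld (.Psi c I u))) (coef V))) := by
  rw [varDer_eq_eulerLin, currentT, eulerLin_coef_mul, mul_one]
  simp only [map_sum, map_add, map_neg, map_sub, map_smul, LinearMap.sum_apply,
    LinearMap.add_apply, LinearMap.neg_apply, LinearMap.sub_apply, LinearMap.smul_apply, Z, Psi]

theorem varDer_A_currentT (c : Fin m) (p : GaugeIdx) (V : Entire) :
    varDer (.A c p) (currentT V) = dz (fld (.B c p) * coef V) := by
  simp [varDer_currentT, eulerLin_fld_mul_dz_fld, ite_and, Superfield.odd]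

theorem varDer_B_currentT (c : Fin m) (p : GaugeIdx) (V : Entire) :
    varDer (.B c p) (currentT V) = -(dz (fld (.A c p)) * coef V) := by
  simp [varDer_currentT, eulerLin_fld_mul_dz_fld, ite_and, Superfield.odd]

theorem varDer_Z_currentT (c : Fin m) (I u : Fin 4) (V : Entire) :
    varDer (.Z c I u) (currentT V) =
      -((3 / 4 : ℂ) • dz (Psi c I u * coef V)) - (1 / 4 : ℂ) • (dz (Psi c I u) * coef V) := by
  simp [varDer_currentT, eulerLin_fld_mul_dz_fld, ite_and, Superfield.odd, Psi]

theorem varDer_Psi_currentT (c : Fin m) (I u : Fin 4) (V : Entire) :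
    varDer (.Psi c I u) (currentT V) =
      (3 / 4 : ℂ) • (dz (Z c I u) * coef V) + (1 / 4 : ℂ) • dz (Z c I u * coef V) := by
  simp [varDer_currentT, eulerLin_fld_mul_dz_fld, ite_and, Superfield.odd, Z,
    Finset.sum_add_distrib]

theorem isPar_currentT (V : Entire) : IsPar true (currentT (m := m) V) := by
  rw [currentT]
  refine (isPar_coef V).mul (q := true) (IsPar.sum fun c _ => IsPar.add (IsPar.neg (IsPar.sum fun p _ => ?_))
    (IsPar.sum fun I _ => IsPar.sum fun u _ => IsPar.sub (IsPar.smul ?_ _) (IsPar.smul ?_ _)))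
  · exact (isPar_fld (.B c p)).mul (isPar_fld (.A c p)).dz
  · exact (isPar_Psi c I u).mul (isPar_Z c I u).dz
  · exact (isPar_Z c I u).mul (isPar_Psi c I u).dz

/-- The Hamiltonian vector field of `𝐓_V`: the Lie derivative along `V`. -/
def lieDer (V : Entire) : Density m →ₗ[ℂ] Density m := ham (isPar_currentT V)

theorem lieDer_mul (V : Entire) (F G : Density m) :
    lieDer V (F * G) = lieDer V F * G + F * lieDer V G := by
  rw [lieDer, ham, evo_mul]; simp

theorem lieDer_coef (V f : Entire) : lieDer V (coef f : Density m) = 0 := evo_coef (isPar_hamChar (isPar_currentT V)) f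

theorem lieDer_dz (V : Entire) (F : Density m) : lieDer V (dz F) = dz (lieDer V F) :=
  evo_dz (isPar_hamChar (isPar_currentT V)) F

theorem lieDer_dpr (V : Entire) (F : Density m) : lieDer V (dpr F) = dpr (lieDer V F) := by
  rw [lieDer, ham, evo_dpr]; simp

theorem lieDer_fld (V : Entire) (φ : Superfield m) :
    lieDer V (fld φ) = koszul true φ.odd • varDer φ.conj (currentT V) :=
  evo_fld (isPar_hamChar (isPar_currentT V)) φ

/-- `F` transforms under Lie derivatives as a density of weight `w`. -/
def HasWeight (w : ℂ) (F : Density m) : Prop :=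
  ∀ V, lieDer V F = coef V * dz F + w • (coef (Entire.der V) * F)

theorem hasWeight_A (c : Fin m) (p : GaugeIdx) : HasWeight 0 (fld (.A c p)) := fun V => by
  rw [lieDer_fld, Superfield.conj, varDer_B_currentT, coef_comm]
  simp [Superfield.odd]

theorem hasWeight_B (c : Fin m) (p : GaugeIdx) : HasWeight 1 (fld (.B c p)) := fun V => by
  rw [lieDer_fld, Superfield.conj, varDer_A_currentT, dz_mul, coef_comm, coef_comm, dz_coef]
  simp [Superfield.odd]

theorem hasWeight_Z (c : Fin m) (I u : Fin 4) : HasWeight (1 / 4) (Z c I u) := fun V => by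
  rw [Z, lieDer_fld, Superfield.conj, varDer_Psi_currentT, dz_mul, coef_comm, coef_comm, dz_coef,
    Superfield.odd, koszul_false_right, Z]
  module

theorem hasWeight_Psi (c : Fin m) (I u : Fin 4) : HasWeight (3 / 4) (Psi c I u) := fun V => by
  rw [Psi, lieDer_fld, Superfield.conj, varDer_Z_currentT, dz_mul, coef_comm, coef_comm, dz_coef,
    Superfield.odd, koszul_true_true, Psi]
  module

section Weight

variable {w w' : ℂ} {F G : Density m}

theorem HasWeight.add (hF : HasWeight w F) (hG : HasWeight w G) : HasWeight w (F + G) := fun V => by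
  simp only [map_add, hF V, hG V, mul_add]; module

theorem HasWeight.smul (hF : HasWeight w F) (r : ℂ) : HasWeight w (r • F) := fun V => by
  simp only [map_smul, hF V, mul_smul_comm]; module

theorem HasWeight.neg (hF : HasWeight w F) : HasWeight w (-F) := by
  simpa using hF.smul (-1)

theorem hasWeight_zero (w : ℂ) : HasWeight w (0 : Density m) := fun V => by simp

theorem HasWeight.sum {ι : Type*} {s : Finset ι} {F : ι → Density m}
    (hF : ∀ i ∈ s, HasWeight w (F i)) : HasWeight w (∑ i ∈ s, F i) := by
  classical
  induction s using Finset.induction_on with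
  | empty => simpa using hasWeight_zero w
  | insert a s ha ih =>
    rw [Finset.sum_insert ha]
    exact (hF a (Finset.mem_insert_self a s)).add
      (ih fun i hi => hF i (Finset.mem_insert_of_mem hi))

theorem HasWeight.mul (hF : HasWeight w F) (hG : HasWeight w' G) : HasWeight (w + w') (F * G) :=
  fun V => by
    have h1 : F * (coef V * dz G) = coef V * (F * dz G) := by
      rw [← mul_assoc, ← coef_comm, mul_assoc]
    have h2 : F * (coef (Entire.der V) * G) = coef (Entire.der V) * (F * G) := by
      rw [← mul_assoc, ← coef_comm, mul_assoc]
    rw [lieDer_mul, hF V, hG V, dz_mul]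
    simp only [add_mul, mul_add, smul_mul_assoc, mul_smul_comm, mul_assoc, h1, h2]
    module

theorem HasWeight.dpr (hF : HasWeight w F) : HasWeight w (dpr F) := fun V => by
  rw [lieDer_dpr, hF V, map_add, map_smul, dpr_mul, dpr_mul, (isPar_coef V).invol,
    (isPar_coef _).invol, dpr_coef, dpr_coef, dpr_dz]
  simp

/-- The derivative of a density of weight `w` is not a density again: there is an anomaly `w V''`,
absent exactly for `w = 0`, the weight of `𝐀`. -/
theorem HasWeight.lieDer_dz (hF : HasWeight w F) (V : Entire) :
    lieDer V (dz F) = coef V * dz (dz F) + (w + 1) • (coef (Entire.der V) * dz F) +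
      w • (coef (Entire.der (Entire.der V)) * F) := by
  rw [BLG.lieDer_dz, hF V, map_add, map_smul, dz_mul, dz_mul, dz_coef, dz_coef]
  module

theorem HasWeight.dz (hF : HasWeight 0 F) : HasWeight 1 (dz F) := fun V => by
  rw [hF.lieDer_dz]; module

theorem HasWeight.congr (hF : HasWeight w F) (h : w = w') : HasWeight w' F := h ▸ hF

/-- The total derivative of `f V F` trades the transport term `f V ∂F` for terms without derivatives
of `F`. The density `A` allows for an anomaly. -/
theorem locInt_lieDer_coef_mul {V : Entire} {A : Density m}
    (hF : lieDer V F = coef V * Density.dz F + w • (coef (Entire.der V) * F) + A) (f : Entire) :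
    locInt (lieDer V (coef f * F)) =
      locInt (coef ((w - 1) • (f * Entire.der V) - Entire.der f * V) * F) + locInt (coef f * A) := by
  have h := locInt_dz (coef (f * V) * F)
  rw [dz_mul, dz_coef, map_add, Entire.der_mul, coef_add, add_mul, map_add] at h
  rw [lieDer_mul, lieDer_coef, zero_mul, zero_add, hF, mul_add, mul_add, mul_smul_comm, ← mul_assoc,
    ← mul_assoc, ← coef_mul, ← coef_mul, map_add, map_add, map_smul, sub_eq_add_neg, coef_add,
    coef_smul, coef_neg, add_mul, smul_mul_assoc, neg_mul, map_add, map_smul, map_neg]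
  linear_combination (norm := module) h

end Weight

/-- The sign is the décalage sign of the odd functional `𝐓_V`. -/
theorem locInt_lieBV_currentT (V : Entire) (G : Density m) :
    locInt (lieBV (currentT V) G) = -locInt (lieDer V G) := by
  have h : bv (currentT V) G = -lieBV (currentT V) G := by
    rw [← neg_one_smul ℂ (lieBV _ _), ← lieBV_smul_left, lieBV, map_smul, (isPar_currentT V).invol,
      smul_smul]
    simp
  rw [lieDer, ← locInt_bv, h, map_neg, neg_neg]

end BLG

/-! ### Brackets with the stress tensor and its closedness -/

namespace BLG

open Density

variable {m : ℕ} (k : Fin m → ℂ)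

/-- The second family may transform with an anomaly `V'' Y'`, as `∂_𝐁 𝐙` does. -/
theorem locInt_lieDer_bil (V : Entire) {w w' : ℂ} {X Y Y' : Fam m}
    (hX : ∀ c I u, HasWeight w (X c I u))
    (hY : ∀ c I u, lieDer V (Y c I u) = coef V * dz (Y c I u)
      + w' • (coef (Entire.der V) * Y c I u) + coef (Entire.der (Entire.der V)) * Y' c I u)
    (M : EMat) :
    locInt (lieDer V (bil M X Y)) =
      locInt (bil ((w + w' - 1) • Entire.der V • M - V • der M) X Y) +
      locInt (bil (Entire.der (Entire.der V) • M) X Y') := by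
  simp only [bil, map_sum, ← Finset.sum_add_distrib]
  refine Finset.sum_congr rfl fun c _ => Finset.sum_congr rfl fun I _ =>
    Finset.sum_congr rfl fun J _ => Finset.sum_congr rfl fun u _ => ?_
  rw [locInt_lieDer_coef_mul (w := w + w')
    (A := coef (Entire.der (Entire.der V)) * (X c I u * Y' c J u))]
  · refine congrArg₂ (· + ·) ?_ ?_
    · simp only [Matrix.sub_apply, Matrix.smul_apply, der_apply, smul_eq_mul]
      rw [mul_comm (M I J), mul_comm V]
    · rw [← mul_assoc, ← coef_mul, Matrix.smul_apply, smul_eq_mul, mul_comm (M I J)]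
  · have h : ∀ (f : Entire) (G : Density m), X c I u * (coef f * G) = coef f * (X c I u * G) :=
      fun f G => by rw [← mul_assoc, ← coef_comm, mul_assoc]
    rw [lieDer_mul, hX c I u V, hY c J u, dz_mul]
    simp only [add_mul, mul_add, smul_mul_assoc, mul_smul_comm, mul_assoc, h]
    module

theorem locInt_lieDer_bil_of_hasWeight (V : Entire) {w w' : ℂ} {X Y : Fam m}
    (hX : ∀ c I u, HasWeight w (X c I u)) (hY : ∀ c I u, HasWeight w' (Y c I u)) (M : EMat) :
    locInt (lieDer V (bil M X Y)) =
      locInt (bil ((w + w' - 1) • Entire.der V • M - V • der M) X Y) := by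
  rw [locInt_lieDer_bil V hX (Y' := 0) (fun c I u => by simpa using hY c I u V) M, bil_zero_right,
    map_zero, add_zero]

theorem hasWeight_soMatrix {w : ℂ} {X : GaugeIdx → Density m} (h : ∀ i, HasWeight w (X i))
    (u v : Fin 4) : HasWeight w (soMatrix X u v) := by
  unfold soMatrix
  split_ifs
  · exact h _
  · exact (h _).neg
  · exact hasWeight_zero w

theorem hasWeight_gaugeA (c : Fin m) (u v : Fin 4) : HasWeight 0 (gaugeA c u v) :=
  hasWeight_soMatrix (hasWeight_A c) u v

theorem hasWeight_sharpB (c : Fin m) (u v : Fin 4) : HasWeight 1 (sharpB c u v) :=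
  HasWeight.smul (HasWeight.sum fun _ _ => HasWeight.sum fun _ _ =>
    (hasWeight_soMatrix (hasWeight_B c) _ _).smul _) _

/-- The product of `𝐁` (weight 1) and `𝐙` (weight `¼`) is a genuine density of weight `5/4`; only
`∂𝐙` contributes the anomaly. -/
theorem lieDer_covB_Z (V : Entire) (c : Fin m) (I u : Fin 4) :
    lieDer V (covD k ZF c I u) = coef V * dz (covD k ZF c I u)
      + (5 / 4 : ℂ) • (coef (Entire.der V) * covD k ZF c I u)
      + coef (Entire.der (Entire.der V)) * (((1 / 4 : ℂ) • ZF) : Fam m) c I u := by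
  have h : HasWeight (5 / 4) (∑ v : Fin 4, sharpB c u v * Z c I v) :=
    HasWeight.sum fun v _ => ((hasWeight_sharpB c u v).mul (hasWeight_Z c I v)).congr (by norm_num)
  show lieDer V (covB k c (Z c I) u) = coef V * dz (covB k c (Z c I) u)
    + (5 / 4 : ℂ) • (coef (Entire.der V) * covB k c (Z c I) u)
    + coef (Entire.der (Entire.der V)) * ((1 / 4 : ℂ) • Z c I u)
  rw [covB, map_sub, (hasWeight_Z c I u).lieDer_dz, map_smul, h V, map_sub, map_smul, mul_sub,
    mul_sub, mul_smul_comm, mul_smul_comm, mul_smul_comm]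
  module

theorem locInt_lieBV_T_L (V : Entire) (U : EMat) :
    locInt (lieBV (currentT (m := m) V) (currentL U)) = locInt (currentL (V • der U)) := by
  rw [locInt_lieBV_currentT, currentL_eq, currentL_eq,
    locInt_lieDer_bil_of_hasWeight V (X := PsiF) (Y := ZF) hasWeight_Psi hasWeight_Z, ← map_neg, ← bil_neg]
  refine congrArg (fun M => locInt (bil M PsiF ZF)) ?_
  norm_num

theorem locInt_lieBV_T_Xi (V : Entire) (S : EMat) :
    locInt (lieBV (currentT (m := m) V) (currentXi S)) =
      locInt (currentXi (V • der S + (1 / 2 : ℂ) • Entire.der V • S)) := by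
  rw [locInt_lieBV_currentT, currentXi_eq, currentXi_eq, map_smul, map_smul,
    locInt_lieDer_bil_of_hasWeight V (X := ZF) (Y := ZF) hasWeight_Z hasWeight_Z]
  simp only [bil_sub, bil_add, bil_smul, map_sub, map_add, map_smul]
  module

theorem locInt_lieBV_T_Theta (V : Entire) (G : EMat) :
    locInt (lieBV (currentT V) (currentTheta k G)) =
      locInt (currentTheta k (V • der G - (1 / 2 : ℂ) • Entire.der V • G)) := by
  -- The anomaly of `∂_𝐁 𝐙` pairs `𝐙` with itself through an antisymmetric matrix and so drops out.
  have h2 : (Entire.der (Entire.der V) • dual G).transpose =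
      -(Entire.der (Entire.der V) • dual G) := by
    rw [Matrix.transpose_smul, dual_transpose, smul_neg]
  rw [locInt_lieBV_currentT, currentTheta_eq, currentTheta_eq, map_sub, map_smul, map_smul, map_sub,
    map_smul, map_smul, 
    locInt_lieDer_bil_of_hasWeight V (X := PsiF) (Y := PsiF) hasWeight_Psi hasWeight_Psi,
    locInt_lieDer_bil V (X := ZF) hasWeight_Z (lieDer_covB_Z k V), bil_smul_right, bil_Z_Z_of_antisymm h2]
  simp only [bil_sub, bil_smul, map_sub, map_smul, dual_sub, dual_csmul, dual_smul, dual_der,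
    smul_zero, map_zero]
  module

/-- The anomalies `¾ · ¼` of `∂𝐙` and `¼ · ¾` of `∂𝚿` cancel: this is what the coefficients of the
stress tensor are made for. -/
theorem hasWeight_stress (c : Fin m) (I u : Fin 4) :
    HasWeight 2 ((3 / 4 : ℂ) • (Psi c I u * dz (Z c I u))
      - (1 / 4 : ℂ) • (Z c I u * dz (Psi c I u))) := fun V => by
  have h : ∀ (f : Entire) (F G : Density m), F * (coef f * G) = coef f * (F * G) :=
    fun f F G => by rw [← mul_assoc, ← coef_comm, mul_assoc]
  have hZP : Z c I u * Psi c I u = Psi c I u * Z c I u := (isPar_Z c I u).even_comm _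
  simp only [map_sub, map_smul, lieDer_mul, (hasWeight_Z c I u).lieDer_dz,
    (hasWeight_Psi c I u).lieDer_dz, hasWeight_Z c I u V, hasWeight_Psi c I u V, dz_mul, mul_sub,
    mul_add, add_mul, mul_smul_comm, smul_mul_assoc, h, mul_assoc, hZP]
  module

theorem locInt_lieBV_T_T (V W : Entire) :
    locInt (lieBV (currentT V) (currentT (m := m) W)) =
      locInt (currentT (V * Entire.der W - Entire.der V * W)) := by
  have h : ∀ F : Density m, HasWeight 2 F → locInt (lieDer V (coef W * F)) =
      -locInt (coef (V * Entire.der W - Entire.der V * W) * F) := fun F hF => by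
    rw [locInt_lieDer_coef_mul (A := 0) (by simpa using hF V), mul_zero, map_zero, add_zero,
      ← map_neg, ← neg_mul, ← coef_neg]
    refine congrArg (fun f => locInt (coef f * F)) ?_
    rw [mul_comm W, mul_comm V]
    module
  rw [locInt_lieBV_currentT, currentT, h, neg_neg, currentT]
  exact HasWeight.sum fun c _ => (HasWeight.sum fun p _ => ((hasWeight_B c p).mul
    (hasWeight_A c p).dz).congr (by norm_num)).neg.add
      (HasWeight.sum fun I _ => HasWeight.sum fun u _ => hasWeight_stress c I u)

theorem hasWeight_superpotential (l : ℂ) (c : Fin m) : HasWeight 1 (superpotential l c) :=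
  HasWeight.smul (HasWeight.sum fun _ _ => HasWeight.sum fun _ _ => HasWeight.smul
    (((((hasWeight_Z c _ _).mul (hasWeight_Z c _ _)).mul (hasWeight_Z c _ _)).mul
      (hasWeight_Z c _ _)).congr (by norm_num)) _) _

/-- Each summand has total weight one: `𝐁` carries weight 1, `∂𝐀` has weight 1 because `𝐀` has
weight 0, `𝚿` and `𝐙` carry `¾ + ¼`, and the superpotential is quartic in `𝐙`. -/
theorem hasWeight_action : HasWeight 1 (action k) := by
  refine HasWeight.sum fun c _ => HasWeight.add (HasWeight.add (HasWeight.add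
    (HasWeight.sum fun p _ => ?_) ?_) (HasWeight.sum fun I _ => HasWeight.sum fun u _ => ?_))
    (hasWeight_superpotential _ _)
  · rw [curvature, Matrix.mul_apply]
    refine ((hasWeight_B c p).mul (HasWeight.add (hasWeight_gaugeA c _ _).dpr
      (HasWeight.sum fun v _ => ?_))).congr (add_zero 1)
    exact ((hasWeight_gaugeA c _ _).mul (hasWeight_gaugeA c _ _)).congr (add_zero 0)
  · exact HasWeight.smul (HasWeight.smul (HasWeight.sum fun _ _ => HasWeight.sum fun _ _ =>
      HasWeight.sum fun _ _ => HasWeight.sum fun _ _ => HasWeight.smul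
        (((hasWeight_gaugeA c _ _).mul (hasWeight_gaugeA c _ _).dz).congr (zero_add 1)) _) _) _
  · refine ((hasWeight_Psi c I u).mul (HasWeight.add (hasWeight_Z c I u).dpr
      (HasWeight.sum fun v _ => ?_))).congr (by norm_num)
    exact ((hasWeight_gaugeA c _ _).mul (hasWeight_Z c I v)).congr (zero_add _)

theorem isPar_superpotential (l : ℂ) (c : Fin m) : IsPar false (superpotential l c) :=
  IsPar.smul (IsPar.sum fun _ _ => IsPar.sum fun _ _ => IsPar.smul
    ((((isPar_Z c _ _).mul (isPar_Z c _ _)).mul (isPar_Z c _ _)).mul (isPar_Z c _ _)) _) _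

theorem isPar_action : IsPar false (action k) := by
  refine IsPar.sum fun c _ => IsPar.add (IsPar.add (IsPar.add
    (IsPar.sum fun p _ => ?_) ?_) (IsPar.sum fun I _ => IsPar.sum fun u _ => ?_))
    (isPar_superpotential _ _)
  · rw [curvature, Matrix.mul_apply]
    exact (isPar_fld (.B c p)).mul (q := false) (IsPar.add (isPar_gaugeA c _ _).dpr
      (IsPar.sum fun v _ => (isPar_gaugeA c _ _).mul (isPar_gaugeA c _ _)))
  · exact IsPar.smul (IsPar.smul (IsPar.sum fun _ _ => IsPar.sum fun _ _ =>
      IsPar.sum fun _ _ => IsPar.sum fun _ _ => IsPar.smul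
        ((isPar_gaugeA c _ _).mul (isPar_gaugeA c _ _).dz) _) _) _
  · exact (isPar_Psi c I u).mul (q := true) (IsPar.add (isPar_Z c I u).dpr
      (IsPar.sum fun v _ => (isPar_gaugeA c _ _).mul (isPar_Z c I v)))

/-- The Lie derivative of a density of weight one is the total derivative `∂(V S)`; antisymmetry of
the bracket turns this invariance of the action into closedness. -/
theorem qClosed_currentT (V : Entire) : QClosed k (currentT V) := by
  have h : bv (action k) (currentT V) = lieBV (action k) (currentT V) := by
    rw [lieBV, (isPar_action k).invol, koszul_false_left, one_smul]
  have e : lieDer V (action k) = dz (coef V * action k) := by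
    rw [hasWeight_action k V, dz_mul, dz_coef, one_smul, add_comm]
  rw [QClosed, h, lieBV_antisymm (isPar_action k) (isPar_currentT V), map_neg, map_smul,
    locInt_lieBV_currentT, e, locInt_dz]
  simp

end BLG

/-! ### The Levi-Civita symbol and determinants -/

namespace BLG

theorem leviInt_perm (σ : Equiv.Perm (Fin 4)) : leviInt σ = (Equiv.Perm.sign σ : ℤ) := by
  revert σ; decide +kernel

theorem leviInt_of_not_injective (i : Fin 4 → Fin 4) (h : ¬ Function.Injective i) :
    leviInt i = 0 := by
  revert i; decide +kernel

section Det

variable {R : Type*} [CommRing R] [Algebra ℂ R]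

/-- The symbol vanishes off permutations and equals the sign on them. -/
theorem sum_levi_smul {M : Type*} [AddCommGroup M] [Module ℂ M] (f : (Fin 4 → Fin 4) → M) :
    ∑ i : Fin 4 → Fin 4, levi i • f i =
      ∑ σ : Equiv.Perm (Fin 4), Equiv.Perm.sign σ • f σ := by
  refine (Fintype.sum_of_injective (fun (σ : Equiv.Perm (Fin 4)) => (σ : Fin 4 → Fin 4))
    DFunLike.coe_injective _ _ (fun i hi => ?_) fun σ => ?_).symm
  · rw [levi_eq, leviInt_of_not_injective, Int.cast_zero, zero_smul]
    intro h
    exact hi ⟨Equiv.ofBijective i (Finite.injective_iff_bijective.mp h), rfl⟩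
  · rw [levi_eq, leviInt_perm]
    rcases Int.units_eq_one_or (Equiv.Perm.sign σ) with h | h <;> simp [h]

theorem sum_levi_prod (X : Matrix (Fin 4) (Fin 4) R) :
    ∑ u : Fin 4 → Fin 4, levi u • ∏ a, X a (u a) = X.det := by
  rw [sum_levi_smul, ← Matrix.det_transpose, Matrix.det_apply]
  rfl

theorem sum_levi_levi_prod (X : Matrix (Fin 4) (Fin 4) R) :
    ∑ i : Fin 4 → Fin 4, ∑ u : Fin 4 → Fin 4, (levi i * levi u) • ∏ a, X (i a) (u a) =
      (24 : ℂ) • X.det := by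
  have h : ∀ i : Fin 4 → Fin 4, ∑ u : Fin 4 → Fin 4, (levi i * levi u) • ∏ a, X (i a) (u a) =
      levi i • (X.submatrix i id).det := fun i => by
    rw [← sum_levi_prod, Finset.smul_sum]
    exact Finset.sum_congr rfl fun u _ => by rw [mul_smul]; rfl
  simp only [h]
  rw [sum_levi_smul]
  have h2 : ∀ σ : Equiv.Perm (Fin 4), Equiv.Perm.sign σ • (X.submatrix σ id).det = X.det :=
    fun σ => by
      rw [Matrix.det_permute]
      rcases Int.units_eq_one_or (Equiv.Perm.sign σ) with h | h <;> simp [h]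
  simp only [h2, Finset.sum_const, Finset.card_univ, Fintype.card_perm, Fintype.card_fin]
  rw [← Nat.cast_smul_eq_nsmul ℂ]
  norm_num [Nat.factorial]

theorem sum_fin_four_fun {M : Type*} [AddCommMonoid M] (g : (Fin 4 → Fin 4) → M) :
    ∑ f, g f = ∑ a, ∑ b, ∑ c, ∑ d, g ![a, b, c, d] := by
  let e : Fin 4 × Fin 4 × Fin 4 × Fin 4 ≃ (Fin 4 → Fin 4) :=
    { toFun := fun p => ![p.1, p.2.1, p.2.2.1, p.2.2.2]
      invFun := fun f => (f 0, f 1, f 2, f 3)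
      left_inv := fun _ => rfl
      right_inv := fun f => by funext i; fin_cases i <;> rfl }
  rw [← e.sum_comp]
  simp only [Fintype.sum_prod_type]
  rfl

/-- Both sides are the determinant with rows `e_u`, `X_P`, `X_Q`, `X_S`: the left side expands it,
and the right side recognises a cofactor of `X`, where `T` is the row index missing among `P`, `Q`,
`S`. -/
theorem sum_levi_adjugate (X : Matrix (Fin 4) (Fin 4) R) (u P Q S : Fin 4) :
    ∑ v, ∑ w, ∑ x, levi ![u, v, w, x] • (X P v * X Q w * X S x) =
      ∑ T, levi ![T, P, Q, S] • X.adjugate u T := by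
  let Y : Matrix (Fin 4) (Fin 4) R := fun i j =>
    ![(Pi.single u 1 : Fin 4 → R) j, X P j, X Q j, X S j] i
  have hY : ∑ v, ∑ w, ∑ x, levi ![u, v, w, x] • (X P v * X Q w * X S x) = Y.det := by
    rw [← sum_levi_prod, sum_fin_four_fun]
    have h : ∀ t v w x, levi ![t, v, w, x] • ∏ a, Y a (![t, v, w, x] a) =
        if t = u then levi ![t, v, w, x] • (X P v * X Q w * X S x) else 0 := fun t v w x => by
      by_cases ht : t = u
      · subst ht
        simp [Fin.prod_univ_four, Y]
      · simp [Fin.prod_univ_four, Y, ht]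
    simp only [h]
    symm
    rw [Finset.sum_eq_single u (fun t _ ht => by simp [ht]) (by simp)]
    simp
  -- Either `P`, `Q`, `S` are distinct and extend to a permutation whose value at 0 is the missing
  -- index, or two rows coincide and both sides vanish.
  have hd : ∀ P Q S : Fin 4, (∃ σ : Equiv.Perm (Fin 4), σ 1 = P ∧ σ 2 = Q ∧ σ 3 = S) ∨
      ((∀ T, leviInt ![T, P, Q, S] = 0) ∧ (P = Q ∨ P = S ∨ Q = S)) := by decide +kernel
  have hl : ∀ (σ : Equiv.Perm (Fin 4)) (T : Fin 4), leviInt ![T, σ 1, σ 2, σ 3] =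
      if T = σ 0 then (Equiv.Perm.sign σ : ℤ) else 0 := by decide +kernel
  rw [hY]
  rcases hd P Q S with ⟨σ, rfl, rfl, rfl⟩ | ⟨h0, h⟩
  · have e : Y = (X.updateRow (σ 0) (Pi.single u 1)).submatrix σ id := by
      refine Matrix.ext fun i j => ?_
      fin_cases i <;> simp [Y, Matrix.updateRow_apply]
    rw [e, Matrix.det_permute, Finset.sum_eq_single (σ 0)
      (fun T _ hT => by rw [levi_eq, hl, if_neg hT]; simp) (by simp), levi_eq, hl, if_pos rfl,
      Matrix.adjugate_apply]
    rcases Int.units_eq_one_or (Equiv.Perm.sign σ) with h | h <;> simp [h]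
  · simp only [levi_eq, h0, Int.cast_zero, zero_smul, Finset.sum_const_zero]
    rcases h with h | h | h
    · exact Matrix.det_zero_of_row_eq (i := 1) (j := 2) (by decide) (funext fun a => by simp [Y, h])
    · exact Matrix.det_zero_of_row_eq (i := 1) (j := 3) (by decide) (funext fun a => by simp [Y, h])
    · exact Matrix.det_zero_of_row_eq (i := 2) (j := 3) (by decide) (funext fun a => by simp [Y, h])

end Det

end BLG

/-! ### The superpotential as a determinant -/

namespace Density

variable {m : ℕ}

/-- The subalgebra of even densities. -/
def even (m : ℕ) : Subalgebra ℂ (Density m) where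
  carrier := {F | IsPar false F}
  mul_mem' hF hG := hF.mul hG
  add_mem' hF hG := hF.add hG
  algebraMap_mem' r := isPar_algebraMap r

instance : CommRing (even m) :=
  { (inferInstance : Ring (even m)) with
    mul_comm := fun F G => Subtype.ext (F.2.even_comm G.1) }

instance : Algebra ℂ (even m) := Subalgebra.algebra (even m)

/-- Even densities that do not involve the field `φ`. -/
def indep (φ : Superfield m) : Subalgebra ℂ (even m) where
  carrier := {F | ∀ G, eulerLin φ (F : Density m) G = 0}
  mul_mem' {F F'} hF hF' G := by
    show eulerLin φ ((F : Density m) * F') G = 0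
    rw [eulerLin_mul F.2 F'.2, hF, hF', smul_zero, add_zero]
  add_mem' {F F'} hF hF' G := by
    show eulerLin φ ((F : Density m) + F') G = 0
    rw [map_add, LinearMap.add_apply, hF, hF', add_zero]
  algebraMap_mem' r G := eulerLin_algebraMap φ r G

theorem det_mem_indep {φ : Superfield m} {M : Matrix (Fin 4) (Fin 4) (even m)}
    (h : ∀ i j, M i j ∈ indep φ) : M.det ∈ indep φ := by
  let N : Matrix (Fin 4) (Fin 4) (indep φ) := fun i j => ⟨M i j, h i j⟩
  have e : M.det = (indep φ).val N.det := by rw [AlgHom.map_det]; rfl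
  rw [e]
  exact N.det.2

end Density

namespace BLG

open Density

variable {m : ℕ}

/-- The matrix of the fields `𝐙` of a copy, with entries in the algebra of even densities. -/
def zMatrix (c : Fin m) : Matrix (Fin 4) (Fin 4) (even m) := fun I u => ⟨Z c I u, isPar_Z c I u⟩

/-- The double contraction with Levi-Civita symbols is 24 times the determinant, and `24 π / 12 = 2
π`. -/
theorem superpotential_eq (l : ℂ) (c : Fin m) :
    superpotential l c = ((2 * Real.pi / l : ℂ) • (zMatrix c).det : even m) := by
  have h := congrArg (even m).val (sum_levi_levi_prod (zMatrix c))
  simp only [map_sum, map_smul, Fin.prod_univ_four] at h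
  rw [superpotential]
  refine (congrArg _ h).trans ?_
  rw [smul_smul]
  refine congrArg (fun r : ℂ => r • ((zMatrix c).det : Density m)) ?_
  -- At `l = 0` both coefficients are zero by the convention for division.
  by_cases hl : l = 0
  · simp [hl]
  · field_simp; norm_num

/-- The derivative `∂𝐖/∂𝐙` of the superpotential. -/
def dSuper (k : Fin m → ℂ) : Fam m := fun c I u =>
  ((2 * Real.pi / k c : ℂ) • (zMatrix c).adjugate u I : even m)

theorem isPar_dSuper (k : Fin m → ℂ) : FamPar false (dSuper k) := fun _ _ _ => Subtype.property _

theorem superpotential_eq_sum (k : Fin m → ℂ) (c : Fin m) (I : Fin 4) :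
    superpotential (k c) c = ∑ u, Z c I u * dSuper k c I u := by
  have h : ∑ u, zMatrix c I u * (zMatrix c).adjugate u I = (zMatrix c).det := by
    have := congrFun (congrFun (zMatrix c).mul_adjugate I) I
    simpa [Matrix.mul_apply] using this
  rw [superpotential_eq, ← h, Finset.smul_sum, AddSubmonoidClass.coe_finsetSum]
  refine Finset.sum_congr rfl fun u _ => ?_
  rw [← mul_smul_comm]; rfl

/-- The cofactor belonging to row `I` is a determinant in which that row has been replaced by
constants, so it does not involve `𝐙^I`. -/
theorem eulerLin_dSuper_of_ne (k : Fin m → ℂ) {φ : Superfield m} {c : Fin m} {I : Fin 4}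
    (h : ∀ J u, J ≠ I → Superfield.Z c J u ≠ φ) (u : Fin 4) (G : Density m) :
    eulerLin φ (dSuper k c I u) G = 0 := by
  have h1 : (zMatrix c).adjugate u I ∈ indep φ := by
    rw [Matrix.adjugate_apply]
    refine det_mem_indep fun i j => ?_
    rw [Matrix.updateRow_apply]
    split_ifs with hi
    · rw [Pi.single_apply]
      split_ifs
      · exact one_mem _
      · exact zero_mem _
    · intro G
      show eulerLin φ (fld (.Z c i j)) G = 0
      rw [eulerLin_fld, if_neg (h i j hi)]
  exact (indep φ).smul_mem h1 _ G

/-- Expanding the determinant along row `I` makes it linear in `𝐙^I` with coefficients free of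
`𝐙^I`. -/
theorem varDer_Z_superpotential (k : Fin m → ℂ) (c' c : Fin m) (I u : Fin 4) :
    varDer (.Z c I u) (superpotential (k c') c') = if c' = c then dSuper k c I u else 0 := by
  rw [superpotential_eq_sum k c' I, varDer_eq_eulerLin]
  simp only [map_sum, LinearMap.sum_apply]
  have h : ∀ v, eulerLin (.Z c I u) (Z c' I v * dSuper k c' I v) 1 =
      if c' = c then if v = u then dSuper k c I u else 0 else 0 := fun v => by
    rw [eulerLin_mul (isPar_Z c' I v) (isPar_dSuper k c' I v), eulerLin_dSuper_of_ne, Z,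
      eulerLin_fld]
    · by_cases h1 : c' = c <;> by_cases h2 : v = u <;> simp [h1, h2]
    · intro J w hJ e
      injection e with _ e2
      exact hJ e2
  simp only [h]
  split_ifs <;> simp

theorem varDer_superpotential_of_ne (k : Fin m → ℂ) {φ : Superfield m} (c : Fin m)
    (h : ∀ I u, Superfield.Z c I u ≠ φ) : varDer φ (superpotential (k c) c) = 0 := by
  rw [superpotential_eq_sum k c 0, varDer_eq_eulerLin]
  simp only [map_sum, LinearMap.sum_apply]
  refine Finset.sum_eq_zero fun v _ => ?_
  rw [eulerLin_mul (isPar_Z c 0 v) (isPar_dSuper k c 0 v),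
    eulerLin_dSuper_of_ne k (fun J w _ => h J w), Z, eulerLin_fld, if_neg (h 0 v)]
  simp

/-- Matrix times adjugate is the determinant: the `𝔤𝔩(4)`-flavour variation of `𝐖` is a trace. The
product in the other order, `sum_dSuper_Z_gauge`, is the same statement for the gauge index. -/
theorem sum_dSuper_Z_flavour (k : Fin m → ℂ) (c : Fin m) (I J : Fin 4) :
    ∑ u, dSuper k c I u * Z c J u = if I = J then superpotential (k c) c else 0 := by
  have h := congrFun (congrFun (zMatrix c).mul_adjugate J) I
  rw [Matrix.mul_apply] at h
  have h2 : ∑ u, dSuper k c I u * Z c J u = (((2 * Real.pi / k c : ℂ) •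
      ∑ u, zMatrix c J u * (zMatrix c).adjugate u I : even m) : Density m) := by
    rw [Finset.smul_sum, AddSubmonoidClass.coe_finsetSum]
    refine Finset.sum_congr rfl fun u _ => ?_
    rw [(isPar_dSuper k c I u).even_comm, ← mul_smul_comm]; rfl
  rw [h2, h, superpotential_eq]
  by_cases hIJ : I = J
  · simp [hIJ]
  · simp [hIJ, Ne.symm hIJ]

theorem sum_dSuper_Z_gauge (k : Fin m → ℂ) (c : Fin m) (u v : Fin 4) :
    ∑ I, dSuper k c I u * Z c I v = if u = v then superpotential (k c) c else 0 := by
  have h := congrFun (congrFun (zMatrix c).adjugate_mul u) v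
  rw [Matrix.mul_apply] at h
  have h2 : ∑ I, dSuper k c I u * Z c I v = (((2 * Real.pi / k c : ℂ) •
      ∑ I, (zMatrix c).adjugate u I * zMatrix c I v : even m) : Density m) := by
    rw [Finset.smul_sum, AddSubmonoidClass.coe_finsetSum]
    refine Finset.sum_congr rfl fun I _ => ?_
    rw [← smul_mul_assoc]; rfl
  rw [h2, h, superpotential_eq]
  by_cases hIJ : u = v
  · simp [hIJ]
  · simp [hIJ]

/-- Exchanges a Levi-Civita symbol in gauge indices for one in flavour indices, at the price of a
gradient of `𝐖`. -/
theorem sum_levi_Z (k : Fin m → ℂ) (c : Fin m) (u P Q S : Fin 4) :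
    (2 * Real.pi / k c : ℂ) • ∑ v, ∑ w, ∑ x, levi ![u, v, w, x] • (Z c P v * Z c Q w * Z c S x) =
      ∑ T, levi ![T, P, Q, S] • dSuper k c T u := by
  have h := congrArg (fun F => ((2 * Real.pi / k c : ℂ) • F : Density m))
    (congrArg (even m).val (sum_levi_adjugate (zMatrix c) u P Q S))
  simp only [map_sum, map_smul] at h
  refine h.trans ?_
  rw [Finset.smul_sum]
  exact Finset.sum_congr rfl fun T _ => smul_comm _ _ _

end BLG

/-! ### Variational derivatives of the action -/

namespace BLG

open Density

variable {m : ℕ} (k : Fin m → ℂ)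

/-- The entries of the basis of `𝔰𝔬(4)`. -/
def soCoef (p : GaugeIdx) (u v : Fin 4) : ℂ :=
  if p.1 = (u, v) then 1 else if p.1 = (v, u) then -1 else 0

theorem soMatrix_eq_sum (X : GaugeIdx → Density m) (u v : Fin 4) :
    soMatrix X u v = ∑ p, soCoef p u v • X p := by
  unfold soMatrix
  rcases lt_trichotomy u v with h | h | h
  · rw [dif_pos h, Finset.sum_eq_single ⟨(u, v), h⟩ _ (by simp)]
    · simp [soCoef]
    · rintro ⟨⟨a, b⟩, hab⟩ - hne
      have h1 : ¬ (a, b) = (u, v) := fun e => hne (Subtype.ext e)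
      have h2 : ¬ (a, b) = (v, u) := fun e => by
        injection e with e1 e2
        subst e1 e2
        exact lt_asymm h hab
      simp only [soCoef, if_neg h1, if_neg h2, zero_smul]
  · subst h
    rw [dif_neg (lt_irrefl _), dif_neg (lt_irrefl _)]
    refine (Finset.sum_eq_zero ?_).symm
    rintro ⟨⟨a, b⟩, hab⟩ -
    have h1 : ¬ (a, b) = (u, u) := fun e => by
      injection e with e1 e2
      subst e1 e2
      exact lt_irrefl _ hab
    simp only [soCoef, if_neg h1, zero_smul]
  · rw [dif_neg (lt_asymm h), dif_pos h, Finset.sum_eq_single ⟨(v, u), h⟩ _ (by simp)]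
    · have h1 : ¬ (v, u) = (u, v) := fun e => by
        injection e with e1 e2
        exact h.ne e1
      simp [soCoef, h1]
    · rintro ⟨⟨a, b⟩, hab⟩ - hne
      have h1 : ¬ (a, b) = (v, u) := fun e => hne (Subtype.ext e)
      have h2 : ¬ (a, b) = (u, v) := fun e => by
        injection e with e1 e2
        subst e1 e2
        exact lt_asymm h hab
      simp only [soCoef, if_neg h1, if_neg h2, zero_smul]

theorem map_soMatrix (f : Density m →ₗ[ℂ] Density m) (X : GaugeIdx → Density m) (u v : Fin 4) :
    f (soMatrix X u v) = soMatrix (fun p => f (X p)) u v := by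
  unfold soMatrix
  split_ifs <;> simp

theorem soMatrix_of_antisymm {N : Fin 4 → Fin 4 → Density m} (hN : ∀ u v, N u v = -N v u)
    (u v : Fin 4) : soMatrix (fun p => N p.1.1 p.1.2) u v = N u v := by
  unfold soMatrix
  split_ifs with h h'
  · rfl
  · exact (hN u v).symm
  · obtain rfl : u = v := le_antisymm (not_lt.mp h') (not_lt.mp h)
    exact (eq_zero_of_eq_neg (hN u u)).symm

theorem sum_soCoef_smul (p : GaugeIdx) (N : Fin 4 → Fin 4 → Density m) :
    ∑ u, ∑ v, soCoef p u v • N u v = N p.1.1 p.1.2 - N p.1.2 p.1.1 := by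
  obtain ⟨⟨a, b⟩, hab⟩ := p
  have h : ∀ u v, soCoef ⟨(a, b), hab⟩ u v • N u v =
      (if a = u then (if b = v then N u v else 0) else 0) -
        (if b = u then (if a = v then N u v else 0) else 0) := fun u v => by
    have hne : a ≠ b := ne_of_lt hab
    by_cases h1 : a = u <;> by_cases h2 : b = v <;> by_cases h3 : b = u <;> by_cases h4 : a = v <;>
      simp_all [soCoef]
  simp only [h, Finset.sum_sub_distrib]
  simp

/-- By symmetry each pair `u < v` is counted twice in the double sum, and the diagonal contributes
nothing. -/
theorem sum_gaugeIdx {f : Fin 4 → Fin 4 → Density m} (hf : ∀ u v, f u v = f v u)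
    (h0 : ∀ u, f u u = 0) : ∑ p : GaugeIdx, f p.1.1 p.1.2 = (1 / 2 : ℂ) • ∑ u, ∑ v, f u v := by
  have h : ∑ p : GaugeIdx, f p.1.1 p.1.2 = ∑ p : Fin 4 × Fin 4, if p.1 < p.2 then f p.1 p.2 else 0 := by
    rw [← Finset.sum_filter, ← Finset.sum_subtype_eq_sum_filter]
    refine Finset.sum_congr ?_ fun _ _ => rfl
    ext; simp
  rw [h, Fintype.sum_prod_type]
  simp [Fin.sum_univ_four, h0, hf 1 0, hf 2 0, hf 3 0, hf 2 1, hf 3 1, hf 3 2]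
  module

theorem fld_B_eq (c : Fin m) (p : GaugeIdx) : fld (.B c p) = gaugeB c p.1.1 p.1.2 := by
  rw [gaugeB, soMatrix, dif_pos p.2]

theorem soCoef_antisymm (p : GaugeIdx) (u v : Fin 4) : soCoef p u v = -soCoef p v u := by
  obtain ⟨⟨a, b⟩, hab⟩ := p
  have hne : a ≠ b := ne_of_lt hab
  simp only [soCoef, Prod.mk.injEq]
  by_cases h1 : a = u <;> by_cases h2 : b = v <;> by_cases h3 : a = v <;> by_cases h4 : b = u <;>
    simp_all

section EulerA

variable (c c' : Fin m) (p : GaugeIdx)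

theorem eulerLin_A_gaugeA (u v : Fin 4) (G : Density m) :
    eulerLin (.A c p) (gaugeA c' u v) G = if c' = c then soCoef p u v • G else 0 := by
  rw [gaugeA, soMatrix_eq_sum]
  simp only [map_sum, map_smul, LinearMap.sum_apply, LinearMap.smul_apply, eulerLin_fld,
    Superfield.A.injEq, ite_and]
  split_ifs <;> simp

theorem eulerLin_A_dpr_gaugeA (u v : Fin 4) (G : Density m) :
    eulerLin (.A c p) (dpr (gaugeA c' u v)) G = if c' = c then soCoef p u v • dpr G else 0 := by
  rw [gaugeA, soMatrix_eq_sum]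
  simp only [map_sum, map_smul, LinearMap.sum_apply, LinearMap.smul_apply, eulerLin_dpr_fld,
    Superfield.A.injEq, ite_and, Superfield.odd, koszul_true_true]
  split_ifs <;> simp

theorem eulerLin_A_dz_gaugeA (u v : Fin 4) (G : Density m) :
    eulerLin (.A c p) (dz (gaugeA c' u v)) G = if c' = c then -(soCoef p u v • dz G) else 0 := by
  rw [eulerLin_dz, eulerLin_A_gaugeA]
  split_ifs <;> simp

theorem eulerLin_A_Z (I u : Fin 4) (G : Density m) : eulerLin (.A c p) (Z c' I u) G = 0 := by
  rw [Z, eulerLin_fld, if_neg (by simp)]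

theorem eulerLin_A_Psi (I u : Fin 4) (G : Density m) : eulerLin (.A c p) (Psi c' I u) G = 0 := by
  rw [Psi, eulerLin_fld, if_neg (by simp)]

theorem eulerLin_A_dpr_Z (I u : Fin 4) (G : Density m) :
    eulerLin (.A c p) (dpr (Z c' I u)) G = 0 := by
  rw [Z, eulerLin_dpr_fld, if_neg (by simp)]

end EulerA

theorem gaugeA_antisymm (c : Fin m) (u v : Fin 4) : gaugeA c u v = -gaugeA c v u :=
  soMatrix_antisymm _ u v
theorem gaugeB_antisymm (c : Fin m) (u v : Fin 4) : gaugeB c u v = -gaugeB c v u :=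
  soMatrix_antisymm _ u v

/-- The image `K^{ab} X_b` in `𝔰𝔬(4)` of a matrix of coefficients in the dual basis. -/
def sharp (X : Fin 4 → Fin 4 → Density m) (u v : Fin 4) : Density m :=
  (1 / 2 : ℂ) • ∑ w : Fin 4, ∑ x : Fin 4, levi ![u, v, w, x] • X w x

/-- Varying `𝐁 F'(𝐀)` gives the covariant differential `d'_𝐀 𝐁` in the coadjoint representation. -/
theorem varDer_A_BF (c c' : Fin m) (p : GaugeIdx) :
    varDer (.A c p) (∑ q : GaugeIdx, fld (.B c' q) * curvature c' q.1.1 q.1.2) =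
      if c' = c then dpr (gaugeB c p.1.1 p.1.2) + ∑ w, (gaugeA c p.1.1 w * gaugeB c w p.1.2 -
        gaugeB c p.1.1 w * gaugeA c w p.1.2) else 0 := by
  have hF : ∀ u v, IsPar false (dpr (gaugeA c' u v) + (gaugeA c' * gaugeA c') u v) := fun u v => by
    rw [Matrix.mul_apply]
    exact (isPar_gaugeA c' _ _).dpr.add
      (IsPar.sum fun w _ => (isPar_gaugeA c' _ _).mul (isPar_gaugeA c' _ _))
  have h : ∀ q : GaugeIdx, eulerLin (.A c p) (fld (.B c' q) * curvature c' q.1.1 q.1.2) 1 =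
      if c' = c then soCoef p q.1.1 q.1.2 • dpr (gaugeB c q.1.1 q.1.2) +
        ∑ w, (soCoef p q.1.1 w • (gaugeA c w q.1.2 * gaugeB c q.1.1 q.1.2) -
          soCoef p w q.1.2 • (gaugeA c q.1.1 w * gaugeB c q.1.1 q.1.2)) else 0 := fun q => by
    rw [curvature, eulerLin_mul (isPar_fld (.B c' q)) (hF _ _), eulerLin_fld, if_neg (by simp),
      zero_add, mul_one, map_add, LinearMap.add_apply, eulerLin_A_dpr_gaugeA, Matrix.mul_apply]
    simp only [map_sum, LinearMap.sum_apply, eulerLin_mul (isPar_gaugeA c' _ _) (isPar_gaugeA c' _ _),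
      eulerLin_A_gaugeA, koszul_true_true, fld_B_eq]
    split_ifs with hc
    · subst hc
      simp [Superfield.odd, sub_eq_add_neg]
    · simp
  rw [varDer_eq_eulerLin]
  simp only [map_sum, LinearMap.sum_apply, h]
  split_ifs with hc
  · rw [Finset.sum_add_distrib]
    refine congrArg₂ (· + ·) ?_ ?_
    · rw [sum_gaugeIdx (f := fun u v => soCoef p u v • dpr (gaugeB c u v)), sum_soCoef_smul,
        gaugeB_antisymm c p.1.2]
      · rw [map_neg]; module
      · intro u v
        rw [soCoef_antisymm, gaugeB_antisymm, map_neg, smul_neg, neg_smul, neg_neg]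
      · intro u
        rw [eq_zero_of_eq_neg (gaugeB_antisymm c u u), map_zero, smul_zero]
    · rw [sum_gaugeIdx (f := fun u v => ∑ w, (soCoef p u w • (gaugeA c w v * gaugeB c u v) -
          soCoef p w v • (gaugeA c u w * gaugeB c u v)))]
      -- The two factors of `𝐀²` contribute the same commutator with `𝐁`, by antisymmetry of `𝐀` and
      -- `𝐁`, which cancels the `½` from `sum_gaugeIdx`.
      · have e1 : ∑ u, ∑ v, ∑ w, soCoef p u w • (gaugeA c w v * gaugeB c u v) =
            ∑ w, (gaugeA c p.1.1 w * gaugeB c w p.1.2 - gaugeB c p.1.1 w * gaugeA c w p.1.2) := by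
          have h1 : ∀ u, ∑ v, ∑ w, soCoef p u w • (gaugeA c w v * gaugeB c u v) =
              ∑ w, soCoef p u w • ∑ v, gaugeA c w v * gaugeB c u v := fun u => by
            rw [Finset.sum_comm]
            simp only [Finset.smul_sum]
          simp only [h1, sum_soCoef_smul p fun u w => ∑ v, gaugeA c w v * gaugeB c u v]
          rw [← Finset.sum_sub_distrib]
          refine Finset.sum_congr rfl fun w _ => ?_
          rw [gaugeB_antisymm c w p.1.2, gaugeA_antisymm c w p.1.2, (isPar_gaugeB c p.1.1 w).even_comm]
          simp only [mul_neg, neg_mul]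
          abel
        have e2 : ∑ u, ∑ v, ∑ w, soCoef p w v • (gaugeA c u w * gaugeB c u v) =
            -∑ w, (gaugeA c p.1.1 w * gaugeB c w p.1.2 - gaugeB c p.1.1 w * gaugeA c w p.1.2) := by
          have h1 : ∑ u, ∑ v, ∑ w, soCoef p w v • (gaugeA c u w * gaugeB c u v) =
              ∑ w, ∑ v, soCoef p w v • ∑ u, gaugeA c u w * gaugeB c u v := by
            simp only [Finset.smul_sum]
            rw [Finset.sum_comm_cycle]
            exact Finset.sum_congr rfl fun w _ => Finset.sum_comm
          rw [h1, sum_soCoef_smul p fun w v => ∑ u, gaugeA c u w * gaugeB c u v,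
            ← Finset.sum_sub_distrib, ← Finset.sum_neg_distrib]
          refine Finset.sum_congr rfl fun w _ => ?_
          rw [gaugeB_antisymm c w p.1.1, gaugeA_antisymm c w p.1.1, (isPar_gaugeB c p.1.1 w).even_comm]
          simp only [mul_neg, neg_mul]
          abel
        simp only [Finset.sum_sub_distrib, e1, e2]
        module
      · intro u v
        refine Finset.sum_congr rfl fun w _ => ?_
        rw [gaugeB_antisymm c v u, gaugeA_antisymm c w u, gaugeA_antisymm c v w,
          soCoef_antisymm p v w, soCoef_antisymm p w u]
        simp
        abel
      · intro u
        rw [eq_zero_of_eq_neg (gaugeB_antisymm c u u)]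
        simp
  · simp

/-- The sign from integrating by parts cancels the sign of exchanging odd fields, and `Tr` is
symmetric; so both factors contribute equally, `¼ (4 + 4) = 2`. -/
theorem varDer_A_CS (c c' : Fin m) (p : GaugeIdx) :
    varDer (.A c p) (Tr (gaugeA c') ((gaugeA c').map dz)) =
      if c' = c then (2 : ℂ) • sharp (fun w x => dz (gaugeA c w x)) p.1.1 p.1.2 else 0 := by
  rw [varDer_eq_eulerLin, Tr]
  simp only [map_sum, map_smul, LinearMap.sum_apply, LinearMap.smul_apply, Matrix.map_apply,
    eulerLin_mul (isPar_gaugeA c' _ _) (isPar_gaugeA c' _ _).dz, eulerLin_A_gaugeA,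
    eulerLin_A_dz_gaugeA, koszul_true_true, mul_one]
  split_ifs with hc
  · subst hc
    have h2 : ∑ u, ∑ v, ∑ w, ∑ x, levi ![u, v, w, x] • (soCoef p u v • dz (gaugeA c' w x)) =
        (4 : ℂ) • sharp (fun w x => dz (gaugeA c' w x)) p.1.1 p.1.2 := by
      have h3 : ∀ u v, ∑ w, ∑ x, levi ![u, v, w, x] • (soCoef p u v • dz (gaugeA c' w x)) =
          soCoef p u v • ∑ w, ∑ x, levi ![u, v, w, x] • dz (gaugeA c' w x) := fun u v => by
        simp only [Finset.smul_sum]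
        exact Finset.sum_congr rfl fun w _ => Finset.sum_congr rfl fun x _ => smul_comm _ _ _
      simp only [h3, sum_soCoef_smul, sharp]
      simp only [levi_swap01 p.1.1 p.1.2, neg_smul, Finset.sum_neg_distrib]
      module
    have h4 : ∑ u, ∑ v, ∑ w, ∑ x, levi ![u, v, w, x] • (soCoef p w x • dz (gaugeA c' u v)) =
        (4 : ℂ) • sharp (fun w x => dz (gaugeA c' w x)) p.1.1 p.1.2 := by
      refine (sum_comm_pairs _).trans (Eq.trans ?_ h2)
      exact Finset.sum_congr rfl fun u _ => Finset.sum_congr rfl fun v _ =>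
        Finset.sum_congr rfl fun w _ => Finset.sum_congr rfl fun x _ => by rw [levi_rotate]
    simp only [smul_neg, neg_smul, one_smul, neg_neg, smul_add, Finset.sum_add_distrib]
    refine (congrArg₂ (fun a b => (1 / 4 : ℂ) • a + (1 / 4 : ℂ) • b) h2 h4).trans ?_
    module
  · simp

/-- Up to sign, the moment map of the `𝔰𝔬(4)`-action on the matter fields. -/
theorem varDer_A_matter (c c' : Fin m) (p : GaugeIdx) :
    varDer (.A c p) (∑ I : Fin 4, ∑ u : Fin 4, Psi c' I u * covZ c' I u) =
      if c' = c then -∑ I, (Psi c I p.1.1 * Z c I p.1.2 - Psi c I p.1.2 * Z c I p.1.1) else 0 := by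
  have h : ∀ I u, eulerLin (.A c p) (Psi c' I u * covZ c' I u) 1 =
      if c' = c then -∑ v, soCoef p u v • (Psi c I u * Z c I v) else 0 := fun I u => by
    have hp : IsPar true (covZ c' I u) := (isPar_Z c' I u).dpr.add
      (IsPar.sum fun v _ => (isPar_gaugeA c' _ _).mul (isPar_Z c' I v))
    rw [eulerLin_mul (isPar_Psi c' I u) hp, mul_one, covZ]
    simp only [map_add, LinearMap.add_apply, map_sum, LinearMap.sum_apply, eulerLin_mul (isPar_gaugeA c' _ _) (isPar_Z c' _ _),
      eulerLin_A_gaugeA, eulerLin_A_Z, eulerLin_A_Psi, eulerLin_A_dpr_Z]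
    split_ifs with hc
    · subst hc
      have e : ∀ v, Z c' I v * Psi c' I u = Psi c' I u * Z c' I v :=
        fun v => (isPar_Z c' I v).even_comm _
      simp [e]
    · simp
  rw [varDer_eq_eulerLin]
  simp only [map_sum, LinearMap.sum_apply, h]
  split_ifs with hc
  · simp only [Finset.sum_neg_distrib, sum_soCoef_smul p fun u v => Psi c _ u * Z c _ v]
  · simp

/-- `δS/δ𝐀`, as a matrix. -/
def dActionA (c : Fin m) (u v : Fin 4) : Density m :=
  dpr (gaugeB c u v) + ∑ w, (gaugeA c u w * gaugeB c w v - gaugeB c u w * gaugeA c w v)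
    + (k c / (2 * Real.pi) : ℂ) • sharp (fun w x => dz (gaugeA c w x)) u v
    - ∑ I, (Psi c I u * Z c I v - Psi c I v * Z c I u)

theorem varDer_add_sum (φ : Superfield m) (F : Fin m → Density m) :
    varDer φ (∑ c, F c) = ∑ c, varDer φ (F c) := by
  simp only [varDer_eq_eulerLin, map_sum, LinearMap.sum_apply]

theorem varDer_A_action (c : Fin m) (p : GaugeIdx) :
    varDer (.A c p) (action k) = dActionA k c p.1.1 p.1.2 := by
  have hW : ∀ c', varDer (.A c p) (superpotential (k c') c') = 0 := fun c' =>
    varDer_superpotential_of_ne k c' fun _ _ e => by cases e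
  rw [action, varDer_add_sum]
  simp only [varDer_add, varDer_smul, varDer_A_BF, varDer_A_CS, varDer_A_matter, hW]
  rw [Finset.sum_eq_single c _ (by simp)]
  · simp only [if_true, dActionA, smul_smul]
    -- The factor 2 is that of `varDer_A_CS`.
    rw [show k c / (4 * Real.pi) * 2 = k c / (2 * Real.pi) by
      have := Complex.ofReal_ne_zero.mpr Real.pi_ne_zero
      field_simp; norm_num]
    abel
  · intro c' _ hc
    simp [hc]

theorem eulerLin_gaugeA_of_ne {φ : Superfield m} (h : ∀ c p, Superfield.A c p ≠ φ) (c : Fin m)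
    (u v : Fin 4) (G : Density m) : eulerLin φ (gaugeA c u v) G = 0 := by
  rw [gaugeA, soMatrix_eq_sum]
  simp [eulerLin_fld, h]

theorem varDer_gauge_of_ne {φ : Superfield m} (hA : ∀ c p, Superfield.A c p ≠ φ)
    (hB : ∀ c p, Superfield.B c p ≠ φ) (c : Fin m) :
    varDer φ (∑ q : GaugeIdx, fld (.B c q) * curvature c q.1.1 q.1.2) = 0 ∧
    varDer φ (Tr (gaugeA c) ((gaugeA c).map dz)) = 0 := by
  have hdA : ∀ u v G, eulerLin φ (dpr (gaugeA c u v)) G = 0 := fun u v G => by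
    rw [gaugeA, soMatrix_eq_sum]
    simp [eulerLin_dpr_fld, hA]
  constructor
  · rw [varDer_eq_eulerLin]
    simp only [map_sum, LinearMap.sum_apply]
    refine Finset.sum_eq_zero fun q _ => ?_
    have hF : IsPar false (curvature c q.1.1 q.1.2) := by
      rw [curvature, Matrix.mul_apply]
      exact (isPar_gaugeA c _ _).dpr.add
        (IsPar.sum fun w _ => (isPar_gaugeA c _ _).mul (isPar_gaugeA c _ _))
    rw [eulerLin_mul (isPar_fld (.B c q)) hF, eulerLin_fld, if_neg (hB _ _), curvature,
      Matrix.mul_apply]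
    simp only [map_add, LinearMap.add_apply, map_sum, LinearMap.sum_apply, hdA,
      eulerLin_mul (isPar_gaugeA c _ _) (isPar_gaugeA c _ _), eulerLin_gaugeA_of_ne hA]
    simp
  · rw [varDer_eq_eulerLin, Tr]
    simp only [map_sum, map_smul, LinearMap.sum_apply, LinearMap.smul_apply, Matrix.map_apply,
      eulerLin_mul (isPar_gaugeA c _ _) (isPar_gaugeA c _ _).dz, eulerLin_gaugeA_of_ne hA,
      eulerLin_dz]
    simp

theorem isPar_covZ (c : Fin m) (I u : Fin 4) : IsPar true (covZ c I u) :=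
  famPar_ZF.covDpr c I u

theorem varDer_Psi_action (c : Fin m) (I u : Fin 4) :
    varDer (.Psi c I u) (action k) = covDpr ZF c I u := by
  have hA : ∀ c' p, Superfield.A c' p ≠ .Psi c I u := fun _ _ e => by cases e
  have hB : ∀ c' p, Superfield.B c' p ≠ .Psi c I u := fun _ _ e => by cases e
  have hW : ∀ c', varDer (.Psi c I u) (superpotential (k c') c') = 0 := fun c' =>
    varDer_superpotential_of_ne k c' fun _ _ e => by cases e
  have h : ∀ c' J v, eulerLin (.Psi c I u) (Psi c' J v * covZ c' J v) 1 =
      if c' = c then if J = I then if v = u then covZ c I u else 0 else 0 else 0 := fun c' J v => by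
    rw [eulerLin_mul (isPar_Psi c' J v) (isPar_covZ c' J v), covZ]
    simp only [map_add, LinearMap.add_apply, map_sum, LinearMap.sum_apply,
      eulerLin_mul (isPar_gaugeA c' _ _) (isPar_Z c' _ _), eulerLin_gaugeA_of_ne hA]
    simp only [Z, Psi, eulerLin_fld, eulerLin_dpr_fld]
    by_cases h1 : c' = c <;> by_cases h2 : J = I <;> by_cases h3 : v = u <;>
      simp [h1, h2, h3, covZ, Z]
  rw [action, varDer_add_sum]
  simp only [varDer_add, varDer_smul,
    (varDer_gauge_of_ne hA hB _).1,
    (varDer_gauge_of_ne hA hB _).2,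
    hW]
  simp only [varDer_eq_eulerLin, map_sum, LinearMap.sum_apply, h]
  simp
  rfl

theorem varDer_Z_action (c : Fin m) (I u : Fin 4) :
    varDer (.Z c I u) (action k) = covDpr PsiF c I u + dSuper k c I u := by
  have hA : ∀ c' p, Superfield.A c' p ≠ .Z c I u := fun _ _ e => by cases e
  have hB : ∀ c' p, Superfield.B c' p ≠ .Z c I u := fun _ _ e => by cases e
  have h : ∀ c' J v, eulerLin (.Z c I u) (Psi c' J v * covZ c' J v) 1 =
      if c' = c then if J = I then (if v = u then dpr (Psi c I u) else 0) +
        gaugeA c u v * Psi c I v else 0 else 0 := fun c' J v => by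
    rw [eulerLin_mul (isPar_Psi c' J v) (isPar_covZ c' J v), covZ]
    simp only [map_add, LinearMap.add_apply, map_sum, LinearMap.sum_apply,
      eulerLin_mul (isPar_gaugeA c' _ _) (isPar_Z c' _ _), eulerLin_gaugeA_of_ne hA]
    simp only [Z, Psi, eulerLin_fld, eulerLin_dpr_fld]
    by_cases h1 : c' = c <;> by_cases h2 : J = I <;>
      simp [h1, h2, Superfield.odd]
    rw [gaugeA_antisymm c u v, neg_mul]
    by_cases h3 : v = u <;> simp [h3]
  rw [action, varDer_add_sum]
  simp only [varDer_add, varDer_smul,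
    (varDer_gauge_of_ne hA hB _).1,
    (varDer_gauge_of_ne hA hB _).2,
    varDer_Z_superpotential]
  rw [Finset.sum_add_distrib]
  simp only [varDer_eq_eulerLin, map_sum, LinearMap.sum_apply, h]
  simp [Finset.sum_add_distrib]
  rfl

end BLG

namespace BLG

open Density

variable {m : ℕ} (k : Fin m → ℂ)

/-! ### The duality on antisymmetric matrices of densities -/

theorem sharp_add (X Y : Fin 4 → Fin 4 → Density m) (u v : Fin 4) :
    sharp (fun u v => X u v + Y u v) u v = sharp X u v + sharp Y u v := by
  simp only [sharp, smul_add, Finset.sum_add_distrib]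

theorem sharp_smul (r : ℂ) (X : Fin 4 → Fin 4 → Density m) (u v : Fin 4) :
    sharp (fun u v => r • X u v) u v = r • sharp X u v := by
  simp only [sharp, smul_comm _ r, ← Finset.smul_sum]

theorem sharp_sub (X Y : Fin 4 → Fin 4 → Density m) (u v : Fin 4) :
    sharp (fun u v => X u v - Y u v) u v = sharp X u v - sharp Y u v := by
  simp only [sharp, smul_sub, Finset.sum_sub_distrib]

theorem map_sharp (f : Density m →ₗ[ℂ] Density m) (X : Fin 4 → Fin 4 → Density m) (u v : Fin 4) :
    f (sharp X u v) = sharp (fun u v => f (X u v)) u v := by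
  simp only [sharp, map_smul, map_sum]

theorem sharp_antisymm (X : Fin 4 → Fin 4 → Density m) (u v : Fin 4) :
    sharp X u v = -sharp X v u := by
  simp only [sharp, levi_swap01 v u, neg_smul, Finset.sum_neg_distrib, smul_neg]

theorem sharp_apply {X : Fin 4 → Fin 4 → Density m} (hX : ∀ u v, X u v = -X v u) {I J K L : Fin 4}
    (h : leviInt ![I, J, K, L] = 1) : sharp X I J = X K L := by
  have key : ∀ I J K L : Fin 4, leviInt ![I, J, K, L] = 1 → ∀ a b, leviInt ![I, J, a, b] =
      (if a = K ∧ b = L then 1 else 0) - (if a = L ∧ b = K then 1 else 0) := by decide +kernel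
  have hne : ∀ I J K L : Fin 4, leviInt ![I, J, K, L] = 1 → K ≠ L := by decide +kernel
  have hKL := hne I J K L h
  have hLK := hX L K
  clear hX hne
  have hs : ∀ a b, levi ![I, J, a, b] • X a b =
      (if a = K then (if b = L then X a b else 0) else 0) -
        (if a = L then (if b = K then X a b else 0) else 0) := by
    intro a b
    rw [levi_eq, key I J K L h a b]
    clear key hLK
    by_cases h1 : a = K <;> by_cases h2 : b = L <;> by_cases h3 : a = L <;> by_cases h4 : b = K <;>
      simp_all
  simp only [sharp, hs, Finset.sum_sub_distrib]
  simp only [Finset.sum_ite_eq', Finset.mem_univ, if_true, Finset.sum_ite_irrel,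
    Finset.sum_const_zero]
  rw [hLK]
  module

/-- The duality on antisymmetric 4×4 matrices is an involution: the complement of the complementary
pair is the original one, with sign `+1`. -/
theorem sharp_sharp {X : Fin 4 → Fin 4 → Density m} (hX : ∀ u v, X u v = -X v u) (u v : Fin 4) :
    sharp (sharp X) u v = X u v := by
  have key : ∀ I J : Fin 4, I = J ∨ ∃ K L, leviInt ![I, J, K, L] = 1 ∧ leviInt ![K, L, I, J] = 1 := by
    decide +kernel
  rcases key u v with rfl | ⟨K, L, h, h'⟩
  · rw [eq_zero_of_eq_neg (sharp_antisymm (sharp X) u u), eq_zero_of_eq_neg (hX u u)]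
  · rw [sharp_apply (sharp_antisymm X) h, sharp_apply hX h']

/-- Equivariance of the duality under the adjoint action of `𝔰𝔬(4)`, equivalently invariance of
`Tr`. The hypothesis `hab` keeps the order of factors immaterial, so that `a` may be odd. -/
theorem sharp_commutator {a b : Fin 4 → Fin 4 → Density m} (ha : ∀ u v, a u v = -a v u)
    (hb : ∀ u v, b u v = -b v u) (hab : ∀ u v w x, b u v * a w x = a w x * b u v) (u v : Fin 4) :
    sharp (fun u v => ∑ w, (a u w * b w v - b u w * a w v)) u v =
      ∑ w, (a u w * sharp b w v - sharp b u w * a w v) := by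
  have hN : ∀ u v, ∑ w, (a u w * b w v - b u w * a w v) = -∑ w, (a v w * b w u - b v w * a w u) := by
    intro u v
    rw [← Finset.sum_neg_distrib]
    refine Finset.sum_congr rfl fun w _ => ?_
    rw [hab, hab, hb w v, ha u w, ha w v, hb u w]
    simp
  have hsb : ∀ u v w x, sharp b u v * a w x = a w x * sharp b u v := fun u v w x => by
    simp only [sharp, smul_mul_assoc, mul_smul_comm, Finset.sum_mul, Finset.mul_sum, hab]
  have hN' : ∀ u v, ∑ w, (a u w * sharp b w v - sharp b u w * a w v) =
      -∑ w, (a v w * sharp b w u - sharp b v w * a w u) := by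
    intro u v
    rw [← Finset.sum_neg_distrib]
    refine Finset.sum_congr rfl fun w _ => ?_
    rw [hsb, hsb, sharp_antisymm b w v, ha u w, ha w v, sharp_antisymm b u w]
    simp
  have h0 : ∀ {x : Fin 4 → Fin 4 → Density m}, (∀ u v, x u v = -x v u) → ∀ u, x u u = 0 :=
    fun h u => eq_zero_of_eq_neg (h u u)
  have e01 : sharp b 0 1 = b 2 3 := sharp_apply hb (by decide)
  have e02 : sharp b 0 2 = -b 1 3 := by rw [← hb 3 1]; exact sharp_apply hb (by decide)
  have e03 : sharp b 0 3 = b 1 2 := sharp_apply hb (by decide)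
  have e12 : sharp b 1 2 = b 0 3 := sharp_apply hb (by decide)
  have e13 : sharp b 1 3 = -b 0 2 := by rw [← hb 2 0]; exact sharp_apply hb (by decide)
  have e23 : sharp b 2 3 = b 0 1 := sharp_apply hb (by decide)
  -- Both sides are antisymmetric, so the six entries above the diagonal suffice; each is written
  -- out with the dual entries of `b` replaced by entries of `b`.
  have main : ∀ I J K L : Fin 4, leviInt ![I, J, K, L] = 1 → I < J →
      ∑ w, (a K w * b w L - b K w * a w L) = ∑ w, (a I w * sharp b w J - sharp b I w * a w J) := by
    intro I J K L h hIJ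
    fin_cases I <;> fin_cases J <;> first | (exact absurd hIJ (by decide)) | skip
    all_goals
      fin_cases K <;> fin_cases L <;> first | (exact absurd h (by decide)) | skip
    all_goals
      simp only [Fin.sum_univ_four, hsb, hab, Fin.zero_eta, Fin.mk_one, Fin.reduceFinMk,
        sharp_antisymm b 1 0, sharp_antisymm b 2 0, sharp_antisymm b 2 1,
        sharp_antisymm b 3 1, sharp_antisymm b 3 2, e01, e02, e03, e12, e13, e23,
        h0 (sharp_antisymm b), h0 ha, h0 hb, ha 1 0, ha 2 0, ha 3 0, ha 2 1, ha 3 1, ha 3 2,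
        hb 1 0, hb 2 0, hb 3 0, hb 2 1, hb 3 1, hb 3 2, mul_neg, neg_mul, mul_zero, zero_mul]
      abel
  have hlt : ∀ {u v : Fin 4}, u < v → sharp (fun u v => ∑ w, (a u w * b w v - b u w * a w v)) u v =
      ∑ w, (a u w * sharp b w v - sharp b u w * a w v) := by
    intro u v huv
    have key : ∀ I J : Fin 4, I < J → ∃ K L, leviInt ![I, J, K, L] = 1 := by decide +kernel
    obtain ⟨K, L, h⟩ := key u v huv
    rw [sharp_apply hN h]
    exact main u v K L h huv
  rcases lt_trichotomy u v with h | h | h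
  · exact hlt h
  · subst h
    rw [h0 (sharp_antisymm _), h0 hN']
  · rw [sharp_antisymm, hN', hlt h]

/-! ### The BRST operator -/

/-- The Hamiltonian vector field `Q_HT` of the action. -/
def qHT : Density m →ₗ[ℂ] Density m := ham (isPar_action k)

theorem qClosed_iff (F : Density m) : QClosed k F ↔ locInt (qHT k F) = 0 := by
  rw [QClosed, locInt_bv (isPar_action k)]; rfl

theorem qHT_mul (F G : Density m) : qHT k (F * G) = qHT k F * G + invol F * qHT k G :=
  evo_mul (isPar_hamChar (isPar_action k)) F G

theorem qHT_coef (f : Entire) : qHT k (coef f) = 0 :=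
  evo_coef (isPar_hamChar (isPar_action k)) f

theorem qHT_dz (F : Density m) : qHT k (dz F) = dz (qHT k F) :=
  evo_dz (isPar_hamChar (isPar_action k)) F

theorem qHT_fld (φ : Superfield m) : qHT k (fld φ) = varDer φ.conj (action k) := by
  have h := evo_fld (isPar_hamChar (isPar_action k)) φ
  rw [hamChar, koszul_false_left, one_smul] at h
  exact h

theorem qHT_Z (c : Fin m) (I u : Fin 4) : qHT k (Z c I u) = covDpr ZF c I u :=
  (qHT_fld k _).trans (varDer_Psi_action k c I u)

theorem qHT_Psi (c : Fin m) (I u : Fin 4) :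
    qHT k (Psi c I u) = covDpr PsiF c I u + dSuper k c I u :=
  (qHT_fld k _).trans (varDer_Z_action k c I u)

/-- The matrix `K (𝚿 ∧ 𝐙)` of densities with values in `𝔰𝔬(4)`. -/
def moment (c : Fin m) : Fin 4 → Fin 4 → Density m :=
  sharp fun u v => ∑ I, (Psi c I u * Z c I v - Psi c I v * Z c I u)

theorem dActionA_antisymm (c : Fin m) (u v : Fin 4) : dActionA k c u v = -dActionA k c v u := by
  have h : ∀ u v, ∑ w, (gaugeA c u w * gaugeB c w v - gaugeB c u w * gaugeA c w v) =
      -∑ w, (gaugeA c v w * gaugeB c w u - gaugeB c v w * gaugeA c w u) := by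
    intro u v
    rw [← Finset.sum_neg_distrib]
    refine Finset.sum_congr rfl fun w _ => ?_
    rw [(isPar_gaugeB c u w).even_comm, (isPar_gaugeB c v w).even_comm, gaugeB_antisymm c w v,
      gaugeA_antisymm c u w, gaugeA_antisymm c w v, gaugeB_antisymm c u w]
    simp
  have h2 : ∀ u v, ∑ I, (Psi c I u * Z c I v - Psi c I v * Z c I u) =
      -∑ I, (Psi c I v * Z c I u - Psi c I u * Z c I v) := fun u v => by
    rw [← Finset.sum_neg_distrib]
    exact Finset.sum_congr rfl fun I _ => by abel
  rw [dActionA, dActionA, h u v, h2 u v, sharp_antisymm _ u v, gaugeB_antisymm c u v, map_neg]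
  module

theorem qHT_gaugeB (c : Fin m) (u v : Fin 4) : qHT k (gaugeB c u v) = dActionA k c u v := by
  rw [gaugeB, map_soMatrix, ← soMatrix_of_antisymm (dActionA_antisymm k c) u v]
  refine congrArg (fun X => soMatrix X u v) (funext fun p => ?_)
  rw [qHT_fld]
  exact varDer_A_action k c p

/-- Since the duality is an involution, the Chern–Simons term contributes `∂𝐀` itself: apart from
the moment map, `𝐁` varies as a connection for `∂` under gauge transformations. -/
theorem qHT_sharpB (c : Fin m) (u v : Fin 4) : qHT k (sharpB c u v) =
    dpr (sharpB c u v) + ∑ w, (gaugeA c u w * sharpB c w v - sharpB c u w * gaugeA c w v)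
      + (k c / (2 * Real.pi) : ℂ) • dz (gaugeA c u v) - moment c u v := by
  have h : qHT k (sharpB c u v) = sharp (dActionA k c) u v := by
    refine (map_sharp _ _ u v).trans ?_
    simp only [qHT_gaugeB]
  have h1 : dpr (sharpB c u v) = sharp (fun u v => dpr (gaugeB c u v)) u v := map_sharp _ _ u v
  have h2 : sharp (sharp fun w x => dz (gaugeA c w x)) u v = dz (gaugeA c u v) :=
    sharp_sharp (fun u v => by rw [gaugeA_antisymm, map_neg]) u v
  have h3 := sharp_commutator (gaugeA_antisymm c) (gaugeB_antisymm c)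
    (fun u v w x => (isPar_gaugeB c u v).even_comm (gaugeA c w x)) u v
  rw [h, h1, ← h2]
  refine Eq.trans ?_ (congrArg (fun x => sharp (fun u v => dpr (gaugeB c u v)) u v + x +
    (k c / (2 * Real.pi) : ℂ) • sharp (sharp fun w x => dz (gaugeA c w x)) u v - moment c u v) h3)
  rw [moment, ← sharp_smul, ← sharp_add, ← sharp_add, ← sharp_sub]
  rfl

end BLG

/-! ### BRST variation of gauge invariant bilinears -/

namespace BLG

open Density

variable {m : ℕ} (k : Fin m → ℂ)

/-- The action of the moment map on a family. -/
def momentAct (X : Fam m) : Fam m := fun c I u =>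
  (2 * Real.pi / k c : ℂ) • ∑ v, moment c u v * X c I v

variable {k}

/-- The variation of the connection in `∂_𝐁` cancels `(∂𝐀) X`, so `∂_𝐁 X` is covariant when `X` is,
up to the error `N` of `X` and the moment map in the variation of `𝐁`. -/
theorem qHT_covD (hk : ∀ c, k c ≠ 0) {X N : Fam m}
    (hQ : ∀ c I u, qHT k (X c I u) = covDpr X c I u + N c I u) (c : Fin m) (I u : Fin 4) :
    qHT k (covD k X c I u) =
      covDpr (covD k X) c I u + (covD k N + momentAct k X) c I u := by
  have hpi := Complex.ofReal_ne_zero.mpr Real.pi_ne_zero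
  have hkc := hk c
  -- The coupling in `∂_𝐁` is inverse to the coefficient of `∂𝐀` in the variation of `𝐁`; this is
  -- where the level has to be nonzero.
  have hh : (2 * Real.pi / k c : ℂ) * (k c / (2 * Real.pi)) = 1 := by field_simp
  have e1 : ∑ v, ∑ w, gaugeA c u w * sharpB c w v * X c I v =
      ∑ v, ∑ w, gaugeA c u v * (sharpB c v w * X c I w) := by
    rw [Finset.sum_comm]
    simp only [mul_assoc]
  have e2 : ∑ v, ∑ w, sharpB c u w * gaugeA c w v * X c I v =
      ∑ v, ∑ w, sharpB c u v * (gaugeA c v w * X c I w) := by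
    rw [Finset.sum_comm]
    simp only [mul_assoc]
  have e3 : ∑ v, (k c / (2 * Real.pi) : ℂ) • (dz (gaugeA c u v) * X c I v) =
      (k c / (2 * Real.pi) : ℂ) • ∑ v, dz (gaugeA c u v) * X c I v := Finset.smul_sum.symm
  have hs : ∀ v, invol (sharpB c u v) = sharpB c u v := fun v => by
    simpa using (isPar_sharpB c u v).invol
  have hs' : ∀ v F, dpr (sharpB c u v * F) = dpr (sharpB c u v) * F + sharpB c u v * dpr F :=
    fun v F => by rw [dpr_mul, hs]
  simp only [covD, covB, covDpr, momentAct, Pi.add_apply, map_sub, map_smul, map_sum, map_add,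
    qHT_dz, qHT_mul, hQ, qHT_sharpB, hs, hs', dz_mul, dpr_dz, add_mul, sub_mul, mul_add, mul_sub,
    Finset.sum_add_distrib, Finset.sum_sub_distrib, smul_mul_assoc, mul_smul_comm, Finset.sum_mul,
    Finset.mul_sum, e1, e2, e3]
  have e4 : ∑ v, (2 * Real.pi / k c : ℂ) • ∑ w, gaugeA c u v * (sharpB c v w * X c I w) =
      (2 * Real.pi / k c : ℂ) • ∑ v, ∑ w, gaugeA c u v * (sharpB c v w * X c I w) :=
    Finset.smul_sum.symm
  simp only [e4, smul_sub, smul_add, smul_smul, hh, one_smul]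
  abel

/-- The covariant parts assemble to `d'` of a gauge invariant density by `dpr_bil`; only the errors
survive integration. -/
theorem qHT_bil {p : Bool} {X Y NX NY : Fam m} (hX : FamPar p X)
    (hQX : ∀ c I u, qHT k (X c I u) = covDpr X c I u + NX c I u)
    (hQY : ∀ c I u, qHT k (Y c I u) = covDpr Y c I u + NY c I u) (M : EMat) :
    qHT k (bil M X Y) = dpr (bil M X Y) + bil M NX Y + koszul p true • bil M X NY := by
  have h : qHT k (bil M X Y) = bil M (covDpr X + NX) Y
      + koszul p true • bil M X (covDpr Y + NY) := by
    rw [← bil_smul_right]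
    simp only [bil, map_sum, ← Finset.sum_add_distrib]
    refine Finset.sum_congr rfl fun c _ => Finset.sum_congr rfl fun I _ =>
      Finset.sum_congr rfl fun J _ => Finset.sum_congr rfl fun u _ => ?_
    rw [qHT_mul, qHT_coef, zero_mul, zero_add, (isPar_coef _).invol, koszul_false_left, one_smul,
      qHT_mul, hQX, hQY, (hX c I u).invol, ← mul_add]
    simp only [Pi.add_apply, Pi.smul_apply, smul_mul_assoc, mul_smul_comm]
  rw [h, dpr_bil M Y hX, bil_add_left, bil_add_right]
  module

theorem qHT_ZF (c : Fin m) (I u : Fin 4) :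
    qHT k (ZF c I u) = covDpr ZF c I u + (0 : Fam m) c I u :=
  (qHT_Z k c I u).trans (add_zero _).symm

theorem qHT_PsiF (c : Fin m) (I u : Fin 4) :
    qHT k (PsiF c I u) = covDpr PsiF c I u + dSuper k c I u := qHT_Psi k c I u

/-! ### Identities for the moment map and the superpotential -/

/-- The `𝔤𝔩(4)` currents `𝚿_{I u} 𝐙^I_v`. -/
def psiZ (c : Fin m) (u v : Fin 4) : Density m := ∑ I, Psi c I u * Z c I v

theorem isPar_psiZ (c : Fin m) (u v : Fin 4) : IsPar true (psiZ c u v) :=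
  IsPar.sum fun I _ => (isPar_Psi c I u).mul (isPar_Z c I v)

theorem moment_eq (c : Fin m) (u v : Fin 4) :
    moment c u v = ∑ w, ∑ x, levi ![u, v, w, x] • psiZ c w x := by
  have h : ∀ w x, ∑ I, (Psi c I w * Z c I x - Psi c I x * Z c I w) = psiZ c w x - psiZ c x w :=
    fun w x => by rw [Finset.sum_sub_distrib]; rfl
  have h2 : ∑ w, ∑ x, levi ![u, v, w, x] • psiZ c x w =
      -∑ w, ∑ x, levi ![u, v, w, x] • psiZ c w x := by
    rw [Finset.sum_comm]
    simp only [← Finset.sum_neg_distrib]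
    exact Finset.sum_congr rfl fun w _ => Finset.sum_congr rfl fun x _ => by
      rw [levi_swap23, neg_smul]
  simp only [moment, sharp, h, smul_sub, Finset.sum_sub_distrib, h2]
  module

theorem isPar_moment (c : Fin m) (u v : Fin 4) : IsPar true (moment c u v) := by
  rw [moment_eq]
  exact IsPar.sum fun w _ => IsPar.sum fun x _ => (isPar_psiZ c w x).smul _

/-- The odd currents `psiZ` are paired with themselves by a form that is symmetric under exchange of
the two index pairs, so the sum equals its negative. -/
theorem sum_psiZ_moment (c : Fin m) : ∑ u, ∑ v, psiZ c u v * moment c u v = 0 := by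
  have h : ∑ u, ∑ v, psiZ c u v * moment c u v =
      ∑ u, ∑ v, ∑ w, ∑ x, levi ![u, v, w, x] • (psiZ c u v * psiZ c w x) := by
    simp only [moment_eq, Finset.mul_sum, mul_smul_comm]
  rw [h]
  refine eq_zero_of_eq_neg ?_
  nth_rewrite 1 [sum_comm_pairs]
  simp only [← Finset.sum_neg_distrib]
  refine Finset.sum_congr rfl fun u _ => Finset.sum_congr rfl fun v _ =>
    Finset.sum_congr rfl fun w _ => Finset.sum_congr rfl fun x _ => ?_
  rw [levi_rotate, (isPar_psiZ c w x).comm (isPar_psiZ c u v), koszul_true_true, neg_one_smul,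
    smul_neg]

theorem bil_scal (V : Entire) (X Y : Fam m) :
    bil (scal V) X Y = coef V * ∑ c : Fin m, ∑ I : Fin 4, ∑ u : Fin 4, X c I u * Y c I u :=
  bil_scalar V X Y

theorem bil_scal_Psi_momentAct (V : Entire) : bil (scal V) PsiF (momentAct k ZF) = 0 := by
  rw [bil_scal]
  refine mul_eq_zero_of_right _ (Finset.sum_eq_zero fun c _ => ?_)
  have h : ∑ I, ∑ u, PsiF c I u * momentAct k ZF c I u =
      (2 * Real.pi / k c : ℂ) • ∑ u, ∑ v, psiZ c u v * moment c u v := by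
    simp only [psiZ, momentAct, mul_smul_comm, Finset.mul_sum, Finset.sum_mul, Finset.smul_sum]
    rw [Finset.sum_comm]
    refine Finset.sum_congr rfl fun u _ => ?_
    rw [Finset.sum_comm]
    refine Finset.sum_congr rfl fun v _ => Finset.sum_congr rfl fun I _ => ?_
    rw [mul_assoc, (isPar_Z c I v).even_comm]
    rfl
  rw [h, sum_psiZ_moment, smul_zero]

/-- Two signs compensate, from reordering the odd factors and from antisymmetry of the moment map,
so this is the same contraction as in `bil_scal_Psi_momentAct`. -/
theorem bil_scal_Z_momentAct (V : Entire) : bil (scal V) ZF (momentAct k PsiF) = 0 := by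
  rw [bil_scal]
  refine mul_eq_zero_of_right _ (Finset.sum_eq_zero fun c _ => ?_)
  have h : ∑ I, ∑ u, ZF c I u * momentAct k PsiF c I u =
      (2 * Real.pi / k c : ℂ) • ∑ u, ∑ v, psiZ c u v * moment c u v := by
    simp only [psiZ, momentAct, mul_smul_comm, Finset.mul_sum, Finset.sum_mul, Finset.smul_sum]
    rw [Finset.sum_comm_cycle]
    refine Finset.sum_congr rfl fun v _ => ?_
    rw [Finset.sum_comm]
    refine Finset.sum_congr rfl fun u _ => Finset.sum_congr rfl fun I _ => ?_
    show _ • (Z c I u * (moment c u v * Psi c I v)) = _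
    rw [(isPar_Z c I u).even_comm, (isPar_moment c u v).comm (isPar_Psi c I v), koszul_true_true,
      neg_one_smul, moment, sharp_antisymm _ u v, mul_neg, neg_neg, mul_assoc, mul_assoc,
      (isPar_Z c I u).even_comm]
  rw [h, sum_psiZ_moment, smul_zero]

/-- Invariance of the superpotential under `𝔰𝔩(4)`: only the trace of `U` survives the contraction.
-/
theorem bil_dSuper_Z {U : EMat} (hU : U.trace = 0) : bil U (dSuper k) ZF = 0 := by
  rw [bil_eq]
  refine Finset.sum_eq_zero fun c _ => ?_
  have h : ∀ I J, ∑ u, dSuper k c I u * ZF c J u = if I = J then superpotential (k c) c else 0 :=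
    sum_dSuper_Z_flavour k c
  simp only [h, mul_ite, mul_zero, Finset.sum_ite_eq, Finset.mem_univ, if_true]
  rw [← Finset.sum_mul, ← coef_sum]
  have : ∑ I, U I I = 0 := hU
  rw [this, coef_zero, zero_mul]

theorem dual_dual {G : EMat} (hG : G.transpose = -G) : dual (dual G) = G := by
  have e : ∀ i j, G j i = -G i j := fun i j => congrFun (congrFun hG i) j
  rw [dual_eq dual_transpose, dual_eq hG]
  conv_rhs => rw [eq_of_antisymm hG]
  refine Matrix.ext fun i j => ?_
  fin_cases i <;> fin_cases j <;> simp

/-- The moment map supplies one `𝐙` and a gauge Levi-Civita symbol; with the two outer `𝐙` it forms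
a cubic contraction to which `sum_levi_Z` applies. -/
theorem sum_Z_mul_momentAct (c : Fin m) (K L : Fin 4) :
    ∑ u, ZF c K u * momentAct k ZF c L u =
      ∑ J, ∑ T, levi ![T, K, L, J] • ∑ w, dSuper k c T w * PsiF c J w := by
  have h1 : ∀ u v w x J, Z c K u * (Psi c J w * Z c J x * Z c L v) =
      Z c K u * Z c L v * Z c J x * Psi c J w := fun u v w x J => by
    rw [mul_assoc, (isPar_Psi c J w).comm ((isPar_Z c J x).mul (isPar_Z c L v)),
      Bool.xor_false, koszul_false_right, one_smul, (isPar_Z c J x).even_comm]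
    simp only [mul_assoc]
  have h2 : ∑ u, ZF c K u * momentAct k ZF c L u =
      ∑ u, ∑ v, ∑ w, ∑ x, ∑ J, (2 * Real.pi / k c * levi ![u, v, w, x] : ℂ) •
        (Z c K u * Z c L v * Z c J x * Psi c J w) := by
    simp only [momentAct, moment_eq, psiZ, ZF, Finset.mul_sum, Finset.sum_mul, Finset.smul_sum,
      mul_smul_comm, smul_mul_assoc, smul_smul, h1]
  have h3 : ∑ J, ∑ T, levi ![T, K, L, J] • ∑ w, dSuper k c T w * PsiF c J w =
      ∑ w, ∑ J, ∑ u, ∑ v, ∑ x, (2 * Real.pi / k c * levi ![u, v, w, x] : ℂ) •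
        (Z c K u * Z c L v * Z c J x * Psi c J w) := by
    rw [Finset.sum_comm]
    have e : ∀ J, ∑ T, levi ![T, K, L, J] • ∑ w, dSuper k c T w * PsiF c J w =
        ∑ w, (∑ T, levi ![T, K, L, J] • dSuper k c T w) * Psi c J w := fun J => by
      simp only [Finset.sum_mul, Finset.smul_sum, smul_mul_assoc]
      rw [Finset.sum_comm]
      rfl
    rw [Finset.sum_comm]
    simp only [e]
    rw [Finset.sum_comm]
    refine Finset.sum_congr rfl fun w _ => Finset.sum_congr rfl fun J _ => ?_
    rw [← sum_levi_Z]
    simp only [Finset.sum_mul, Finset.smul_sum, smul_mul_assoc, smul_smul]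
    refine Finset.sum_congr rfl fun u _ => Finset.sum_congr rfl fun v _ =>
      Finset.sum_congr rfl fun x _ => ?_
    rw [levi_swap01, ← levi_swap12, levi_swap12 u w v x, levi_swap01 w u v x, neg_neg]
  rw [h2, h3, sum_comm_pairs]
  refine Finset.sum_congr rfl fun w _ => ?_
  rw [sum_comm_pairs, Finset.sum_comm]
  exact Finset.sum_congr rfl fun J _ => Finset.sum_comm_cycle

/-- The flavour symbol produced by `sum_Z_mul_momentAct` dualises `*Γ` back to `Γ`; the 2 undoes the
`½` in `dual`. This identity fixes the relative coefficient of the two terms of `𝚯`. -/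
theorem bil_dual_Z_momentAct {G : EMat} (hG : G.transpose = -G) :
    bil (dual G) ZF (momentAct k ZF) = (2 : ℂ) • bil G (dSuper k) PsiF := by
  conv_rhs => rw [← dual_dual hG]
  rw [bil_eq, bil_eq, Finset.smul_sum]
  refine Finset.sum_congr rfl fun c _ => ?_
  have e : ∀ T J, (2 : ℂ) • (coef (dual (dual G) T J) * ∑ u, dSuper k c T u * PsiF c J u) =
      ∑ K, ∑ L, coef (dual G K L) *
        levi ![T, K, L, J] • ∑ u, dSuper k c T u * PsiF c J u := fun T J => by
    rw [dual, coef_smul, coef_sum, smul_mul_assoc, smul_smul, Finset.sum_mul]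
    norm_num only [one_smul]
    refine Finset.sum_congr rfl fun K _ => ?_
    rw [coef_sum, Finset.sum_mul]
    refine Finset.sum_congr rfl fun L _ => ?_
    rw [coef_smul, smul_mul_assoc, mul_smul_comm, levi_swap12 K T L J, levi_swap01 T K L J,
      neg_neg]
  have e' : (2 : ℂ) • ∑ T, ∑ J, coef (dual (dual G) T J) * ∑ u, dSuper k c T u * PsiF c J u =
      ∑ T, ∑ J, ∑ K, ∑ L, coef (dual G K L) *
        levi ![T, K, L, J] • ∑ u, dSuper k c T u * PsiF c J u := by
    rw [Finset.smul_sum]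
    refine Finset.sum_congr rfl fun T _ => ?_
    rw [Finset.smul_sum]
    exact Finset.sum_congr rfl fun J _ => e T J
  refine Eq.trans ?_ e'.symm
  rw [sum_comm_pairs]
  refine Finset.sum_congr rfl fun K _ => Finset.sum_congr rfl fun L _ => ?_
  rw [sum_Z_mul_momentAct, Finset.sum_comm]
  simp only [Finset.mul_sum]

/-- Gauge invariance of the superpotential: contracting with its gradient leaves the diagonal of an
antisymmetric matrix. -/
theorem bil_gauge_dSuper (V : Entire) (X : Fin m → Fin 4 → Fin 4 → Density m)
    (hX : ∀ c u v, X c u v = -X c v u) :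
    bil (scal V) (fun c I u => ∑ v, X c u v * Z c I v) (dSuper k) = 0 := by
  rw [bil_scal]
  refine mul_eq_zero_of_right _ (Finset.sum_eq_zero fun c _ => ?_)
  have h : ∑ I, ∑ u, (∑ v, X c u v * Z c I v) * dSuper k c I u =
      ∑ u, ∑ v, X c u v * ∑ I, dSuper k c I u * Z c I v := by
    simp only [Finset.sum_mul, Finset.mul_sum]
    rw [Finset.sum_comm]
    refine Finset.sum_congr rfl fun u _ => ?_
    rw [Finset.sum_comm]
    refine Finset.sum_congr rfl fun v _ => Finset.sum_congr rfl fun I _ => ?_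
    rw [mul_assoc, (isPar_Z c I v).even_comm]
  rw [h]
  simp only [sum_dSuper_Z_gauge, mul_ite, mul_zero, Finset.sum_ite_eq, Finset.mem_univ, if_true]
  exact Finset.sum_eq_zero fun u _ => by rw [eq_zero_of_eq_neg (hX c u u), zero_mul]

end BLG

namespace BLG

open Density

variable {m : ℕ} {k : Fin m → ℂ}

/-! ### Closedness of the currents -/

theorem covD_zero : covD k 0 = (0 : Fam m) :=
  funext fun c => funext fun I => funext fun u => by simp [covD, covB]

theorem qHT_DZ (hk : ∀ c, k c ≠ 0) (c : Fin m) (I u : Fin 4) :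
    qHT k (covD k ZF c I u) = covDpr (covD k ZF) c I u + momentAct k ZF c I u := by
  rw [qHT_covD hk qHT_ZF, covD_zero, zero_add]

theorem qHT_DPsi (hk : ∀ c, k c ≠ 0) (c : Fin m) (I u : Fin 4) :
    qHT k (covD k PsiF c I u) = covDpr (covD k PsiF) c I u +
      (covD k (dSuper k) + momentAct k PsiF) c I u := qHT_covD hk qHT_PsiF c I u

theorem qClosed_currentXi (S : EMat) : QClosed k (currentXi S) := by
  rw [qClosed_iff, currentXi_eq, map_smul, qHT_bil famPar_ZF qHT_ZF qHT_ZF, bil_zero_left,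
    bil_zero_right]
  simp

theorem qClosed_currentL {U : EMat} (hU : U.trace = 0) : QClosed k (currentL U) := by
  rw [qClosed_iff, currentL_eq, qHT_bil famPar_PsiF qHT_PsiF qHT_ZF, bil_zero_right,
    bil_dSuper_Z hU]
  simp

/-- The variation of `½ 𝚿 Γ 𝚿` leaves `Γ` contracted with the gradient of `𝐖` and `𝚿`; the second
term of `𝚯` leaves minus the same through the moment map. -/
theorem qClosed_currentTheta (hk : ∀ c, k c ≠ 0) {G : EMat} (hG : G.transpose = -G) :
    QClosed k (currentTheta k G) := by
  have h : bil G PsiF (dSuper k) = -bil G (dSuper k) PsiF := by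
    rw [bil_swap G famPar_PsiF (isPar_dSuper k), hG, bil_neg]
    simp
  rw [qClosed_iff, currentTheta_eq, map_sub, map_smul, map_smul,
    qHT_bil famPar_PsiF qHT_PsiF qHT_PsiF, qHT_bil famPar_ZF qHT_ZF (qHT_DZ hk), bil_zero_left,
    bil_dual_Z_momentAct hG, h]
  simp only [map_sub, map_add, map_smul, locInt_dpr, map_neg, map_zero, koszul_true_true,
    koszul_false_left]
  module

/-- The superpotential has weight one, so its integral is invariant under `𝐓_V`; the left side and
the `¼`-term are the two parts of the variation of `𝐙`. -/
theorem locInt_bil_dZ_dSuper (V : Entire) :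
    locInt (bil (scal V) (fun c I u => dz (Z c I u)) (dSuper k)) =
      -(1 / 4 : ℂ) • locInt (bil (scal (Entire.der V)) ZF (dSuper k)) := by
  set W : Density m := ∑ c, superpotential (k c) c with hW
  have hwt : HasWeight 1 W := HasWeight.sum fun c _ => hasWeight_superpotential (k c) c
  have hne : ∀ φ : Superfield m, (∀ c I u, Superfield.Z c I u ≠ φ) → varDer φ W = 0 := fun φ h => by
    rw [hW, varDer_eq_eulerLin, map_sum, LinearMap.sum_apply]
    refine Finset.sum_eq_zero fun c _ => ?_
    rw [← varDer_eq_eulerLin, varDer_superpotential_of_ne k c (h c)]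
  have hZ : ∀ c I u, varDer (.Z c I u) W = dSuper k c I u := fun c I u => by
    rw [hW, varDer_eq_eulerLin, map_sum, LinearMap.sum_apply]
    simp [← varDer_eq_eulerLin, varDer_Z_superpotential]
  have h0 : locInt (bv (currentT V) W) = 0 := by
    rw [locInt_bv (isPar_currentT V)]
    show locInt (lieDer V W) = 0
    rw [hwt V, one_smul, ← dz_coef, add_comm, ← dz_mul, locInt_dz]
  have h1 : bv (currentT V) W = bil (scal V) (fun c I u => dz (Z c I u)) (dSuper k) +
      (1 / 4 : ℂ) • bil (scal (Entire.der V)) ZF (dSuper k) := by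
    rw [bil_scal, bil_scal, bv]
    have hA : ∀ c p, varDer (.A c p) W = 0 := fun _ _ => hne _ fun _ _ _ e => by cases e
    have hB : ∀ c p, varDer (.B c p) W = 0 := fun _ _ => hne _ fun _ _ _ e => by cases e
    have hPsi : ∀ c I u, varDer (.Psi c I u) W = 0 := fun _ _ _ => hne _ fun _ _ _ e => by cases e
    simp only [hA, hB, hPsi, hZ, mul_zero, add_zero, Finset.sum_const_zero, zero_add,
      Finset.mul_sum, Finset.smul_sum, ← Finset.sum_add_distrib, varDer_Psi_currentT]
    refine Finset.sum_congr rfl fun c _ => Finset.sum_congr rfl fun I _ =>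
      Finset.sum_congr rfl fun u _ => ?_
    rw [dz_mul, dz_coef, ← coef_comm, ← coef_comm]
    simp only [ZF, add_mul, smul_add, smul_mul_assoc, mul_assoc]
    module
  rw [h1, map_add, map_smul] at h0
  rw [eq_neg_of_add_eq_zero_left h0, neg_smul]

theorem qClosed_currentTHat (hk : ∀ c, k c ≠ 0) (V : Entire) : QClosed k (currentTHat k V) := by
  have h1 : bil (scal V) ZF (covD k (dSuper k)) = bil (scal V) (covD k (dSuper k)) ZF := by
    rw [bil_swap _ famPar_ZF ((isPar_dSuper k).covD k), scal_transpose]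
    simp
  have h2 : bil (scal V) (dSuper k) (covD k ZF) = bil (scal V) (covD k ZF) (dSuper k) := by
    rw [bil_swap _ (isPar_dSuper k) (famPar_DZ k), scal_transpose]
    simp
  have h3 : bil (scal (Entire.der V)) (dSuper k) ZF = bil (scal (Entire.der V)) ZF (dSuper k) := by
    rw [bil_swap _ (isPar_dSuper k) famPar_ZF, scal_transpose]
    simp
  -- The connection drops out of `∂_𝐁` against the gradient, by gauge invariance of `𝐖`.
  have h4 : bil (scal V) (covD k ZF) (dSuper k) =
      bil (scal V) (fun c I u => dz (Z c I u)) (dSuper k) := by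
    have e : covD k ZF = (fun c I u => dz (Z c I u)) +
        (fun c I u => ∑ v, (-(2 * Real.pi / k c : ℂ) • sharpB c u v) * Z c I v : Fam m) :=
      funext fun c => funext fun I => funext fun u => by
        simp [covD, covB, sub_eq_add_neg, Finset.smul_sum, ZF]
    rw [e, bil_add_left, bil_gauge_dSuper, add_zero]
    exact fun c u v => by rw [sharpB_antisymm c u v]; module
  have h5 := locInt_bil_covD k (isPar_dSuper k) (scal V) ZF
  rw [qClosed_iff, currentTHat_eq]
  change locInt (qHT k ((3 / 4 : ℂ) • bil (scal V) PsiF (covD k ZF) -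
    (1 / 4 : ℂ) • bil (scal V) ZF (covD k PsiF))) = 0
  rw [map_sub, map_smul, map_smul, qHT_bil famPar_PsiF qHT_PsiF (qHT_DZ hk),
    qHT_bil famPar_ZF qHT_ZF (qHT_DPsi hk), bil_zero_left, bil_add_right,
    bil_scal_Psi_momentAct, bil_scal_Z_momentAct, h1, h2, h4]
  simp only [map_sub, map_add, map_smul, locInt_dpr, koszul_true_true, smul_zero,
    koszul_false_left, add_zero, zero_add, h5, h2, h4, der_scal, h3, locInt_bil_dZ_dSuper]
  module

end BLG

namespace BLG

open Density

variable {m : ℕ} {k : Fin m → ℂ}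

/-! ### The two stress tensors agree up to exact terms -/

theorem sum_sharp_mul (X Y : Fin 4 → Fin 4 → Density m) :
    ∑ u, ∑ v, sharp X u v * Y u v = ∑ u, ∑ v, X u v * sharp Y u v := by
  have h : ∑ u, ∑ v, sharp X u v * Y u v =
      ∑ u, ∑ v, ∑ w, ∑ x, ((1 / 2 : ℂ) * levi ![u, v, w, x]) • (X w x * Y u v) := by
    simp only [sharp, smul_mul_assoc, Finset.sum_mul, Finset.smul_sum, smul_smul]
  rw [h, sum_comm_pairs]
  simp only [sharp, mul_smul_comm, Finset.mul_sum, Finset.smul_sum, smul_smul, levi_rotate]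

/-- The Casimir `𝐁 · 𝐁`. -/
def sqB (c : Fin m) : Density m := ∑ u, ∑ v, sharpB c u v * gaugeB c u v

theorem sharpB_eq_sharp (c : Fin m) : (sharpB c : Fin 4 → Fin 4 → Density m) = sharp (gaugeB c) := rfl

theorem sum_sharpB_mul (c : Fin m) (Y : Fin 4 → Fin 4 → Density m) :
    ∑ u, ∑ v, sharpB c u v * Y u v = ∑ u, ∑ v, sharp Y u v * gaugeB c u v := by
  refine (sum_sharp_mul (gaugeB c) Y).trans ?_
  exact Finset.sum_congr rfl fun u _ => Finset.sum_congr rfl fun v _ => (isPar_gaugeB c u v).even_comm _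

theorem derivation_sqB (D : Density m →ₗ[ℂ] Density m)
    (hD : ∀ c u v F, D (sharpB c u v * F) = D (sharpB c u v) * F + sharpB c u v * D F) (c : Fin m) :
    D (sqB c) = (2 : ℂ) • ∑ u, ∑ v, D (sharpB c u v) * gaugeB c u v := by
  have h := sum_sharpB_mul c fun u v => D (gaugeB c u v)
  have e : ∀ u v, sharp (fun u v => D (gaugeB c u v)) u v = D (sharpB c u v) := fun u v =>
    (map_sharp D (gaugeB c) u v).symm
  simp only [e] at h
  simp only [sqB, map_sum, hD, Finset.sum_add_distrib, h]
  module

/-- Invariance of `𝐁·𝐁`. Self-adjointness of the duality and `sharp_commutator` move the commutator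
to the other factor, while antisymmetry of `𝐀` turns that expression into minus the original. -/
theorem sum_commutator_mul (c : Fin m) :
    ∑ u, ∑ v, (∑ w, (gaugeA c u w * sharpB c w v - sharpB c u w * gaugeA c w v)) * gaugeB c u v
      = 0 := by
  have hBA : ∀ u v w x, gaugeB c u v * gaugeA c w x = gaugeA c w x * gaugeB c u v :=
    fun u v w x => (isPar_gaugeB c u v).even_comm _
  have hC : ∀ u v F, sharpB c u v * F = F * sharpB c u v := fun u v F =>
    (isPar_sharpB c u v).even_comm F
  have e : ∀ u v, sharp (fun u v => ∑ w, (gaugeA c u w * gaugeB c w v - gaugeB c u w * gaugeA c w v))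
      u v = ∑ w, (gaugeA c u w * sharpB c w v - sharpB c u w * gaugeA c w v) :=
    sharp_commutator (gaugeA_antisymm c) (gaugeB_antisymm c) hBA
  have h := sum_sharpB_mul c fun u v =>
    ∑ w, (gaugeA c u w * gaugeB c w v - gaugeB c u w * gaugeA c w v)
  have h1 : ∑ u, ∑ v, sharpB c u v *
        ∑ w, (gaugeA c u w * gaugeB c w v - gaugeB c u w * gaugeA c w v) =
      ∑ u, ∑ v, ∑ w, gaugeA c u w * (gaugeB c w v * sharpB c u v)
        - ∑ u, ∑ v, ∑ w, gaugeA c w v * (gaugeB c u w * sharpB c u v) := by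
    simp only [← Finset.sum_sub_distrib]
    refine Finset.sum_congr rfl fun u _ => Finset.sum_congr rfl fun v _ => ?_
    rw [hC, Finset.sum_mul]
    exact Finset.sum_congr rfl fun w _ => by rw [sub_mul, hBA, mul_assoc, mul_assoc]
  have h2 : ∑ u, ∑ v, (∑ w, (gaugeA c u w * sharpB c w v - sharpB c u w * gaugeA c w v)) *
        gaugeB c u v =
      ∑ u, ∑ v, ∑ w, gaugeA c u w * (gaugeB c u v * sharpB c w v)
        - ∑ u, ∑ v, ∑ w, gaugeA c w v * (gaugeB c u v * sharpB c u w) := by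
    simp only [← Finset.sum_sub_distrib]
    refine Finset.sum_congr rfl fun u _ => Finset.sum_congr rfl fun v _ => ?_
    rw [Finset.sum_mul]
    exact Finset.sum_congr rfl fun w _ => by rw [sub_mul, mul_assoc, hC, hC u w, mul_assoc, hC]
  have h3 : ∑ u, ∑ v, ∑ w, gaugeA c u w * (gaugeB c u v * sharpB c w v) =
      -∑ u, ∑ v, ∑ w, gaugeA c u w * (gaugeB c w v * sharpB c u v) := by
    rw [Finset.sum_comm, Finset.sum_comm (f := fun u v => ∑ w, gaugeA c u w * _)]
    simp only [← Finset.sum_neg_distrib]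
    refine Finset.sum_congr rfl fun v _ => ?_
    rw [Finset.sum_comm]
    refine Finset.sum_congr rfl fun u _ => Finset.sum_congr rfl fun w _ => ?_
    rw [gaugeA_antisymm c w u, neg_mul]
  have h4 : ∑ u, ∑ v, ∑ w, gaugeA c w v * (gaugeB c u v * sharpB c u w) =
      -∑ u, ∑ v, ∑ w, gaugeA c w v * (gaugeB c u w * sharpB c u v) := by
    simp only [← Finset.sum_neg_distrib]
    refine Finset.sum_congr rfl fun u _ => ?_
    rw [Finset.sum_comm]
    refine Finset.sum_congr rfl fun v _ => Finset.sum_congr rfl fun w _ => ?_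
    rw [gaugeA_antisymm c v w, neg_mul]
  refine eq_zero_of_eq_neg ?_
  simp only [e] at h
  nth_rewrite 2 [← h]
  rw [h1, h2, h3, h4]
  abel

/-- The variation of `𝐁` contributes `∂𝐀` and the moment map. With the factor `π/2k` their
coefficients become those of `𝐁 ∂𝐀` and of the connection term of `𝐓̂`. -/
theorem qHT_sqB (hk : ∀ c, k c ≠ 0) (c : Fin m) :
    (Real.pi / (2 * k c) : ℂ) • qHT k (sqB c) =
      dpr ((Real.pi / (2 * k c) : ℂ) • sqB c) + ∑ p : GaugeIdx, fld (.B c p) * dz (fld (.A c p))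
      - (2 * Real.pi / k c : ℂ) • ∑ I, ∑ u, Psi c I u * ∑ v, sharpB c u v * Z c I v := by
  have hpi := Complex.ofReal_ne_zero.mpr Real.pi_ne_zero
  have hkc := hk c
  have h1 : qHT k (sqB c) = (2 : ℂ) • ∑ u, ∑ v, qHT k (sharpB c u v) * gaugeB c u v :=
    derivation_sqB (qHT k) (fun c u v F => by
      rw [qHT_mul, (isPar_sharpB c u v).invol, koszul_false_left, one_smul]) c
  have h2 : dpr (sqB c) = (2 : ℂ) • ∑ u, ∑ v, dpr (sharpB c u v) * gaugeB c u v :=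
    derivation_sqB dpr (fun c u v F => by
      rw [dpr_mul, (isPar_sharpB c u v).invol, koszul_false_left, one_smul]) c
  have h3 : ∑ p : GaugeIdx, fld (.B c p) * dz (fld (.A c p)) =
      (1 / 2 : ℂ) • ∑ u, ∑ v, dz (gaugeA c u v) * gaugeB c u v := by
    rw [← sum_gaugeIdx]
    · refine Finset.sum_congr rfl fun p _ => ?_
      rw [(isPar_fld (.B c p)).even_comm, fld_B_eq, gaugeA, soMatrix, dif_pos p.2]
    · intro u v
      rw [gaugeA_antisymm, gaugeB_antisymm, map_neg, neg_mul_neg]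
    · intro u
      rw [eq_zero_of_eq_neg (gaugeB_antisymm c u u), mul_zero]
  have h4 : ∑ u, ∑ v, moment c u v * gaugeB c u v =
      (2 : ℂ) • ∑ I, ∑ u, Psi c I u * ∑ v, sharpB c u v * Z c I v := by
    have e : ∀ X : Fin 4 → Fin 4 → Density m, ∑ u, ∑ v, X v u * sharpB c u v =
        -∑ u, ∑ v, X u v * sharpB c u v := fun X => by
      rw [Finset.sum_comm]
      simp only [← Finset.sum_neg_distrib]
      refine Finset.sum_congr rfl fun u _ => Finset.sum_congr rfl fun v _ => ?_
      rw [sharpB_antisymm c v u, mul_neg]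
    have e2 := e fun u v => ∑ I, Psi c I u * Z c I v
    refine (sum_sharp_mul _ (gaugeB c)).trans ?_
    rw [← sharpB_eq_sharp]
    simp only [Finset.sum_sub_distrib, sub_mul, e2]
    have e3 : ∑ u, ∑ v, (∑ I, Psi c I u * Z c I v) * sharpB c u v =
        ∑ I, ∑ u, Psi c I u * ∑ v, sharpB c u v * Z c I v := by
      simp only [Finset.sum_mul, Finset.mul_sum, mul_assoc, (isPar_Z c _ _).even_comm]
      rw [Finset.sum_comm_cycle]
    rw [e3]
    module
  obtain ⟨X, hX, h0⟩ : ∃ X : Fin 4 → Fin 4 → Density m, (∀ u v, qHT k (sharpB c u v) =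
      dpr (sharpB c u v) + X u v + (k c / (2 * Real.pi) : ℂ) • dz (gaugeA c u v) - moment c u v) ∧
      ∑ u, ∑ v, X u v * gaugeB c u v = 0 := ⟨_, qHT_sharpB k c, sum_commutator_mul c⟩
  rw [h1, map_smul, h2, h3]
  simp only [hX, add_mul, sub_mul, Finset.sum_add_distrib, Finset.sum_sub_distrib, h0, h4,
    smul_mul_assoc, ← Finset.smul_sum]
  match_scalars <;> field_simp

/-- Moving `𝐁` from `𝚿` to `𝐙` costs a sign, so the connection terms weighted `¾` and `¼` combine
into a single one. -/
theorem currentTHat_sub_currentT (V : Entire) :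
    currentTHat k V - currentT V = coef V * ∑ c, (∑ p : GaugeIdx, fld (.B c p) * dz (fld (.A c p))
      - (2 * Real.pi / k c : ℂ) • ∑ I, ∑ u, Psi c I u * ∑ v, sharpB c u v * Z c I v) := by
  rw [currentTHat, currentT, ← mul_sub, ← Finset.sum_sub_distrib]
  refine congrArg (HMul.hMul (coef V)) (Finset.sum_congr rfl fun c _ => ?_)
  have h : ∑ I, ∑ u, Z c I u * ∑ v, sharpB c u v * Psi c I v =
      -∑ I, ∑ u, Psi c I u * ∑ v, sharpB c u v * Z c I v := by
    simp only [← Finset.sum_neg_distrib, Finset.mul_sum]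
    refine Finset.sum_congr rfl fun I _ => ?_
    rw [Finset.sum_comm]
    refine Finset.sum_congr rfl fun u _ => Finset.sum_congr rfl fun v _ => ?_
    rw [(isPar_Z c I v).even_comm, sharpB_antisymm c v u, neg_mul, neg_mul,
      (isPar_sharpB c u v).even_comm, mul_assoc]
  have e : ∀ X Y : Fam m, ∀ I u, X c I u * covB k c (Y c I) u = X c I u * dz (Y c I u)
      - (2 * Real.pi / k c : ℂ) • (X c I u * ∑ v, sharpB c u v * Y c I v) := fun X Y I u => by
    rw [covB, mul_sub, mul_smul_comm]
  have e1 := e Psi Z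
  have e2 := e Z Psi
  simp only [e1, e2, smul_sub, Finset.sum_sub_distrib,
    smul_comm _ (2 * Real.pi / k c : ℂ), ← Finset.smul_sum, h]
  module

theorem qExact_currentTHat_sub_currentT (hk : ∀ c, k c ≠ 0) (V : Entire) :
    QExact k (currentTHat k V - currentT V) := by
  refine ⟨coef V * ∑ c, (Real.pi / (2 * k c) : ℂ) • sqB c, ?_⟩
  rw [locInt_bv (isPar_action k)]
  change _ = locInt (qHT k _)
  have h : dpr (coef V * ∑ c, (Real.pi / (2 * k c) : ℂ) • sqB c) =
      coef V * ∑ c : Fin m, dpr ((Real.pi / (2 * k c) : ℂ) • sqB c) := by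
    rw [(isPar_coef V).dpr_mul, dpr_coef, map_sum]; simp
  have h' : qHT k (coef V * ∑ c, (Real.pi / (2 * k c) : ℂ) • sqB c) =
      dpr (coef V * ∑ c, (Real.pi / (2 * k c) : ℂ) • sqB c) + (currentTHat k V - currentT V) := by
    rw [qHT_mul, qHT_coef, zero_mul, zero_add, (isPar_coef V).invol, koszul_false_left, one_smul,
      h, currentTHat_sub_currentT, ← mul_add, ← Finset.sum_add_distrib, map_sum]
    simp only [map_smul, qHT_sqB hk, add_sub_assoc]
  rw [h', map_add, locInt_dpr, zero_add]

end BLG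

namespace BLG

open Density

variable {m : ℕ} {k : Fin m → ℂ}

/-! ### Local functionals up to exact ones -/

/-- The `Q_HT`-exact local functionals. -/
def exactFunctionals (k : Fin m → ℂ) : Submodule ℂ (LocalFunctional m) :=
  LinearMap.range (locInt ∘ₗ qHT k)

theorem qExact_iff (F : Density m) : QExact k F ↔ locInt F ∈ exactFunctionals k := by
  constructor
  · rintro ⟨H, h⟩
    exact ⟨H, by rw [h, locInt_bv (isPar_action k)]; rfl⟩
  · rintro ⟨H, h⟩
    exact ⟨H, by rw [← h, locInt_bv (isPar_action k)]; rfl⟩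

/-- The class of a density in the space of local functionals modulo exact ones. -/
def qClass (k : Fin m → ℂ) : Density m →ₗ[ℂ] LocalFunctional m ⧸ exactFunctionals k :=
  (exactFunctionals k).mkQ ∘ₗ locInt

theorem qClass_eq_iff (F G : Density m) : qClass k F = qClass k G ↔ QExact k (F - G) := by
  rw [qExact_iff, map_sub, ← Submodule.Quotient.eq]
  rfl

theorem qClass_congr {F G : Density m} (h : locInt F = locInt G) : qClass k F = qClass k G :=
  congrArg (exactFunctionals k).mkQ h

theorem qExact_lieBV_current (hk : ∀ c, k c ≠ 0) (x y : CurrentParam) :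
    QExact k (lieBV (current k x) (current k y) - current k (paramBracket x y)) :=
  (qClass_eq_iff _ _).mp <| lieBV_current_of k (qClass k) (fun _ _ h => qClass_congr h) (tLin m)
    isPar_currentT (fun V => Eq.symm ((qClass_eq_iff _ _).mpr
      (qExact_currentTHat_sub_currentT hk V)))
    (fun V W => qClass_congr (locInt_lieBV_T_T V W)) (fun V U => qClass_congr (locInt_lieBV_T_L V U))
    (fun V G _ => qClass_congr (locInt_lieBV_T_Theta k V G))
    (fun V S _ => qClass_congr (locInt_lieBV_T_Xi V S)) x y

theorem qExact_currentHat_sub_current (hk : ∀ c, k c ≠ 0) (x : CurrentParam) :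
    QExact k (currentHat k x - current k x) := by
  have h : currentHat k x - current k x = currentTHat k x.1.1 - currentT x.1.1 := by
    rw [currentHat, current]; abel
  rw [h]
  exact qExact_currentTHat_sub_currentT hk _

theorem QClosed.add {F G : Density m} (hF : QClosed k F) (hG : QClosed k G) : QClosed k (F + G) := by
  rw [qClosed_iff] at *
  rw [map_add, map_add, hF, hG, add_zero]

theorem qClosed_current (hk : ∀ c, k c ≠ 0) (x : CurrentParam) : QClosed k (current k x) :=
  (((qClosed_currentT k _).add (qClosed_currentL x.1.2.2)).add
    (qClosed_currentTheta hk x.2.1.2)).add (qClosed_currentXi _)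

theorem qClosed_currentHat (hk : ∀ c, k c ≠ 0) (x : CurrentParam) : QClosed k (currentHat k x) :=
  (((qClosed_currentTHat hk _).add (qClosed_currentL x.1.2.2)).add
    (qClosed_currentTheta hk x.2.1.2)).add (qClosed_currentXi _)

end BLG

/-! ## Formal linear combinations with dyadic Gaussian coefficients -/

/-- The number `((p - q) + (r - s) i) / 2 ^ exp`. -/
structure DyadicGauss : Type where
  p : ℕ
  q : ℕ
  r : ℕ
  s : ℕ
  exp : ℕ

namespace DyadicGauss

/-- The value in `ℂ`. -/
def val (a : DyadicGauss) : ℂ := ((a.p - a.q : ℂ) + (a.r - a.s) * Complex.I) / 2 ^ a.exp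

/-- Multiplication of dyadic Gaussian numbers. -/
def mul (a b : DyadicGauss) : DyadicGauss :=
  ⟨a.p * b.p + a.q * b.q + a.r * b.s + a.s * b.r, a.p * b.q + a.q * b.p + a.r * b.r + a.s * b.s,
    a.p * b.r + a.q * b.s + a.r * b.p + a.s * b.q, a.p * b.s + a.q * b.r + a.r * b.q + a.s * b.p,
    a.exp + b.exp⟩

/-- Addition of dyadic Gaussian numbers. -/
def add (a b : DyadicGauss) : DyadicGauss :=
  ⟨a.p * 2 ^ b.exp + b.p * 2 ^ a.exp, a.q * 2 ^ b.exp + b.q * 2 ^ a.exp,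
    a.r * 2 ^ b.exp + b.r * 2 ^ a.exp, a.s * 2 ^ b.exp + b.s * 2 ^ a.exp, a.exp + b.exp⟩

/-- Differences of natural numbers as dyadic Gaussian numbers. -/
def diff (m n : ℕ) : DyadicGauss := ⟨m, n, 0, 0, 0⟩

/-- The test for zero. -/
def isZero (a : DyadicGauss) : Bool := a.p.beq a.q && a.r.beq a.s

theorem val_mul (a b : DyadicGauss) : (a.mul b).val = a.val * b.val := by
  simp only [val, mul]
  push_cast
  rw [div_mul_div_comm, ← pow_add]
  congr 1
  linear_combination (-((a.r - a.s) * (b.r - b.s) : ℂ)) * Complex.I_sq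

theorem val_add (a b : DyadicGauss) : (a.add b).val = a.val + b.val := by
  simp only [val, add]
  rw [div_add_div _ _ (pow_ne_zero _ two_ne_zero) (pow_ne_zero _ two_ne_zero), ← pow_add]
  push_cast
  ring

@[simp] theorem val_diff (m n : ℕ) : (diff m n).val = m - n := by simp [val, diff]

theorem val_eq_zero {a : DyadicGauss} (h : a.isZero = true) : a.val = 0 := by
  rw [isZero, Bool.and_eq_true] at h
  simp [val, Nat.eq_of_beq_eq_true h.1, Nat.eq_of_beq_eq_true h.2]

end DyadicGauss

/-- Formal linear combinations of elements of `κ`. -/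
abbrev Comb (κ : Type) : Type := List (DyadicGauss × κ)

namespace Comb

variable {κ ι E : Type} [AddCommGroup E] [Module ℂ E]

/-- The value of a formal linear combination. -/
def eval (v : κ → E) (L : Comb κ) : E := (L.map fun t => t.1.val • v t.2).sum

@[simp] theorem eval_nil (v : κ → E) : eval v [] = 0 := rfl

@[simp] theorem eval_cons (v : κ → E) (t : DyadicGauss × κ) (L : Comb κ) :
    eval v (t :: L) = t.1.val • v t.2 + eval v L := by simp [eval]

@[simp] theorem eval_append (v : κ → E) (L M : Comb κ) : eval v (L ++ M) = eval v L + eval v M := by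
  simp [eval]

/-- Scalar multiplication. -/
def smul (a : DyadicGauss) (L : Comb κ) : Comb κ := L.map fun t => (a.mul t.1, t.2)

@[simp] theorem eval_smul (v : κ → E) (a : DyadicGauss) (L : Comb κ) :
    eval v (smul a L) = a.val • eval v L := by
  induction L with
  | nil => simp [smul]
  | cons t L ih =>
    rw [eval_cons, smul_add, ← ih, smul_smul, ← DyadicGauss.val_mul]
    simp [smul]

/-- Substitution. -/
def subst (s : κ → Comb ι) (L : Comb κ) : Comb ι := L.flatMap fun t => smul t.1 (s t.2)

/-- The substitution rule is only required on labels that occur; the component formulas hold for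
masks below 64 only. -/
theorem eval_subst_of_mem (v : ι → E) (w : κ → E) (s : κ → Comb ι) {L : Comb κ}
    (h : ∀ t ∈ L, eval v (s t.2) = w t.2) : eval v (subst s L) = eval w L := by
  induction L with
  | nil => rfl
  | cons t L ih =>
    rw [eval_cons, ← ih fun t ht => h t (List.mem_cons_of_mem _ ht), ← h t List.mem_cons_self,
      ← eval_smul]
    simp [subst]

theorem eval_subst (v : ι → E) (w : κ → E) (s : κ → Comb ι) (h : ∀ k, eval v (s k) = w k)
    (L : Comb κ) : eval v (subst s L) = eval w L :=
  eval_subst_of_mem v w s fun t _ => h t.2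

theorem eval_add (u v w : κ → E) (h : ∀ k, u k = v k + w k) (L : Comb κ) :
    eval u L = eval v L + eval w L := by
  induction L with
  | nil => simp
  | cons t L ih => rw [eval_cons, eval_cons, eval_cons, ih, h]; module

theorem eval_smul_right (u v : κ → E) (r : ℂ) (h : ∀ k, u k = r • v k) (L : Comb κ) :
    eval u L = r • eval v L := by
  induction L with
  | nil => simp
  | cons t L ih => rw [eval_cons, eval_cons, ih, h]; module

theorem eval_flatMap {α : Type} (v : κ → E) (l : List α) (f : α → Comb κ) :
    eval v (l.flatMap f) = (l.map fun a => eval v (f a)).sum := by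
  induction l with
  | nil => rfl
  | cons a l ih => simp [ih]

/-- The difference. -/
def sub (L M : Comb κ) : Comb κ := L ++ smul (.diff 0 1) M

@[simp] theorem eval_sub (v : κ → E) (L M : Comb κ) : eval v (sub L M) = eval v L - eval v M := by
  simp [sub, sub_eq_add_neg]

/-- The product of two formal linear combinations. -/
def prod (L : Comb κ) (M : Comb ι) : Comb (κ × ι) :=
  L.flatMap fun s => M.map fun t => (s.1.mul t.1, (s.2, t.2))

theorem eval_prod {A : Type} [CommRing A] [Algebra ℂ A] (v : κ → A) (w : ι → A) (L : Comb κ)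
    (M : Comb ι) : eval (fun k => v k.1 * w k.2) (prod L M) = eval v L * eval w M := by
  induction L with
  | nil => simp [prod]
  | cons s L ih =>
    have h : eval (fun k => v k.1 * w k.2) (M.map fun t => (s.1.mul t.1, (s.2, t.2))) =
        s.1.val • v s.2 * eval w M := by
      clear ih
      induction M with
      | nil => simp
      | cons t M ih' =>
        rw [List.map_cons, eval_cons, eval_cons, mul_add, ih', DyadicGauss.val_mul,
          smul_mul_smul_comm]
    rw [eval_cons, add_mul, ← ih, ← h]
    simp [prod]

end Comb

/-- Search trees for linear combinations. -/
inductive CombTree (κ : Type) : Type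
  | leaf
  | node (l : CombTree κ) (a : DyadicGauss) (k : κ) (r : CombTree κ)

namespace CombTree

variable {κ E : Type} [AddCommGroup E] [Module ℂ E]

/-- The value of a search tree. -/
def eval (v : κ → E) : CombTree κ → E
  | leaf => 0
  | node l a k r => a.val • v k + (eval v l + eval v r)

/-- Add a term. -/
def insert (eqb : κ → κ → Bool) (hash : κ → ℕ) (a : DyadicGauss) (k : κ) :
    CombTree κ → CombTree κ
  | leaf => node leaf a k leaf
  | node l b j r => bif (hash k).blt (hash j) then node (insert eqb hash a k l) b j r
      else bif eqb k j then node l (a.add b) j r else node l b j (insert eqb hash a k r)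

/-- The test for zero coefficients. -/
def isZero : CombTree κ → Bool
  | leaf => true
  | node l a _ r => a.isZero && (isZero l && isZero r)

/-- Valid for any hash: only labels that are actually equal are merged. A poor hash can cost time,
never soundness. -/
theorem eval_insert {eqb : κ → κ → Bool} {hash : κ → ℕ} (heqb : ∀ k l, eqb k l = true → k = l)
    (v : κ → E) (a : DyadicGauss) (k : κ) (t : CombTree κ) :
    eval v (insert eqb hash a k t) = a.val • v k + eval v t := by
  induction t with
  | leaf => simp [insert, eval]
  | node l b j r ihl ihr =>
    rw [insert]
    cases (hash k).blt (hash j) with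
    | true => rw [cond_true, eval, eval, ihl]; abel
    | false =>
      cases h : eqb k j with
      | true => rw [heqb _ _ h, cond_false, cond_true, eval, eval, DyadicGauss.val_add]; module
      | false => rw [cond_false, cond_false, eval, eval, ihr]; abel

theorem eval_eq_zero (v : κ → E) {t : CombTree κ} (h : t.isZero = true) : t.eval v = 0 := by
  induction t with
  | leaf => rfl
  | node l b j r ihl ihr =>
    rw [isZero, Bool.and_eq_true, Bool.and_eq_true] at h
    rw [eval, DyadicGauss.val_eq_zero h.1, ihl h.2.1, ihr h.2.2, zero_smul, add_zero, add_zero]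

end CombTree

namespace Comb

variable {κ ι E : Type} [AddCommGroup E] [Module ℂ E]

/-- The test for zero; the function `hash` only serves efficiency. -/
def isZero (eqb : κ → κ → Bool) (L : Comb κ) (hash : κ → ℕ := fun _ => 0) : Bool :=
  (L.foldr (fun t T => CombTree.insert eqb hash t.1 t.2 T) .leaf).isZero

variable {eqb : κ → κ → Bool} {hash : κ → ℕ}

theorem eval_eq_zero (heqb : ∀ k l, eqb k l = true → k = l)
    (v : κ → E) {L : Comb κ} (h : isZero eqb L hash = true) : eval v L = 0 := by
  have e : eval v L =
      (L.foldr (fun t T => CombTree.insert eqb hash t.1 t.2 T) .leaf).eval v := by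
    clear h
    induction L with
    | nil => rfl
    | cons t L ih => rw [eval_cons, ih, List.foldr_cons, CombTree.eval_insert heqb]
  rw [e, CombTree.eval_eq_zero v h]

theorem eval_eq_of_isZero_sub (heqb : ∀ k l, eqb k l = true → k = l)
    (v : κ → E) {L M : Comb κ} (h : isZero eqb (sub L M) hash = true) :
    eval v L = eval v M := by
  rw [← sub_eq_zero, ← eval_sub, eval_eq_zero heqb v h]

end Comb

/-! ## The contact bracket in terms of bit masks -/

namespace SuperFun

/-- The subset of `Fin 6` with a given bit mask. -/
def bitSet (n : ℕ) : Finset (Fin 6) := Finset.univ.filter fun i => n.testBit i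

theorem mem_bitSet {n : ℕ} {i : Fin 6} : i ∈ bitSet n ↔ n.testBit i = true := by simp [bitSet]

/-- The number of elements of a subset with a given bit mask. -/
def bitCard (n : ℕ) : ℕ :=
  n % 2 + n / 2 % 2 + n / 4 % 2 + n / 8 % 2 + n / 16 % 2 + n / 32 % 2

/-- The parity of the number of pairs in `superSign`. -/
def bitInv (S T : ℕ) : ℕ :=
  bitCard (S &&& (2 * T ^^^ 4 * T ^^^ 8 * T ^^^ 16 * T ^^^ 32 * T)) % 2

/-- The sign `(-1) ^ n`. -/
def signPow (n : ℕ) : DyadicGauss := bif (n % 2).beq 0 then .diff 1 0 else .diff 0 1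

/-- The sign `superSign`. -/
def bitSign (S T : ℕ) : DyadicGauss := signPow (bitInv S T)

/-- The submasks of a mask. -/
def submasks (U : ℕ) : List ℕ := (List.range 64).filter fun S => (S &&& U).beq S

/-- The complementary mask. -/
def bitCompl (U : ℕ) : ℕ := 63 ^^^ U

theorem exists_bitSet (S : Finset (Fin 6)) : ∃ n < 64, bitSet n = S := by
  revert S; decide +kernel

theorem bitSet_compl (U : ℕ) : (bitSet U)ᶜ = bitSet (bitCompl U) := by
  ext i
  have h : (63 : ℕ).testBit i = true := by revert i; decide
  simp [mem_bitSet, bitCompl, Nat.testBit_xor, h]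

theorem powerset_bitSet : ∀ U < 64, (bitSet U).powerset.val = ((submasks U).map bitSet : List _) := by
  decide +kernel

/-- Bit `i` of the exclusive-or of the shifts of `T` is the parity of the number of elements of `T`
below `i`; masking by `S` and counting bits gives the parity of the inversions. -/
theorem bitInv_eq : ∀ S < 64, ∀ T < 64,
    ((bitSet S ×ˢ bitSet T).filter fun p => p.2 < p.1).card % 2 = bitInv S T := by
  decide +kernel

theorem card_bitSet : ∀ n < 64, (bitSet n).card = bitCard n := by
  decide +kernel

theorem val_signPow (n : ℕ) : (signPow n).val = (-1) ^ n := by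
  rw [signPow]
  rcases Nat.even_or_odd n with h | h
  · rw [h.neg_one_pow, Nat.even_iff.mp h]
    show (DyadicGauss.diff 1 0).val = 1
    simp
  · rw [h.neg_one_pow, Nat.odd_iff.mp h]
    show (DyadicGauss.diff 0 1).val = -1
    simp

theorem superSign_bitSet {S T : ℕ} (hS : S < 64) (hT : T < 64) :
    superSign (bitSet S) (bitSet T) = (bitSign S T).val := by
  rw [superSign, neg_one_pow_eq_pow_mod_two, bitInv_eq S hS T hT, bitSign, val_signPow]

theorem mem_submasks {S U : ℕ} : S ∈ submasks U ↔ S < 64 ∧ S &&& U = S := by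
  rw [submasks, List.mem_filter, List.mem_range, Nat.beq_eq]

theorem sdiff_bitSet {S U : ℕ} (h : S &&& U = S) : bitSet U \ bitSet S = bitSet (U ^^^ S) := by
  ext i
  have h' := congrArg (fun n => n.testBit i) h
  simp only [Nat.testBit_and] at h'
  simp only [Finset.mem_sdiff, mem_bitSet, Nat.testBit_xor]
  revert h'
  cases S.testBit i <;> cases U.testBit i <;> simp

theorem insert_bitSet (S : ℕ) (i : Fin 6) : insert i (bitSet S) = bitSet (S ||| 2 ^ (i : ℕ)) := by
  ext j
  simp only [Finset.mem_insert, mem_bitSet, Nat.testBit_or, Nat.testBit_two_pow, Bool.or_eq_true,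
    decide_eq_true_eq, Fin.ext_iff]
  rw [or_comm, eq_comm (a := (j : ℕ))]

theorem singleton_bitSet (i : Fin 6) : {i} = bitSet (2 ^ (i : ℕ)) := by
  ext j
  simp only [Finset.mem_singleton, mem_bitSet, Nat.testBit_two_pow, decide_eq_true_eq, Fin.ext_iff]
  rw [eq_comm]

theorem xor_lt {S U : ℕ} (hS : S < 64) (hU : U < 64) : U ^^^ S < 64 :=
  Nat.xor_lt_two_pow (n := 6) hU hS

theorem mul_bitSet (f g : SuperFun) {U : ℕ} (hU : U < 64) : mul f g (bitSet U) =
    ((submasks U).map fun S =>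
      (bitSign S (U ^^^ S)).val • (f (bitSet S) * g (bitSet (U ^^^ S)))).sum := by
  rw [mul, Finset.sum, powerset_bitSet U hU, Multiset.map_coe, Multiset.sum_coe, List.map_map]
  refine congrArg List.sum (List.map_congr_left fun S hS => ?_)
  obtain ⟨h, h'⟩ := mem_submasks.mp hS
  rw [Function.comp_apply, sdiff_bitSet h', superSign_bitSet h (xor_lt h hU)]

theorem dxi_bitSet (i : Fin 6) (f : SuperFun) {S : ℕ} (hS : S < 64) (hi : S.testBit i = false) :
    dxi i f (bitSet S) = (bitSign (2 ^ (i : ℕ)) S).val • f (bitSet (S ||| 2 ^ (i : ℕ))) := by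
  have hi2 : 2 ^ (i : ℕ) < 64 := Nat.pow_lt_pow_right one_lt_two i.2
  rw [dxi, if_neg (by simp [mem_bitSet, hi]), insert_bitSet, singleton_bitSet,
    superSign_bitSet hi2 hS]

theorem dxi_bitSet_of_mem (i : Fin 6) (f : SuperFun) {S : ℕ} (hi : S.testBit i = true) :
    dxi i f (bitSet S) = 0 := if_pos (mem_bitSet.mpr hi)

/-- The components of a superfunction and their derivatives. -/
def jet (f : SuperFun) (k : ℕ × ℕ) : Entire := (Entire.der ^ k.2) (f (bitSet k.1))

/-- The products of two jets. -/
def jet₂ (f g : SuperFun) (k : (ℕ × ℕ) × (ℕ × ℕ)) : Entire := jet f k.1 * jet g k.2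

/-- The component of the contact bracket with a given mask. -/
def bracketComb (U : ℕ) : Comb ((ℕ × ℕ) × (ℕ × ℕ)) :=
  (submasks U).map (fun S => ((bitSign S (U ^^^ S)).mul (.diff 2 (bitCard S)),
    ((S, 0), (U ^^^ S, 1)))) ++
  (submasks U).map (fun S => ((bitSign S (U ^^^ S)).mul (.diff (bitCard (U ^^^ S)) 2),
    ((S, 1), (U ^^^ S, 0)))) ++
  ([0, 1, 2, 3, 4, 5].filter fun i => !U.testBit i).flatMap fun i => (submasks U).map fun S =>
    ((bitSign S (U ^^^ S)).mul ((signPow (bitCard (S ||| 2 ^ i))).mul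
      ((bitSign (2 ^ i) S).mul (bitSign (2 ^ i) (U ^^^ S)))),
      ((S ||| 2 ^ i, 0), ((U ^^^ S) ||| 2 ^ i, 0)))

theorem eval_map_submasks {E : Type} [AddCommGroup E] [Module ℂ E] {κ : Type} (v : κ → E) (l : List ℕ)
    (c : ℕ → DyadicGauss) (k : ℕ → κ) : Comb.eval v (l.map fun S => (c S, k S)) =
      (l.map fun S => (c S).val • v (k S)).sum := by
  rw [Comb.eval, List.map_map]; rfl

theorem sum_fin_six {M : Type} [AddCommMonoid M] (F : ℕ → M) (p : ℕ → Bool) :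
    ∑ i : Fin 6, (if p i then F i else 0) = (([0, 1, 2, 3, 4, 5].filter p).map F).sum := by
  have h : ∀ l : List ℕ, ((l.filter p).map F).sum = (l.map fun i => if p i then F i else 0).sum := by
    intro l
    induction l with
    | nil => rfl
    | cons i l ih => by_cases hi : p i <;> simp [hi, ih]
  rw [h, Fin.sum_univ_six]
  simp [add_assoc]

theorem contactBracket_bitSet (f g : SuperFun) {U : ℕ} (hU : U < 64) :
    contactBracket f g (bitSet U) = (bracketComb U).eval (jet₂ f g) := by
  have hx : ∀ i : Fin 6, mul (dxi i (invol f)) (dxi i g) (bitSet U) =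
      if (!U.testBit i) then ((submasks U).map fun S =>
        ((bitSign S (U ^^^ S)).mul ((signPow (bitCard (S ||| 2 ^ (i : ℕ)))).mul
        ((bitSign (2 ^ (i : ℕ)) S).mul (bitSign (2 ^ (i : ℕ)) (U ^^^ S))))).val •
        jet₂ f g ((S ||| 2 ^ (i : ℕ), 0), ((U ^^^ S) ||| 2 ^ (i : ℕ), 0))).sum else 0 := by
    intro i
    rw [mul_bitSet _ _ hU]
    split_ifs with hi
    · refine congrArg List.sum (List.map_congr_left fun S hS => ?_)
      obtain ⟨h, h'⟩ := mem_submasks.mp hS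
      have hSi : S.testBit i = false := by
        rw [← h', Nat.testBit_and]; simp_all
      have hTi : (U ^^^ S).testBit i = false := by
        rw [Nat.testBit_xor]; simp_all
      have hlt : S ||| 2 ^ (i : ℕ) < 64 :=
        Nat.or_lt_two_pow (n := 6) h (Nat.pow_lt_pow_right one_lt_two i.2)
      rw [dxi_bitSet i _ h hSi, dxi_bitSet i _ (xor_lt h hU) hTi, invol, card_bitSet _ hlt]
      simp only [DyadicGauss.val_mul, val_signPow, jet₂, jet, pow_zero, Module.End.one_apply,
        smul_mul_smul_comm, smul_smul]
      congr 1
      ring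
    -- If `i ∈ U`, it lies in `S` or in its complement in `U`, and a `ξ_i`-derivative has no
    -- component containing `ξ_i`.
    · refine List.sum_eq_zero fun e he => ?_
      obtain ⟨S, hS, rfl⟩ := List.mem_map.mp he
      obtain ⟨h, h'⟩ := mem_submasks.mp hS
      have hUi : U.testBit i = true := by simpa using hi
      cases hSi : S.testBit i with
      | true => rw [dxi_bitSet_of_mem i _ hSi, zero_mul, smul_zero]
      | false =>
        rw [dxi_bitSet_of_mem i (S := U ^^^ S) _ (by rw [Nat.testBit_xor, hUi, hSi]; rfl), mul_zero,
          smul_zero]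
  have h1 : mul (twoSubEuler f) (dz g) (bitSet U) = ((submasks U).map fun S =>
      ((bitSign S (U ^^^ S)).mul (.diff 2 (bitCard S))).val • jet₂ f g ((S, 0), (U ^^^ S, 1))).sum := by
    rw [mul_bitSet _ _ hU]
    refine congrArg List.sum (List.map_congr_left fun S hS => ?_)
    rw [twoSubEuler, card_bitSet _ (mem_submasks.mp hS).1, DyadicGauss.val_mul, smul_mul_assoc,
      smul_smul, DyadicGauss.val_diff]
    push_cast
    rfl
  have h2 : mul (dz f) (twoSubEuler g) (bitSet U) = -((submasks U).map fun S =>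
      ((bitSign S (U ^^^ S)).mul (.diff (bitCard (U ^^^ S)) 2)).val •
        jet₂ f g ((S, 1), (U ^^^ S, 0))).sum := by
    rw [mul_bitSet _ _ hU, eq_neg_iff_add_eq_zero, ← List.sum_map_add]
    refine List.sum_eq_zero fun e he => ?_
    obtain ⟨S, hS, rfl⟩ := List.mem_map.mp he
    rw [twoSubEuler, card_bitSet _ (xor_lt (mem_submasks.mp hS).1 hU), DyadicGauss.val_mul,
      mul_smul_comm, smul_smul, DyadicGauss.val_diff]
    push_cast
    change _ + _ • (dz f (bitSet S) * g (bitSet (U ^^^ S))) = 0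
    module
  have h0 : contactBracket f g (bitSet U) = mul (twoSubEuler f) (dz g) (bitSet U)
      - mul (dz f) (twoSubEuler g) (bitSet U) +
        ∑ i : Fin 6, mul (dxi i (invol f)) (dxi i g) (bitSet U) := by
    rw [contactBracket, Pi.add_apply, Pi.sub_apply, Finset.sum_apply]
  rw [h0, h1, h2, sub_neg_eq_add, bracketComb, Comb.eval_append, Comb.eval_append, eval_map_submasks,
    eval_map_submasks, Comb.eval_flatMap]
  simp only [hx, eval_map_submasks]
  exact congrArg (HAdd.hAdd _) (sum_fin_six (fun i => ((submasks U).map fun S =>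
    ((bitSign S (U ^^^ S)).mul ((signPow (bitCard (S ||| 2 ^ i))).mul
    ((bitSign (2 ^ i) S).mul (bitSign (2 ^ i) (U ^^^ S))))).val •
    jet₂ f g ((S ||| 2 ^ i, 0), ((U ^^^ S) ||| 2 ^ i, 0))).sum) fun i => !U.testBit i)

end SuperFun

/-! ## Closure of `E(1|6)` under the contact bracket -/

namespace SuperFun

/-- The order of the derivative in `ckMap`. -/
def hodgeOrder (U : ℕ) : ℕ := 3 - bitCard (bitCompl U)

/-- The coefficient in `ckMap`. -/
def hodgeCoef (U : ℕ) : DyadicGauss :=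
  ((DyadicGauss.mk 0 0 1 0 0).mul
    (signPow (bitCard (bitCompl U) * (bitCard (bitCompl U) + 1) / 2))).mul (bitSign (bitCompl U) U)

theorem bitCompl_lt {U : ℕ} (hU : U < 64) : bitCompl U < 64 :=
  Nat.xor_lt_two_pow (n := 6) (by norm_num) hU

theorem bitCompl_bitCompl (U : ℕ) : bitCompl (bitCompl U) = U := by
  rw [bitCompl, bitCompl, ← Nat.xor_assoc, Nat.xor_self, Nat.zero_xor]

theorem bitCard_bitCompl : ∀ U < 64, bitCard (bitCompl U) + bitCard U = 6 := by decide +kernel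

theorem ckMap_bitSet (f : SuperFun) {U : ℕ} (hU : U < 64) : ckMap f (bitSet U) =
    f (bitSet U) - (hodgeCoef U).val • jet f (bitCompl U, hodgeOrder U) := by
  show f (bitSet U) - _ = _
  rw [bitSet_compl, card_bitSet _ (bitCompl_lt hU), superSign_bitSet (bitCompl_lt hU) hU, hodgeCoef,
    DyadicGauss.val_mul]
  rw [DyadicGauss.val_mul, val_signPow]
  simp [DyadicGauss.val, jet, hodgeOrder]

/-- In degree three the normalised Hodge operator is an involution. -/
theorem hodgeCoef_mul : ∀ U < 64, bitCard U = 3 →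
    (((hodgeCoef U).mul (hodgeCoef (bitCompl U))).add (.diff 0 1)).isZero = true := by
  decide +kernel

/-- These duality relations characterise `E(1|6)`, see `mem_E16_of_apply` for the converse; they
make membership a condition on components. -/
theorem E16_apply {x : SuperFun} (hx : x ∈ E16) {U : ℕ} (hU : U < 64) (h3 : 3 ≤ bitCard U) :
    x (bitSet U) = -(hodgeCoef U).val • jet x (bitCompl U, hodgeOrder U) := by
  obtain ⟨f, hf, rfl⟩ := hx
  have hc := bitCard_bitCompl U hU
  simp only [jet]
  rw [ckMap_bitSet f hU, ckMap_bitSet f (bitCompl_lt hU), bitCompl_bitCompl]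
  rcases h3.eq_or_lt with h | h
  · have ho : hodgeOrder U = 0 := by rw [hodgeOrder]; omega
    have ho' : hodgeOrder (bitCompl U) = 0 := by rw [hodgeOrder, bitCompl_bitCompl]; omega
    have hm := DyadicGauss.val_eq_zero (hodgeCoef_mul U hU h.symm)
    rw [DyadicGauss.val_add, DyadicGauss.val_mul, DyadicGauss.val_diff] at hm
    push_cast at hm
    simp only [ho, ho', jet, pow_zero, Module.End.one_apply]
    linear_combination (norm := module) (-hm) • f (bitSet U)
  -- Above degree three `f` has no component of its own, so the component of the image is the dual
  -- term alone.
  · have h0 : f (bitSet U) = 0 := hf _ (by rw [card_bitSet U hU]; exact h)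
    simp only [jet, h0, map_zero, smul_zero, sub_zero, zero_sub, neg_smul]

theorem mem_E16_of_apply {x : SuperFun} (h : ∀ U < 64, 3 ≤ bitCard U →
    x (bitSet U) = -(hodgeCoef U).val • jet x (bitCompl U, hodgeOrder U)) : x ∈ E16 := by
  -- In degree three `ckMap` is twice a projection, hence the factor `½` in the preimage.
  refine ⟨fun S => if S.card ≤ 2 then x S else if S.card = 3 then (1 / 2 : ℂ) • x S else 0,
    fun S hS => ?_, funext fun S => ?_⟩
  · exact (if_neg (by omega)).trans (if_neg (by omega))
  · obtain ⟨U, hU, rfl⟩ := exists_bitSet S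
    have hc := bitCard_bitCompl U hU
    rw [ckMap_bitSet _ hU]
    simp only [jet, card_bitSet _ hU, card_bitSet _ (bitCompl_lt hU)]
    rcases lt_trichotomy (bitCard U) 3 with h3 | h3 | h3
    · rw [if_pos (by omega), if_neg (by omega), if_neg (by omega), map_zero, smul_zero, sub_zero]
    · have e := h U hU h3.ge
      rw [jet, neg_smul] at e
      rw [if_neg (by omega), if_pos (by omega), if_neg (by omega), if_pos (by omega), map_smul]
      linear_combination (norm := module) (-1 / 2 : ℂ) • e
    · rw [if_neg (by omega), if_neg (by omega), if_pos (by omega), h U hU h3.le, zero_sub, neg_smul]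
      rfl

/-- Rewrite the components of an element of `E(1|6)` in terms of independent ones. -/
def reduce (k : ℕ × ℕ) : Comb (ℕ × ℕ) :=
  bif k.1.blt 64 && Nat.ble 3 (bitCard k.1) && !((bitCard k.1).beq 3 && k.1.testBit 0) then
    [((DyadicGauss.diff 0 1).mul (hodgeCoef k.1), (bitCompl k.1, k.2 + hodgeOrder k.1))]
  else [(.diff 1 0, k)]

theorem eval_reduce {x : SuperFun} (hx : x ∈ E16) (k : ℕ × ℕ) :
    (reduce k).eval (jet x) = jet x k := by
  rw [reduce]
  cases h : k.1.blt 64 && Nat.ble 3 (bitCard k.1) && !((bitCard k.1).beq 3 && k.1.testBit 0)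
  · simp
  · rw [Bool.and_eq_true, Bool.and_eq_true, Nat.blt_eq, Nat.ble_eq] at h
    rw [cond_true]
    rw [Comb.eval_cons, Comb.eval_nil, add_zero]
    simp only [jet]
    rw [E16_apply hx h.1.1 h.1.2, map_smul, jet, ← Module.End.mul_apply, ← pow_add,
      DyadicGauss.val_mul, DyadicGauss.val_diff]
    push_cast
    rw [zero_sub, neg_one_mul]

/-- `reduce` on both factors. -/
def reduce₂ (k : (ℕ × ℕ) × (ℕ × ℕ)) : Comb ((ℕ × ℕ) × (ℕ × ℕ)) := (reduce k.1).prod (reduce k.2)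

theorem eval_reduce₂ {x y : SuperFun} (hx : x ∈ E16) (hy : y ∈ E16)
    (L : Comb ((ℕ × ℕ) × (ℕ × ℕ))) : (L.subst reduce₂).eval (jet₂ x y) = L.eval (jet₂ x y) :=
  Comb.eval_subst _ _ _ (fun k => by
    have h := Comb.eval_prod (jet x) (jet y) (reduce k.1) (reduce k.2)
    rw [eval_reduce hx, eval_reduce hy] at h
    exact h) L

/-- The Leibniz rule. -/
def leibniz (L : Comb ((ℕ × ℕ) × (ℕ × ℕ))) : Comb ((ℕ × ℕ) × (ℕ × ℕ)) :=
  L.subst fun k => [(.diff 1 0, ((k.1.1, k.1.2 + 1), k.2)), (.diff 1 0, (k.1, (k.2.1, k.2.2 + 1)))]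

theorem der_jet (x : SuperFun) (k : ℕ × ℕ) : Entire.der (jet x k) = jet x (k.1, k.2 + 1) := by
  rw [jet, jet, pow_succ']; rfl

theorem eval_leibniz (x y : SuperFun) (L : Comb ((ℕ × ℕ) × (ℕ × ℕ))) :
    (leibniz L).eval (jet₂ x y) = Entire.der (L.eval (jet₂ x y)) := by
  rw [leibniz, Comb.eval_subst (w := fun k => Entire.der (jet₂ x y k))]
  · induction L with
    | nil => simp
    | cons t L ih => rw [Comb.eval_cons, Comb.eval_cons, map_add, map_smul, ih]
  · intro k
    simp [jet₂, Entire.der_mul, der_jet, add_comm]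

theorem eval_leibniz_iterate (x y : SuperFun) (n : ℕ) (L : Comb ((ℕ × ℕ) × (ℕ × ℕ))) :
    (leibniz^[n] L).eval (jet₂ x y) = (Entire.der ^ n) (L.eval (jet₂ x y)) := by
  induction n with
  | zero => rfl
  | succ n ih => rw [Function.iterate_succ_apply', eval_leibniz, ih, pow_succ']; rfl

/-- A hash function for pairs of jets. -/
def hash₂ (k : (ℕ × ℕ) × (ℕ × ℕ)) : ℕ :=
  (37 * k.1.1 + 101 * k.2.1 + 71 * k.1.2 + 13 * k.2.2) % 1021

/-- Equality of pairs of jets. -/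
def eqb₂ (k l : (ℕ × ℕ) × (ℕ × ℕ)) : Bool :=
  k.1.1.beq l.1.1 && (k.2.1.beq l.2.1 && (k.1.2.beq l.1.2 && k.2.2.beq l.2.2))

theorem eq_of_eqb₂ (k l : (ℕ × ℕ) × (ℕ × ℕ)) (h : eqb₂ k l = true) : k = l := by
  simp only [eqb₂, Bool.and_eq_true] at h
  obtain ⟨h1, h2, h3, h4⟩ := h
  exact Prod.ext (Prod.ext (Nat.eq_of_beq_eq_true h1) (Nat.eq_of_beq_eq_true h3))
    (Prod.ext (Nat.eq_of_beq_eq_true h2) (Nat.eq_of_beq_eq_true h4))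

/-- The duality relation for a bracket of two elements of `E(1|6)`: the derivatives are distributed
by the Leibniz rule, dependent components are eliminated by `reduce₂`, and the remaining products of
jets are treated as free variables whose coefficients all vanish. -/
theorem isZero_bracketComb : ∀ U < 64, 3 ≤ bitCard U →
    ((bracketComb U ++ (leibniz^[hodgeOrder U] (bracketComb (bitCompl U))).smul
      (hodgeCoef U)).subst reduce₂).isZero eqb₂ hash₂ = true := by
  decide +kernel

theorem contactBracket_mem_E16 {x y : SuperFun} (hx : x ∈ E16) (hy : y ∈ E16) :
    contactBracket x y ∈ E16 := mem_E16_of_apply fun U hU h => by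
  have e := Comb.eval_eq_zero eq_of_eqb₂ (jet₂ x y) (isZero_bracketComb U hU h)
  rw [eval_reduce₂ hx hy, Comb.eval_append, Comb.eval_smul, eval_leibniz_iterate,
    ← contactBracket_bitSet x y hU, ← contactBracket_bitSet x y (bitCompl_lt hU)] at e
  rw [eq_neg_of_add_eq_zero_left e, neg_smul]
  rfl

end SuperFun

/-! ## The identification of `E(1|6)` with the space of parameters -/

namespace SuperFun

/-- Matrices of linear combinations of jets. -/
abbrev CombMat : Type := Fin 4 → Fin 4 → Comb (ℕ × ℕ)

/-- The matrix with given rows. -/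
def table (l : List (List (Comb (ℕ × ℕ)))) : CombMat := fun a b => (l.getD a []).getD b []

/-- The component `V`, twice the constant term. -/
def vecComb : Comb (ℕ × ℕ) := [(.diff 2 0, (0, 0))]

/-- The linear combination `(-1)^a x_S + (-1)^b i x_T` of components. -/
def pairComb (a b S T : ℕ) : Comb (ℕ × ℕ) :=
  [(signPow a, (S, 0)), ((DyadicGauss.mk 0 0 1 0 0).mul (signPow b), (T, 0))]

/-- The negative. -/
def negComb (L : Comb (ℕ × ℕ)) : Comb (ℕ × ℕ) := L.smul (.diff 0 1)

/-- One half. -/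
def halfComb (L : Comb (ℕ × ℕ)) : Comb (ℕ × ℕ) := L.smul ⟨1, 0, 0, 0, 1⟩

/-- The matrix `Γ = ∑ f_i γ_i`, where the `γ_i` span `Λ²ℂ⁴ ≅ ℂ⁶`. -/
def altComb : CombMat :=
  table [[[], pairComb 0 0 1 2, pairComb 0 0 4 8, pairComb 0 1 16 32],
    [pairComb 1 1 1 2, [], pairComb 0 0 16 32, pairComb 1 0 4 8],
    [pairComb 1 1 4 8, pairComb 1 1 16 32, [], pairComb 0 1 1 2],
    [pairComb 1 0 16 32, pairComb 0 1 4 8, pairComb 1 0 1 2, []]]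

/-- The dual of the matrix `Γ`. -/
def dualComb : CombMat :=
  table [[[], altComb 2 3, negComb (altComb 1 3), altComb 1 2],
    [negComb (altComb 2 3), [], altComb 0 3, negComb (altComb 0 2)],
    [altComb 1 3, negComb (altComb 0 3), [], altComb 0 1],
    [negComb (altComb 1 2), altComb 0 2, negComb (altComb 0 1), []]]

/-- A diagonal entry of the matrix `U`. -/
def cartanComb (a b c : ℕ) : Comb (ℕ × ℕ) :=
  [((DyadicGauss.mk 0 0 1 0 0).mul (signPow a), (3, 0)),
    ((DyadicGauss.mk 0 0 1 0 0).mul (signPow b), (12, 0)),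
    ((DyadicGauss.mk 0 0 1 0 0).mul (signPow c), (48, 0))]

/-- The matrix `U = ½ ∑ f_ij γ_i *γ_j`, under `𝔰𝔬(6) ≅ 𝔰𝔩(4)`. -/
def slComb : CombMat := fun a b => halfComb <|
  table [[cartanComb 0 0 1, pairComb 1 1 20 24 ++ pairComb 1 0 40 36,
      pairComb 0 0 17 18 ++ pairComb 0 1 34 33, pairComb 1 1 5 6 ++ pairComb 0 1 10 9],
    [pairComb 0 1 20 24 ++ pairComb 0 0 40 36, cartanComb 0 1 0,
      pairComb 1 1 5 6 ++ pairComb 1 0 10 9, pairComb 1 1 17 18 ++ pairComb 0 1 34 33],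
    [pairComb 1 0 17 18 ++ pairComb 1 1 34 33, pairComb 0 1 5 6 ++ pairComb 0 0 10 9,
      cartanComb 1 0 0, pairComb 1 1 20 24 ++ pairComb 0 1 40 36],
    [pairComb 0 1 5 6 ++ pairComb 1 1 10 9, pairComb 0 1 17 18 ++ pairComb 1 1 34 33,
      pairComb 0 1 20 24 ++ pairComb 1 1 40 36, cartanComb 1 1 1]] a b

/-- The matrix `Σ = -¼ ∑ f_ijk *γ_i γ_j *γ_k`. -/
def symComb : CombMat := fun a b => halfComb <|
  table [[pairComb 1 0 21 25 ++ pairComb 1 1 41 37,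
      [((DyadicGauss.mk 0 0 1 0 0), (13, 0)), ((DyadicGauss.mk 0 0 0 1 0), (49, 0))],
      pairComb 0 0 11 7, pairComb 1 0 35 19],
    [[((DyadicGauss.mk 0 0 1 0 0), (13, 0)), ((DyadicGauss.mk 0 0 0 1 0), (49, 0))],
      pairComb 1 1 21 25 ++ pairComb 1 0 41 37, pairComb 0 0 35 19, pairComb 0 1 11 7],
    [pairComb 0 0 11 7, pairComb 0 0 35 19, pairComb 1 0 21 25 ++ pairComb 0 0 41 37,
      [((DyadicGauss.mk 0 0 1 0 0), (13, 0)), ((DyadicGauss.mk 0 0 1 0 0), (49, 0))]],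
    [pairComb 1 0 35 19, pairComb 0 1 11 7,
      [((DyadicGauss.mk 0 0 1 0 0), (13, 0)), ((DyadicGauss.mk 0 0 1 0 0), (49, 0))],
      pairComb 1 1 21 25 ++ pairComb 0 1 41 37]] a b

/-- Labels of the entries of `(V, U, Γ, Σ)`. -/
inductive ParamKey : Type
  | vec
  | sl (a b : Fin 4)
  | alt (a b : Fin 4)
  | sym (a b : Fin 4)

/-- The entries of the image of an element of `E(1|6)`. -/
def paramComb : ParamKey → Comb (ℕ × ℕ)
  | .vec => vecComb
  | .sl a b => slComb a b
  | .alt a b => altComb a b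
  | .sym a b => symComb a b

/-- Equality of matrix positions. -/
def eqbPos (a b c d : Fin 4) : Bool := a.1.beq c.1 && b.1.beq d.1

theorem eq_of_eqbPos {a b c d : Fin 4} (h : eqbPos a b c d = true) : a = c ∧ b = d := by
  rw [eqbPos, Bool.and_eq_true] at h
  exact ⟨Fin.ext (Nat.eq_of_beq_eq_true h.1), Fin.ext (Nat.eq_of_beq_eq_true h.2)⟩

/-- Equality of labels. -/
def eqbKey : ParamKey → ParamKey → Bool
  | .vec, .vec => true
  | .sl a b, .sl c d => eqbPos a b c d
  | .alt a b, .alt c d => eqbPos a b c d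
  | .sym a b, .sym c d => eqbPos a b c d
  | _, _ => false

theorem eq_of_eqbKey (k l : ParamKey) (h : eqbKey k l = true) : k = l := by
  cases k <;> cases l <;> simp only [eqbKey, Bool.false_eq_true] at h <;>
    first
    | rfl
    | (obtain ⟨rfl, rfl⟩ := eq_of_eqbPos h; rfl)

/-- The list of all positions in a matrix. -/
def positions : List (Fin 4 × Fin 4) :=
  [(0, 0), (0, 1), (0, 2), (0, 3), (1, 0), (1, 1), (1, 2), (1, 3),
    (2, 0), (2, 1), (2, 2), (2, 3), (3, 0), (3, 1), (3, 2), (3, 3)]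

theorem mem_positions (a b : Fin 4) : (a, b) ∈ positions := by
  revert a b; decide

/-- A test for all labels. -/
def allKeys (p : ParamKey → Bool) : Bool :=
  p .vec && (positions.all (fun q => p (.sl q.1 q.2)) &&
    (positions.all (fun q => p (.alt q.1 q.2)) && positions.all fun q => p (.sym q.1 q.2)))

theorem of_allKeys {p : ParamKey → Bool} (h : allKeys p = true) (k : ParamKey) : p k = true := by
  simp only [allKeys, Bool.and_eq_true, List.all_eq_true] at h
  obtain ⟨h0, h1, h2, h3⟩ := h
  cases k with
  | vec => exact h0
  | sl a b => exact h1 _ (mem_positions a b)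
  | alt a b => exact h2 _ (mem_positions a b)
  | sym a b => exact h3 _ (mem_positions a b)

/-- Equality of jets. -/
def eqb₁ (k l : ℕ × ℕ) : Bool := k.1.beq l.1 && k.2.beq l.2

theorem eq_of_eqb₁ (k l : ℕ × ℕ) (h : eqb₁ k l = true) : k = l := by
  rw [eqb₁, Bool.and_eq_true] at h
  exact Prod.ext (Nat.eq_of_beq_eq_true h.1) (Nat.eq_of_beq_eq_true h.2)

/-- The linear map `x ↦ (V, U, Γ, Σ)`. -/
def toParam : SuperFun →ₗ[ℂ] CurrentParam where
  toFun x := ((vecComb.eval (jet x), ⟨fun a b => (slComb a b).eval (jet x), by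
      -- The diagonal entries cancel as formal combinations, before evaluation.
      have h : (slComb 0 0 ++ (slComb 1 1 ++ (slComb 2 2 ++ slComb 3 3))).isZero eqb₁ = true := by
        decide +kernel
      have e := Comb.eval_eq_zero eq_of_eqb₁ (jet x) h
      simp only [Comb.eval_append] at e
      show ∑ a, (slComb a a).eval (jet x) = 0
      rw [Fin.sum_univ_four, ← e]
      abel⟩),
    (⟨fun a b => (altComb a b).eval (jet x), by
      have h : ∀ a b, (altComb b a ++ altComb a b).isZero eqb₁ = true := by decide +kernel
      refine Matrix.ext fun a b => eq_neg_of_add_eq_zero_left ?_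
      have e := Comb.eval_eq_zero eq_of_eqb₁ (jet x) (h a b)
      rwa [Comb.eval_append] at e⟩,
    ⟨fun a b => (symComb a b).eval (jet x), by
      have h : ∀ a b, ((symComb b a).sub (symComb a b)).isZero eqb₁ = true := by decide +kernel
      exact Matrix.ext fun a b => Comb.eval_eq_of_isZero_sub eq_of_eqb₁ (jet x) (h a b)⟩))
  map_add' x y := by
    have h : ∀ L : Comb (ℕ × ℕ), L.eval (jet (x + y)) = L.eval (jet x) + L.eval (jet y) := fun L =>
      Comb.eval_add _ _ _ (fun k => by simp [jet]) L
    simp only [h]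
    rfl
  map_smul' r x := by
    have h : ∀ L : Comb (ℕ × ℕ), L.eval (jet (r • x)) = r • L.eval (jet x) := fun L =>
      Comb.eval_smul_right _ _ _ (fun k => by simp [jet]) L
    simp only [h]
    rfl

/-- The entries of `(V, U, Γ, Σ)`. -/
def entry (p : CurrentParam) : ParamKey → Entire
  | .vec => p.1.1
  | .sl a b => p.1.2.1 a b
  | .alt a b => p.2.1.1 a b
  | .sym a b => p.2.2.1 a b

theorem entry_toParam (x : SuperFun) (k : ParamKey) :
    entry (toParam x) k = (paramComb k).eval (jet x) := by
  cases k <;> rfl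

theorem param_ext {p q : CurrentParam} (h : ∀ k, entry p k = entry q k) : p = q :=
  Prod.ext (Prod.ext (h .vec) (Subtype.ext (Matrix.ext fun a b => h (.sl a b))))
    (Prod.ext (Subtype.ext (Matrix.ext fun a b => h (.alt a b)))
      (Subtype.ext (Matrix.ext fun a b => h (.sym a b))))

/-- Rewrite the entries in terms of independent ones. -/
def canon : ParamKey → Comb ParamKey
  | .vec => [(.diff 1 0, .vec)]
  | .sl a b => bif eqbPos a b 3 3 then
      [(.diff 0 1, .sl 0 0), (.diff 0 1, .sl 1 1), (.diff 0 1, .sl 2 2)]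
    else [(.diff 1 0, .sl a b)]
  | .alt a b => bif a.1.blt b.1 then [(.diff 1 0, .alt a b)]
    else bif a.1.beq b.1 then [] else [(.diff 0 1, .alt b a)]
  | .sym a b => bif a.1.ble b.1 then [(.diff 1 0, .sym a b)] else [(.diff 1 0, .sym b a)]

theorem eval_canon (p : CurrentParam) (k : ParamKey) : (canon k).eval (entry p) = entry p k := by
  cases k with
  | vec => simp [canon]
  | sl a b =>
    rw [canon]
    cases h : eqbPos a b 3 3 with
    | false => simp
    | true =>
      obtain ⟨rfl, rfl⟩ := eq_of_eqbPos h
      have hU : ∑ i, p.1.2.1 i i = 0 := p.1.2.2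
      rw [Fin.sum_univ_four] at hU
      simp [entry]
      linear_combination -hU
  | alt a b =>
    have hG : ∀ a b, p.2.1.1 a b = -p.2.1.1 b a := fun a b => congrFun (congrFun p.2.1.2 b) a
    rw [canon]
    cases h : a.1.blt b.1 with
    | true => simp
    | false =>
      cases h' : a.1.beq b.1 with
      | true =>
        obtain rfl : a = b := Fin.ext (Nat.eq_of_beq_eq_true h')
        simpa [entry] using (BLG.eq_zero_of_eq_neg (hG a a)).symm
      | false => simpa [entry] using (hG a b).symm
  | sym a b =>
    have hS : ∀ a b, p.2.2.1 a b = p.2.2.1 b a := fun a b => congrFun (congrFun p.2.2.2 b) a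
    rw [canon]
    cases h : a.1.ble b.1 with
    | true => simp
    | false => simpa [entry] using hS b a

/-- The coefficients of the inverse of `toParam`, as for orthonormal bases. -/
def transposeComb (i : Fin 4 → Fin 4 → ParamKey) (c : DyadicGauss) (S : ℕ) : Comb ParamKey :=
  positions.flatMap fun q => ((paramComb (i q.1 q.2)).filter fun t => t.2.1.beq S).map fun t =>
    (c.mul ⟨t.1.p, t.1.q, t.1.s, t.1.r, t.1.exp⟩, i q.1 q.2)

/-- The independent components of the inverse image of an element of the space of parameters. -/
def invComb (S : ℕ) : Comb ParamKey :=
  bif S.beq 0 then [(⟨1, 0, 0, 0, 1⟩, .vec)] else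
    transposeComb .sl (.diff 1 0) S ++ (transposeComb .alt ⟨1, 0, 0, 0, 2⟩ S ++
      transposeComb .sym (.diff 1 0) S)

/-- The bit mask of a subset of `Fin 6`. -/
def bitMask (S : Finset (Fin 6)) : ℕ := ∑ i ∈ S, 2 ^ (i : ℕ)

theorem bitMask_bitSet : ∀ n < 64, bitMask (bitSet n) = n := by decide +kernel

/-- The masks of the independent components of elements of `E(1|6)`. -/
def isIndep (S : ℕ) : Bool := S.blt 64 && (Nat.ble (bitCard S) 2 || ((bitCard S).beq 3 && S.testBit 0))

/-- Components of degree at most three with given image in the space of parameters. -/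
def ofParamLow (p : CurrentParam) : SuperFun := fun S => (invComb (bitMask S)).eval (entry p)

/-- The chosen preimage is supported on independent masks. These have degree at most three, and of
each complementary pair at most one is independent (`isIndep_bitCompl`), so `ckMap` leaves the
independent components unchanged. -/
theorem invComb_eq_nil : ∀ S < 64, isIndep S = false → (invComb S).isEmpty = true := by
  decide +kernel

theorem isIndep_bitCompl : ∀ S < 64, isIndep S = true → isIndep (bitCompl S) = false := by
  decide +kernel

theorem ofParamLow_bitSet (p : CurrentParam) {S : ℕ} (hS : S < 64) :
    ofParamLow p (bitSet S) = (invComb S).eval (entry p) := by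
  rw [ofParamLow, bitMask_bitSet S hS]

theorem ofParamLow_mem (p : CurrentParam) : ofParamLow p ∈ lowDegree := fun S hS => by
  obtain ⟨U, hU, rfl⟩ := exists_bitSet S
  rw [card_bitSet U hU] at hS
  have h : isIndep U = false := by
    rw [isIndep, Bool.and_eq_false_iff, Bool.or_eq_false_iff]
    refine Or.inr ⟨?_, ?_⟩
    · rw [← Bool.not_eq_true, Nat.ble_eq]; omega
    · rw [Bool.and_eq_false_iff, ← Bool.not_eq_true, Nat.beq_eq]; omega
  rw [ofParamLow_bitSet p hU, List.isEmpty_iff.mp (invComb_eq_nil U hU h), Comb.eval_nil]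

theorem ckMap_ofParamLow (p : CurrentParam) {S : ℕ} (hS : isIndep S = true) :
    ckMap (ofParamLow p) (bitSet S) = (invComb S).eval (entry p) := by
  have hS' : S < 64 := by
    rw [isIndep, Bool.and_eq_true, Nat.blt_eq] at hS
    exact hS.1
  rw [ckMap_bitSet _ hS', jet, ofParamLow_bitSet p hS', ofParamLow_bitSet p (bitCompl_lt hS'),
    List.isEmpty_iff.mp (invComb_eq_nil _ (bitCompl_lt hS') (isIndep_bitCompl S hS' hS)),
    Comb.eval_nil, map_zero, smul_zero, sub_zero]

theorem paramComb_indep :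
    (allKeys fun k => (paramComb k).all fun t => isIndep t.2.1 && t.2.2.beq 0) = true := by
  decide +kernel

/-- This check gives surjectivity of `toParam`, the next one injectivity. Since `toParam` involves
no derivatives, both are statements about constant matrices. -/
theorem isZero_paramComb_invComb : (allKeys fun k =>
    (((paramComb k).subst fun l => (invComb l.1).subst canon).sub (canon k)).isZero eqbKey) = true := by
  decide +kernel

theorem isZero_invComb_paramComb : ∀ S < 64, isIndep S = true →
    (((invComb S).subst paramComb).sub [(.diff 1 0, (S, 0))]).isZero eqb₁ = true := by
  decide +kernel

theorem indep_of_mem {k : ParamKey} {t : DyadicGauss × (ℕ × ℕ)} (ht : t ∈ paramComb k) :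
    isIndep t.2.1 = true ∧ t.2.2 = 0 := by
  have h := List.all_eq_true.mp (of_allKeys paramComb_indep k) t ht
  rw [Bool.and_eq_true, Nat.beq_eq] at h
  exact h

theorem toParam_ckMap_ofParamLow (p : CurrentParam) : toParam (ckMap (ofParamLow p)) = p := by
  refine param_ext fun k => ?_
  rw [entry_toParam, ← eval_canon p k, ← Comb.eval_eq_of_isZero_sub eq_of_eqbKey
    (entry p) (of_allKeys isZero_paramComb_invComb k)]
  refine (Comb.eval_subst_of_mem _ _ _ fun t ht => ?_).symm
  obtain ⟨h1, h2⟩ := indep_of_mem ht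
  rw [Comb.eval_subst _ _ _ (eval_canon p), ← ckMap_ofParamLow p h1, jet, h2]
  rfl

/-- Every dependent component is determined through `E16_apply` by an independent one. -/
theorem isIndep_bitCompl_of_not : ∀ S < 64, isIndep S = false →
    3 ≤ bitCard S ∧ isIndep (bitCompl S) = true := by
  decide +kernel

theorem eq_zero_of_toParam {x : SuperFun} (hx : x ∈ E16) (h : toParam x = 0) : x = 0 := by
  have h0 : ∀ S < 64, isIndep S = true → x (bitSet S) = 0 := fun S hS hi => by
    have e := Comb.eval_eq_of_isZero_sub eq_of_eqb₁ (jet x) (isZero_invComb_paramComb S hS hi)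
    rw [Comb.eval_subst _ (entry (toParam x)) _ (fun k => (entry_toParam x k).symm), h,
      Comb.eval_cons, Comb.eval_nil, add_zero, DyadicGauss.val_diff] at e
    have hz : ∀ L : Comb ParamKey, L.eval (entry 0) = 0 := fun L => by
      rw [Comb.eval_smul_right _ (entry 0) 0 (fun k => ?_), zero_smul]
      cases k <;> exact (zero_smul ℂ _).symm
    rw [hz] at e
    simpa [jet] using e.symm
  funext T
  obtain ⟨S, hS, rfl⟩ := exists_bitSet T
  cases hi : isIndep S with
  | true => exact h0 S hS hi
  | false =>
    obtain ⟨h3, hc⟩ := isIndep_bitCompl_of_not S hS hi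
    rw [E16_apply hx hS h3, jet, h0 _ (bitCompl_lt hS) hc, map_zero, smul_zero]
    rfl

end SuperFun

/-! ## The identification intertwines the brackets -/

namespace SuperFun

/-- The derivative of a linear combination of jets. -/
def derComb (L : Comb (ℕ × ℕ)) : Comb (ℕ × ℕ) := L.map fun t => (t.1, (t.2.1, t.2.2 + 1))

/-- The exchange of the two factors. -/
def swapComb (L : Comb ((ℕ × ℕ) × (ℕ × ℕ))) : Comb ((ℕ × ℕ) × (ℕ × ℕ)) :=
  L.map fun t => (t.1, (t.2.2, t.2.1))

/-- The product of matrices. -/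
def mulComb (A B : CombMat) (a b : Fin 4) : Comb ((ℕ × ℕ) × (ℕ × ℕ)) :=
  (A a 0).prod (B 0 b) ++ ((A a 1).prod (B 1 b) ++ ((A a 2).prod (B 2 b) ++ (A a 3).prod (B 3 b)))

theorem eval_derComb (x : SuperFun) (L : Comb (ℕ × ℕ)) :
    (derComb L).eval (jet x) = Entire.der (L.eval (jet x)) := by
  induction L with
  | nil => simp [derComb]
  | cons t L ih => rw [Comb.eval_cons, map_add, map_smul, ← ih, der_jet]; simp [derComb]

theorem eval_swapComb (x y : SuperFun) (L : Comb ((ℕ × ℕ) × (ℕ × ℕ))) :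
    (swapComb L).eval (jet₂ x y) = L.eval (jet₂ y x) := by
  induction L with
  | nil => simp [swapComb]
  | cons t L ih => rw [Comb.eval_cons, ← ih, jet₂, mul_comm]; simp [swapComb, jet₂]

theorem eval_prod_jet (x y : SuperFun) (L M : Comb (ℕ × ℕ)) :
    (L.prod M).eval (jet₂ x y) = L.eval (jet x) * M.eval (jet y) :=
  Comb.eval_prod (jet x) (jet y) L M

theorem eval_mulComb (x y : SuperFun) (A B : CombMat) (a b : Fin 4) :
    (mulComb A B a b).eval (jet₂ x y) =
      ∑ c, (A a c).eval (jet x) * (B c b).eval (jet y) := by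
  simp only [mulComb, Comb.eval_append, eval_prod_jet, Fin.sum_univ_four, add_assoc]

theorem eval_dualComb (x : SuperFun) (a b : Fin 4) :
    (dualComb a b).eval (jet x) = BLG.dual (toParam x).2.1.1 a b := by
  rw [BLG.dual_eq (toParam x).2.1.2]
  have h : ∀ L : Comb (ℕ × ℕ), (negComb L).eval (jet x) = -L.eval (jet x) := fun L => by
    simp [negComb]
  have e : ∀ i j, (altComb i j).eval (jet x) = (toParam x).2.1.1 i j := fun _ _ => rfl
  fin_cases a <;> fin_cases b <;> first
    | rfl
    | exact (h _)

/-- The polarized Pfaffian of `Γ`. -/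
def pfComb : Comb ((ℕ × ℕ) × (ℕ × ℕ)) :=
  ((altComb 0 1).prod (altComb 2 3) ++ ((altComb 2 3).prod (altComb 0 1) ++
    ((altComb 0 3).prod (altComb 1 2) ++ (altComb 1 2).prod (altComb 0 3)))).sub
  ((altComb 0 2).prod (altComb 1 3) ++ (altComb 1 3).prod (altComb 0 2))

theorem eval_pfComb (x y : SuperFun) :
    pfComb.eval (jet₂ x y) = BLG.pf (toParam x).2.1.1 (toParam y).2.1.1 := by
  have e : ∀ z : SuperFun, ∀ i j, (altComb i j).eval (jet z) = (toParam z).2.1.1 i j :=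
    fun _ _ _ => rfl
  simp only [pfComb, Comb.eval_append, Comb.eval_sub, eval_prod_jet, e, BLG.pf]
  ring

/-- The transposed product `Uᵀ * B`. -/
def transposeMulComb (B : CombMat) : Fin 4 → Fin 4 → Comb ((ℕ × ℕ) × (ℕ × ℕ)) :=
  mulComb (fun a b => slComb b a) B

/-- The part of `paramBracket` to be antisymmetrized. -/
def skewComb : ParamKey → Comb ((ℕ × ℕ) × (ℕ × ℕ))
  | .vec => vecComb.prod (derComb vecComb)
  | .sl a b => vecComb.prod (derComb (slComb a b)) ++ mulComb slComb slComb a b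
  | .alt a b => vecComb.prod (derComb (altComb a b)) ++
      ((derComb vecComb).prod (altComb a b)).smul ⟨0, 1, 0, 0, 1⟩ ++
      (mulComb slComb altComb a b).sub (mulComb slComb altComb b a)
  | .sym a b => vecComb.prod (derComb (symComb a b)) ++
      ((derComb vecComb).prod (symComb a b)).smul ⟨1, 0, 0, 0, 1⟩ ++
      (mulComb (fun a b => derComb (slComb b a)) dualComb a b ++
        mulComb (fun a b => derComb (slComb b a)) dualComb b a).smul ⟨0, 1, 0, 0, 1⟩ ++
      (transposeMulComb symComb a b ++ transposeMulComb symComb b a).smul (.diff 0 1)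

/-- The bracket of the odd parameters, before symmetrization. -/
def oddComb : ParamKey → Comb ((ℕ × ℕ) × (ℕ × ℕ))
  | .vec => pfComb.smul ⟨0, 1, 0, 0, 1⟩
  | .sl a b => (mulComb altComb (fun a b => derComb (dualComb a b)) a b).smul ⟨1, 0, 0, 0, 1⟩ ++
      ((bif a.1.beq b.1 then (leibniz pfComb).smul ⟨1, 0, 0, 0, 3⟩ else []) ++
      (mulComb altComb symComb a b).smul (.diff 0 1))
  | _ => []

/-- The entries of `paramBracket`. -/
def paramBracketComb (k : ParamKey) : Comb ((ℕ × ℕ) × (ℕ × ℕ)) :=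
  skewComb k ++ (swapComb (skewComb k)).smul (.diff 0 1) ++ (oddComb k ++ swapComb (oddComb k))

theorem val_half : (DyadicGauss.mk 1 0 0 0 1).val = 1 / 2 := by simp [DyadicGauss.val]

theorem val_neg_half : (DyadicGauss.mk 0 1 0 0 1).val = -(1 / 2) := by
  simp [DyadicGauss.val]; norm_num

theorem val_eighth : (DyadicGauss.mk 1 0 0 0 3).val = 1 / 8 := by
  simp [DyadicGauss.val]; norm_num

/-- The bracket is an antisymmetrised part plus a symmetrised part for two odd parameters. The
Pfaffian is already symmetric, so its coefficients in `oddComb` are half those of `paramBracket`. -/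
theorem eval_paramBracketComb (x y : SuperFun) (k : ParamKey) :
    (paramBracketComb k).eval (jet₂ x y) =
      entry (BLG.paramBracket (toParam x) (toParam y)) k := by
  have eV : ∀ z : SuperFun, vecComb.eval (jet z) = (toParam z).1.1 := fun _ => rfl
  have eU : ∀ z : SuperFun, ∀ a b, (slComb a b).eval (jet z) = (toParam z).1.2.1 a b :=
    fun _ _ _ => rfl
  have eG : ∀ z : SuperFun, ∀ a b, (altComb a b).eval (jet z) = (toParam z).2.1.1 a b :=
    fun _ _ _ => rfl
  have eS : ∀ z : SuperFun, ∀ a b, (symComb a b).eval (jet z) = (toParam z).2.2.1 a b :=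
    fun _ _ _ => rfl
  have tG : ∀ z : SuperFun, ∀ a b, (toParam z).2.1.1 a b = -(toParam z).2.1.1 b a := fun z a b =>
    congrFun (congrFun (toParam z).2.1.2 b) a
  have tS : ∀ z : SuperFun, ∀ a b, (toParam z).2.2.1 a b = (toParam z).2.2.1 b a := fun z a b =>
    congrFun (congrFun (toParam z).2.2.2 b) a
  have tD : ∀ z : SuperFun, ∀ a b, BLG.dual (toParam z).2.1.1 a b =
      -BLG.dual (toParam z).2.1.1 b a := fun z a b =>
    congrFun (congrFun (BLG.dual_transpose (G := (toParam z).2.1.1)) b) a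
  cases k with
  | vec =>
    simp only [paramBracketComb, skewComb, oddComb, Comb.eval_append, Comb.eval_smul, eval_swapComb,
      eval_prod_jet, eval_derComb, eval_pfComb, eV, entry, BLG.paramBracket, val_neg_half,
      DyadicGauss.val_diff, Nat.cast_zero, Nat.cast_one]
    rw [BLG.pf_comm (toParam y).2.1.1, mul_comm (Entire.der (toParam x).1.1)]
    module
  | sl a b =>
    have hb : ∀ z w : SuperFun, ∀ L : Comb ((ℕ × ℕ) × (ℕ × ℕ)),
        Comb.eval (jet₂ z w) (bif a.1.beq b.1 then L else []) =
          L.eval (jet₂ z w) * (1 : Matrix (Fin 4) (Fin 4) Entire) a b := by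
      intro z w L
      cases h : a.1.beq b.1 with
      | true =>
        obtain rfl : a = b := Fin.ext (Nat.eq_of_beq_eq_true h)
        rw [Matrix.one_apply_eq, mul_one]; rfl
      | false =>
        rw [Matrix.one_apply_ne (fun e => Nat.ne_of_beq_eq_false h (congrArg Fin.val e)), mul_zero]
        rfl
    simp only [paramBracketComb, skewComb, oddComb, Comb.eval_append, Comb.eval_smul, eval_swapComb,
      eval_prod_jet, eval_derComb, eval_pfComb, eval_mulComb, eval_dualComb, eval_leibniz, hb,
      eV, eU, eG, eS, entry, BLG.paramBracket, BLG.scal, val_half, val_eighth,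
      DyadicGauss.val_diff, Nat.cast_zero, Nat.cast_one, Matrix.sub_apply, Matrix.add_apply,
      Matrix.smul_apply, Matrix.mul_apply, BLG.der_apply, smul_eq_mul, smul_mul_assoc]
    rw [BLG.pf_comm (toParam y).2.1.1]
    module
  | alt a b =>
    have hT : ∀ z w : SuperFun, ∑ j, (toParam w).2.1.1 a j * (toParam z).1.2.1 b j =
        -∑ j, (toParam z).1.2.1 b j * (toParam w).2.1.1 j a := fun z w => by
      rw [← Finset.sum_neg_distrib]
      exact Finset.sum_congr rfl fun j _ => by rw [tG w a j]; ring
    simp only [paramBracketComb, skewComb, oddComb, Comb.eval_append, Comb.eval_smul, Comb.eval_sub,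
      eval_swapComb, eval_prod_jet, eval_derComb, eval_mulComb, Comb.eval_nil,
      eV, eU, eG, entry, BLG.paramBracket, val_neg_half,
      DyadicGauss.val_diff, Nat.cast_zero, Nat.cast_one, Matrix.sub_apply, Matrix.add_apply,
      Matrix.smul_apply, Matrix.mul_apply, Matrix.transpose_apply, BLG.der_apply, smul_eq_mul, hT]
    module
  | sym a b =>
    have hT : ∀ z w : SuperFun, ∑ j, (toParam w).2.2.1 a j * (toParam z).1.2.1 j b =
        ∑ j, (toParam z).1.2.1 j b * (toParam w).2.2.1 j a := fun z w =>
      Finset.sum_congr rfl fun j _ => by rw [tS w a j]; ring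
    have hD : ∀ z w : SuperFun,
        ∑ j, BLG.dual (toParam w).2.1.1 a j * Entire.der ((toParam z).1.2.1 j b) =
        -∑ j, Entire.der ((toParam z).1.2.1 j b) * BLG.dual (toParam w).2.1.1 j a := fun z w => by
      rw [← Finset.sum_neg_distrib]
      exact Finset.sum_congr rfl fun j _ => by rw [tD w a j]; ring
    simp only [paramBracketComb, skewComb, oddComb, transposeMulComb, Comb.eval_append,
      Comb.eval_smul, eval_swapComb, eval_prod_jet, eval_derComb, eval_mulComb, eval_dualComb,
      Comb.eval_nil, eV, eU, eS, entry, BLG.paramBracket, val_half, val_neg_half,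
      DyadicGauss.val_diff, Nat.cast_zero, Nat.cast_one, Matrix.sub_apply, Matrix.add_apply,
      Matrix.smul_apply, Matrix.mul_apply, Matrix.transpose_apply, BLG.der_apply, smul_eq_mul, hT,
      hD]
    module

/-- The entries of the image of the contact bracket. -/
def contactComb (k : ParamKey) : Comb ((ℕ × ℕ) × (ℕ × ℕ)) :=
  (paramComb k).subst fun l => bracketComb l.1

theorem eval_contactComb (x y : SuperFun) (k : ParamKey) :
    (contactComb k).eval (jet₂ x y) = entry (toParam (contactBracket x y)) k := by
  rw [entry_toParam]
  refine Comb.eval_subst_of_mem _ _ _ fun t ht => ?_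
  obtain ⟨h1, h2⟩ := indep_of_mem ht
  rw [isIndep, Bool.and_eq_true, Nat.blt_eq] at h1
  rw [← contactBracket_bitSet x y h1.1, jet, h2]
  rfl

end SuperFun

/-! ### Agreement of the contact bracket with the bracket of parameters -/

namespace SuperFun

/-- The independent entries. -/
def isCanon : ParamKey → Bool
  | .vec => true
  | .sl a b => !eqbPos a b 3 3
  | .alt a b => a.1.blt b.1
  | .sym a b => a.1.ble b.1

theorem isCanon_canon : (allKeys fun k => (canon k).all fun t => isCanon t.2) = true := by
  decide +kernel

/-- The comparison is made on the 1 + 15 + 6 + 10 independent entries only; the other entries of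
both sides follow by trace and symmetry conditions. -/
theorem isZero_contactComb_sub : (allKeys fun k => !isCanon k ||
    (((contactComb k).sub (paramBracketComb k)).subst reduce₂).isZero eqb₂ hash₂) = true := by
  decide +kernel

theorem toParam_contactBracket {x y : SuperFun} (hx : x ∈ E16) (hy : y ∈ E16) :
    toParam (contactBracket x y) = BLG.paramBracket (toParam x) (toParam y) := by
  refine param_ext fun k => ?_
  rw [← eval_canon, ← eval_canon (BLG.paramBracket _ _)]
  -- Both sides are now the same canonical combination of independent entries, so they are compared
  -- term by term.
  refine congrArg List.sum (List.map_congr_left fun t ht => congrArg (t.1.val • ·) ?_)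
  have hc := List.all_eq_true.mp (of_allKeys isCanon_canon k) t ht
  have h := of_allKeys isZero_contactComb_sub t.2
  rw [hc, Bool.not_true, Bool.false_or] at h
  have e := Comb.eval_eq_zero eq_of_eqb₂ (jet₂ x y) h
  rw [eval_reduce₂ hx hy, Comb.eval_sub, sub_eq_zero] at e
  rw [← eval_contactComb, e, eval_paramBracketComb]

/-- The parity of an entry. -/
def keyParity : ParamKey → ℕ
  | .vec => 0
  | .sl _ _ => 0
  | .alt _ _ => 1
  | .sym _ _ => 1

theorem paramComb_parity : (allKeys fun k => (paramComb k).all fun t =>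
    (bitCard t.2.1 % 2).beq (keyParity k)) = true := by
  decide +kernel

theorem entry_toParam_eq_zero {x : SuperFun} {k : ParamKey}
    (h : ∀ t ∈ paramComb k, x (bitSet t.2.1) = 0) : entry (toParam x) k = 0 := by
  have e := Comb.eval_subst_of_mem (jet x) (jet x) (fun _ => []) (L := paramComb k) fun t ht => by
    rw [jet, h t ht, map_zero]; rfl
  rw [entry_toParam, ← e]
  induction paramComb k with
  | nil => rfl
  | cons t L ih => exact ih

theorem card_bitSet_of_mem {k : ParamKey} {t : DyadicGauss × (ℕ × ℕ)} (ht : t ∈ paramComb k) :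
    (bitSet t.2.1).card % 2 = keyParity k := by
  have h1 := (indep_of_mem ht).1
  rw [isIndep, Bool.and_eq_true, Nat.blt_eq] at h1
  rw [card_bitSet _ h1.1]
  exact Nat.eq_of_beq_eq_true (List.all_eq_true.mp (of_allKeys paramComb_parity k) t ht)

theorem toParam_snd_of_isEven {x : SuperFun} (hx : x.IsEven) : (toParam x).2 = 0 := by
  have h : ∀ k, keyParity k = 1 →
      entry (toParam x) k = 0 := fun k hk => entry_toParam_eq_zero fun t ht =>
    hx _ (by rw [Nat.odd_iff, card_bitSet_of_mem ht, hk])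
  exact Prod.ext (Subtype.ext (Matrix.ext fun a b => h (.alt a b) rfl))
    (Subtype.ext (Matrix.ext fun a b => h (.sym a b) rfl))

theorem toParam_fst_of_isOdd {x : SuperFun} (hx : x.IsOdd) : (toParam x).1 = 0 := by
  have h : ∀ k, keyParity k = 0 →
      entry (toParam x) k = 0 := fun k hk => entry_toParam_eq_zero fun t ht =>
    hx _ (by rw [Nat.even_iff, card_bitSet_of_mem ht, hk])
  exact Prod.ext (h .vec rfl) (Subtype.ext (Matrix.ext fun a b => h (.sl a b) rfl))

theorem toParam_bijective : Function.Bijective (toParam ∘ₗ E16.subtype) := by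
  refine ⟨(injective_iff_map_eq_zero _).mpr fun x h => Subtype.ext (eq_zero_of_toParam x.2 h),
    fun p => ⟨⟨ckMap (ofParamLow p), ofParamLow p, ofParamLow_mem p, rfl⟩,
      toParam_ckMap_ofParamLow p⟩⟩

/-- `E(1|6)` is isomorphic to the space of parameters. -/
def paramEquiv : E16 ≃ₗ[ℂ] CurrentParam := LinearEquiv.ofBijective _ toParam_bijective

end SuperFun

end

theorem mainTheorem1 (m : ℕ) (k : Fin m → ℂ) (hk : ∀ c, k c ≠ 0) :
    ∃ Φ : E16 ≃ₗ[ℂ] CurrentParam,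
      -- the identification of `E(1|6)` with the space of parameters preserves parity
      (∀ x : E16, SuperFun.IsEven (x : SuperFun) → (Φ x).2 = 0) ∧
      (∀ x : E16, SuperFun.IsOdd (x : SuperFun) → (Φ x).1 = 0) ∧
      -- all currents are `Q_HT`-closed
      (∀ x : E16, BLG.QClosed k (BLG.current k (Φ x))) ∧
      (∀ x : E16, BLG.QClosed k (BLG.currentHat k (Φ x))) ∧
      -- both families of currents agree up to `Q_HT`-exact functionals
      (∀ x : E16, BLG.QExact k (BLG.currentHat k (Φ x) - BLG.current k (Φ x))) ∧
      -- `E(1|6)` is closed under the contact bracket, and the BV brackets of the currents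
      -- reproduce it: strictly for the covariant stress tensor, up to `Q_HT`-exact functionals
      -- for the other one
      (∀ x y : E16, ∃ hxy : SuperFun.contactBracket x y ∈ E16,
        locInt (Density.lieBV (BLG.currentHat k (Φ x)) (BLG.currentHat k (Φ y)))
          = locInt (BLG.currentHat k (Φ ⟨SuperFun.contactBracket x y, hxy⟩)) ∧
        BLG.QExact k (Density.lieBV (BLG.current k (Φ x)) (BLG.current k (Φ y))
          - BLG.current k (Φ ⟨SuperFun.contactBracket x y, hxy⟩))) := by
  -- Through this identity the contact bracket inherits both statements already known for
  -- `paramBracket`.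
  have h : ∀ x y : E16, ∀ hxy, SuperFun.paramEquiv ⟨SuperFun.contactBracket x y, hxy⟩ =
      BLG.paramBracket (SuperFun.paramEquiv x) (SuperFun.paramEquiv y) := fun x y _ =>
    SuperFun.toParam_contactBracket x.2 y.2
  refine ⟨SuperFun.paramEquiv, fun x hx => SuperFun.toParam_snd_of_isEven hx,
    fun x hx => SuperFun.toParam_fst_of_isOdd hx, fun x => BLG.qClosed_current hk _,
    fun x => BLG.qClosed_currentHat hk _, fun x => BLG.qExact_currentHat_sub_current hk _,
    fun x y => ⟨SuperFun.contactBracket_mem_E16 x.2 y.2, ?_, ?_⟩⟩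
  · rw [h]
    exact BLG.locInt_lieBV_currentHat k _ _
  · rw [h]
    exact BLG.qExact_lieBV_current hk _ _
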